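/- Notation. Let $e(z)=\exp(2\pi i z)$, $q^n=e(n\tau)$, and let $z^{r}=\exp(r\log z)$ with $-\pi<\operatorname{Im}\log z\le\pi$. The double cover $\widetilde{\Gamma_0(N)}$ consists of the pairs $(\gamma,\varepsilon\sqrt{c\tau+d})$, written $(\gamma,\varepsilon)$, with $\gamma=\begin{pmatrix}a&b\\c&d\end{pmatrix}\in\Gamma_0(N)$ and $\varepsilon=\pm1$; put $\widetilde\gamma=(\gamma,1)$, and define $\widetilde{\mathrm{SL}_2(\mathbb Z)}$ likewise. For $k\in\frac12\mathbb Z$ put $f|_k(\gamma,\varepsilon)(\tau)=(\varepsilon\sqrt{c\tau+d})^{-2k}f\left(\frac{a\tau+b}{c\tau+d}\right)$. A meromorphic function $f$ on the upper half-plane is a meromorphic modular form of weight $k$ on $\Gamma_0(N)$ with character $\chi$ if $f|_k\gamma=\chi(\gamma)f$ for all $\gamma\in\widetilde{\Gamma_0(N)}$ and if, for every $\gamma\in\widetilde{\mathrm{SL}_2(\mathbb Z)}$, $f|_k\gamma$ has, for $\operatorname{Im}\tau$ large, an expansion $\sum_{n\in m^{-1}\mathbb Z,\ n\ge n_0}c_nq^n$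 with some $m\in\mathbb Z_{\ge1}$ and some $n_0$. Let $N\ge1$, let $\mathbf r=(r_n)_{n\mid N}$ be integers, and set $k'=\frac12\sum_{n\mid N}r_n$, $x_N=\sum_{n\mid N}nr_n$ and $\varPi=\prod_{n\mid N}(N/n)^{|r_n|}$. The character of $\prod_{n\mid N}\eta(n\tau)^{r_n}$ on $\widetilde{\Gamma_0(N)}$ is $$\chi_{\mathbf r}\left(\begin{pmatrix}a&b\\c&d\end{pmatrix},\varepsilon\right)=\varepsilon^{-2k'}e\left(\tfrac1{24}\sum_{n\mid N}r_n\Psi\begin{pmatrix}a&bn\\c/n&d\end{pmatrix}\right),$$ where $\Psi\begin{pmatrix}a&b\\c&d\end{pmatrix}$ equals $\frac{a+d}c+12s(-d,c)-3$ if $c>0$, $\frac{a+d}c+12s(d,-c)+3$ if $c<0$, $b$ if $c=0<a$, and $-b-6$ if $c=0>a$. Here $s(h,m)=\sum_{j\bmod m}((j/m))((hj/m))$ is the Dedekind sum, with $((t))=t-\lfloor t\rfloor-\frac12$ for $t\notin\mathbb Z$ and $((t))=0$ for $t\in\mathbb Z$. Let $m_{\mathbf r}=24/\gcd\left(24,\sum_{n\mid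 N}\frac Nn r_n,\sum_{n\mid N}nr_n\right)$, and let $L_{\mathbf r}$ be the set of positive integers $l\equiv1\pmod{m_{\mathbf r}}$ which, if $k'\notin\mathbb Z$, are moreover perfect squares. For $l\in L_{\mathbf r}$ and $k\in k'+2\mathbb Z$ put $$T_lf(\tau)=l^{-k/2}\sum_{\substack{a\mid l\\(a,N)=1}}a^k\sum_{\substack{0\le b<d\\(a,b,d)=1}}\chi_{\mathbf r}\widetilde{\begin{pmatrix}-Nb+ax&z\\-Nd&y\end{pmatrix}}^{-1}\chi_{\mathbf r}\widetilde{\begin{pmatrix}ay&by-dz\\N&x\end{pmatrix}}^{-1}f\left(\frac{a\tau+b}d\right),$$ where $a>0$, $d=l/a$, and $x,y,z$ are any integers (depending on $a,b,d$) with $(-Nb+ax)y+Ndz=1$. Let $\left(\frac{\cdot}{\cdot}\right)$ denote the Kronecker--Jacobi symbol. **Theorem 9.7.** Let $f$ be a meromorphic modular form on $\Gamma_0(N)$ of weight $k\in k'+2\mathbb Z$ with character $\chi_{\mathbf r}$, and let $l\in L_{\mathbf r}$. Then, for every choice of the integers $x,y,z$ in the definition of $T_l$: (a) there are a real number $Y_0\ge0$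 and uniquely determined complex numbers $c_f(n)$, $c_{T_lf}(n)$ such that, for $\operatorname{Im}\tau>Y_0$, $$f(\tau)=\sum_{n\in\frac{x_N}{24}+\mathbb Z}c_f(n)q^n,\qquad T_lf(\tau)=\sum_{n\in\frac{x_N}{24}+\mathbb Z}c_{T_lf}(n)q^n;$$ (b) for every $n\in\frac{x_N}{24}+\mathbb Z$, with $c_f(t)=0$ for $t\notin\frac{x_N}{24}+\mathbb Z$, $$c_{T_lf}(n)=l^{-k/2}\sum_{\substack{a\mid l,\ d=l/a\\(a,N)=1}}\left(\frac a{\varPi}\right)a^k\,c_f\left(\frac{ln}{a^2}\right)\sum_{\substack{0\le b<d\\(a,b,d)=1}}\left(\frac{-Nb}{(a,d)}\right)^{2k}e\left(bd\left(\frac nl-\frac{x_N}{24}\right)\right)\psi_{l,\mathbf r}(a,b),$$ where $$\psi_{l,\mathbf r}(a,b)=\begin{cases}e\left(-\frac{k+\delta}4(d-1)+\frac{(k+\delta)(l-1)(N-1)}4\right)&\text{if }2\nmid l,\\[2pt] e\left(-\frac{k+\delta}4(a-1)-\frac{N(k+\delta)(1+\delta_1)}4b\right)&\text{if }2\mid l,\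 2\mid N,\\[2pt] 1&\text{if }2\mid l,\ 2\nmid N.\end{cases}$$ Here $\delta=0$ if the odd part of $\varPi$ is $\equiv1\pmod4$ and $\delta=1$ if it is $\equiv3\pmod4$; and $\delta_1=1$ if $2\mid l$, $4\mid N$, $k\in\frac12+\mathbb Z$ and the exponent of $2$ in $\varPi$ is odd, and $\delta_1=0$ otherwise. -/

import Mathlib

open scoped MatrixGroups

namespace EtaHecke

open UpperHalfPlane

/-- `e z = exp (2 π i z)`. -/
noncomputable def e (z : ℂ) : ℂ := Complex.exp (2 * Real.pi * Complex.I * z)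

/-- The Kronecker–Jacobi symbol `(m / n)` for arbitrary integers `m`, `n`: it is completely
multiplicative in `n ≠ 0`, is the Legendre symbol at odd primes, `(m / 2) = χ₈ m`,
`(m / -1)` is the sign of `m` (with value `1` at `0`), and `(m / 0)` is `1` exactly for `m = ± 1`. -/
def kronecker (m n : ℤ) : ℤ :=
  if n = 0 then (if m.natAbs = 1 then 1 else 0)
  else (if n < 0 ∧ m < 0 then -1 else 1)
    * ZMod.χ₈ (m : ZMod 8) ^ (padicValNat 2 n.natAbs)
    * jacobiSym m (n.natAbs / 2 ^ padicValNat 2 n.natAbs)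

/-- The sawtooth function `((x))`. -/
def sawtooth (x : ℚ) : ℚ := if Int.fract x = 0 then 0 else Int.fract x - 1 / 2

/-- The Dedekind sum `s(h, k)`, for `k ≥ 1`. -/
def dedekindSum (h : ℤ) (k : ℕ) : ℚ :=
  ∑ r ∈ Finset.range k, sawtooth ((r : ℚ) / k) * sawtooth ((h : ℚ) * r / k)

/-- The Dedekind–Rademacher function `Ψ` of the matrix `(a, b; c, d)` of `SL₂(ℤ)`. -/
def Psi (a b c d : ℤ) : ℚ :=
  if 0 < c then ((a : ℚ) + d) / c + 12 * dedekindSum (-d) c.natAbs - 3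
  else if c < 0 then ((a : ℚ) + d) / c + 12 * dedekindSum d c.natAbs + 3
  else if 0 < a then (b : ℚ)
  else -(b : ℚ) - 6

/-- The character `χ_r` of the eta-quotient `∏_{n ∣ N} η(n τ) ^ (r n)` at the element
`(M, ε √(c τ + d))` of the double cover of `Γ₀(N)`, where `M = (a, b; c, d) ∈ Γ₀(N)`:
`ε ^ (-∑ r n) * e ((1 / 24) ∑ (r n) Ψ(a, b n; c / n, d))`. The division `c / n` is exact. -/
noncomputable def etaChar (N : ℕ) (r : ℕ → ℤ) (M : Matrix (Fin 2) (Fin 2) ℤ) (ε : ℤˣ) : ℂ :=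
  ((ε : ℤ) : ℂ) ^ (-∑ n ∈ N.divisors, r n) *
    e ((((1 / 24 : ℚ) * ∑ n ∈ N.divisors,
      (r n : ℚ) * Psi (M 0 0) (M 0 1 * n) (M 1 0 / n) (M 1 1) : ℚ)) : ℂ)

/-- The slash operator of weight `w / 2` on functions on the upper half-plane, for the element
`(γ, ε √(c τ + d))` of the double cover of `SL₂(ℤ)` (principal branch of the square root). -/
noncomputable def slash (w : ℤ) (γ : SL(2, ℤ)) (ε : ℤˣ) (f : ℍ → ℂ) (τ : ℍ) : ℂ :=
  (((ε : ℤ) : ℂ) * (((γ 1 0 : ℤ) : ℂ) * (τ : ℂ) + ((γ 1 1 : ℤ) : ℂ)) ^ (1 / 2 : ℂ)) ^ (-w)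
    * f (γ • τ)

/-- `g` has an expansion in powers of `q ^ (1 / m)`, for some `m ≥ 1`, on some half-plane
`Im τ > Y`, with only finitely many negative exponents, i.e. its order at `i ∞` is `> -∞`. -/
def MeromorphicAtInfty (g : ℍ → ℂ) : Prop :=
  ∃ (m : ℕ) (Y : ℝ) (n₀ : ℤ) (c : ℤ → ℂ), 1 ≤ m ∧ 0 < Y ∧ (∀ n < n₀, c n = 0) ∧
    ∀ τ : ℍ, Y < τ.im → HasSum (fun n : ℤ => c n * e ((n : ℂ) * (τ : ℂ) / m)) (g τ)

/-- Meromorphic modular forms of weight `w / 2` on `Γ₀(N)` with character `χ`, a function on the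
double cover of `Γ₀(N)`. An element of the field of meromorphic functions on the upper half-plane
is represented by its unique representative in normal form (the one that takes the analytic value
wherever the singularity is removable, and the value `0` at the poles), so that identities between
such functions hold pointwise. -/
structure IsMeromorphicModularForm (N : ℕ) (w : ℤ)
    (χ : Matrix (Fin 2) (Fin 2) ℤ → ℤˣ → ℂ) (f : ℍ → ℂ) : Prop where
  meromorphic : MeromorphicNFOn (fun z : ℂ => f (ofComplex z)) {z : ℂ | 0 < z.im}
  slash_eq : ∀ γ ∈ CongruenceSubgroup.Gamma0 N, ∀ (ε : ℤˣ) (τ : ℍ),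
    slash w γ ε f τ = χ γ.1 ε * f τ
  cusps : ∀ (γ : SL(2, ℤ)) (ε : ℤˣ), MeromorphicAtInfty (slash w γ ε f)

/-- `m_r = 24 / gcd(24, ∑ (N / n) r_n, ∑ n r_n)`. -/
def modulusR (N : ℕ) (r : ℕ → ℤ) : ℕ :=
  24 / Nat.gcd 24 (Int.gcd (∑ n ∈ N.divisors, ((N / n : ℕ) : ℤ) * r n)
    (∑ n ∈ N.divisors, (n : ℤ) * r n))

/-- The monoid `L_r` of positive integers `l ≡ 1 mod m_r`, which are moreover required to be
perfect squares when `k' = (1 / 2) ∑ r_n` is not an integer. -/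
def monoidL (N : ℕ) (r : ℕ → ℤ) : Set ℕ :=
  {l | 1 ≤ l ∧ l ≡ 1 [MOD modulusR N r] ∧ (Odd (∑ n ∈ N.divisors, r n) → IsSquare l)}

/-- The positive divisors `a` of `l` that are coprime to `N`. -/
def indexA (N l : ℕ) : Finset ℕ := l.divisors.filter fun a => Nat.Coprime a N

/-- For `d = l / a`, the integers `0 ≤ b < d` with `gcd(a, b, d) = 1`. -/
def indexB (l a : ℕ) : Finset ℕ :=
  (Finset.range (l / a)).filter fun b => Nat.gcd (Nat.gcd a b) (l / a) = 1

/-- `x`, `y`, `z` is an admissible choice of integers, depending on `a`, `b` and `d = l / a`, in the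
definition of `T_l`: `(-N b + a x) y + N d z = 1` (so that `-N b + a x` and `N d` are coprime). -/
def IsChoice (N l : ℕ) (x y z : ℕ → ℕ → ℤ) : Prop :=
  ∀ a ∈ indexA N l, ∀ b ∈ indexB l a,
    (-(N : ℤ) * b + a * x a b) * y a b + N * ((l / a : ℕ) : ℤ) * z a b = 1

/-- The generalized double coset operator `T_l` in weight `w / 2`, with `χ = χ'`, formed with the
integers `x`, `y`, `z`. -/
noncomputable def heckeT (N l : ℕ) (w : ℤ) (χ : Matrix (Fin 2) (Fin 2) ℤ → ℤˣ → ℂ)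
    (x y z : ℕ → ℕ → ℤ) (f : ℍ → ℂ) (τ : ℍ) : ℂ :=
  (l : ℂ) ^ (-((w : ℂ) / 2) / 2) * ∑ a ∈ indexA N l, (a : ℂ) ^ ((w : ℂ) / 2) *
    ∑ b ∈ indexB l a,
      (χ !![-(N : ℤ) * b + a * x a b, z a b; -(N : ℤ) * ((l / a : ℕ) : ℤ), y a b] 1)⁻¹ *
      (χ !![(a : ℤ) * y a b, (b : ℤ) * y a b - ((l / a : ℕ) : ℤ) * z a b; (N : ℤ), x a b] 1)⁻¹ *
      f (ofComplex (((a : ℂ) * (τ : ℂ) + b) / ((l / a : ℕ) : ℂ)))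

/-- On `Im τ > Y` we have `g(τ) = ∑_{n ∈ s + ℤ} c(n) q ^ n`; the function `c` is extended by `0`
outside `s + ℤ`. -/
def IsQExpansion (s : ℚ) (Y : ℝ) (g : ℍ → ℂ) (c : ℚ → ℂ) : Prop :=
  (∀ n : ℚ, (¬ ∃ j : ℤ, n = s + j) → c n = 0) ∧
    ∀ τ : ℍ, Y < τ.im →
      HasSum (fun j : ℤ => c (s + j) * e (((s + j : ℚ) : ℂ) * (τ : ℂ))) (g τ)

/-- `x_N = ∑ n r_n`. -/
def xN (N : ℕ) (r : ℕ → ℤ) : ℤ := ∑ n ∈ N.divisors, (n : ℤ) * r n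

/-- `Π = ∏ (N / n) ^ |r_n|`. -/
def bigPi (N : ℕ) (r : ℕ → ℤ) : ℕ := ∏ n ∈ N.divisors, (N / n) ^ (r n).natAbs

/-- `δ`: it is `1` if the odd part of `Π` is `3` modulo `4`, and `0` if it is `1` modulo `4`. -/
def delta (N : ℕ) (r : ℕ → ℤ) : ℕ :=
  if (bigPi N r / 2 ^ padicValNat 2 (bigPi N r)) % 4 = 3 then 1 else 0

/-- `δ₁`: it is `1` if `2 ∣ l`, `4 ∣ N`, the weight `w / 2` is not an integer, and the exponent of
`2` in `Π` is odd, and `0` otherwise. -/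
def delta₁ (N l : ℕ) (r : ℕ → ℤ) (w : ℤ) : ℕ :=
  if 2 ∣ l ∧ 4 ∣ N ∧ Odd w ∧ Odd (padicValNat 2 (bigPi N r)) then 1 else 0

/-- The root of unity `ψ_{l,r}(a, b)`, with `k = w / 2` and `d = l / a`. -/
noncomputable def psi (N l : ℕ) (r : ℕ → ℤ) (w : ℤ) (a b : ℕ) : ℂ :=
  if ¬ 2 ∣ l then
    e (-((w : ℂ) / 2 + delta N r) / 4 * (((l / a : ℕ) : ℂ) - 1)
      + ((w : ℂ) / 2 + delta N r) * ((l : ℂ) - 1) * ((N : ℂ) - 1) / 4)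
  else if 2 ∣ N then
    e (-((w : ℂ) / 2 + delta N r) / 4 * ((a : ℂ) - 1)
      - (N : ℂ) * ((w : ℂ) / 2 + delta N r) * (1 + delta₁ N l r w) / 4 * b)
  else 1

/-- Admissible choices of `x`, `y`, `z` in the definition of `T_l` exist. -/
theorem exists_isChoice (N l : ℕ) (hN : 0 < N) :
    ∃ x y z : ℕ → ℕ → ℤ, IsChoice N l x y z := by
  have key : ∀ a b : ℕ, ∃ t : ℤ × ℤ × ℤ, a ∈ indexA N l → b ∈ indexB l a →
      (-(N : ℤ) * b + a * t.1) * t.2.1 + N * ((l / a : ℕ) : ℤ) * t.2.2 = 1 := by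
    intro a b
    by_cases h : a ∈ indexA N l ∧ b ∈ indexB l a
    swap
    · exact ⟨0, fun ha hb => absurd ⟨ha, hb⟩ h⟩
    obtain ⟨ha, hb⟩ := h
    simp only [indexA, indexB, Finset.mem_filter, Nat.mem_divisors, Finset.mem_range] at ha hb
    obtain ⟨⟨hal, -⟩, haN⟩ := ha
    obtain ⟨hbd, hg⟩ := hb
    set d := l / a with hd
    have hd0 : 0 < d := by omega
    let X : ℕ := ∏ p ∈ (N * d).primeFactors.filter (fun p => ¬ p ∣ N * b), p
    have hco : IsCoprime (-(N : ℤ) * b + a * (X : ℤ)) ((N * d : ℕ) : ℤ) := by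
      rw [Int.isCoprime_iff_gcd_eq_one]
      by_contra hne
      obtain ⟨p, hp, hpd⟩ := Nat.exists_prime_and_dvd hne
      have h1 : (p : ℤ) ∣ -(N : ℤ) * b + a * (X : ℤ) :=
        (Int.natCast_dvd_natCast.2 hpd).trans (Int.gcd_dvd_left ..)
      have h2 : p ∣ N * d := by
        have := (Int.natCast_dvd_natCast.2 hpd).trans
          (Int.gcd_dvd_right (-(N : ℤ) * b + a * (X : ℤ)) ((N * d : ℕ) : ℤ))
        exact Int.natCast_dvd_natCast.1 this
      have hmem : p ∈ (N * d).primeFactors :=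
        Nat.mem_primeFactors.2 ⟨hp, h2, (Nat.mul_pos hN hd0).ne'⟩
      by_cases hNb : p ∣ N * b
      · have h3 : (p : ℤ) ∣ ((a * X : ℕ) : ℤ) := by
          have h4 : (p : ℤ) ∣ ((N * b : ℕ) : ℤ) := Int.natCast_dvd_natCast.2 hNb
          have h5 := dvd_add h1 h4
          push_cast at h5 ⊢
          have h6 : -(N : ℤ) * b + a * (X : ℤ) + N * b = a * X := by ring
          rwa [h6] at h5
        have h4 : p ∣ a * X := Int.natCast_dvd_natCast.1 h3
        rcases (Nat.Prime.dvd_mul hp).1 h4 with h5 | h5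
        · have hpN : ¬ p ∣ N := fun h => hp.one_lt.ne' (Nat.dvd_one.1 (haN ▸ Nat.dvd_gcd h5 h))
          have hpb : p ∣ b := ((Nat.Prime.dvd_mul hp).1 hNb).resolve_left hpN
          have hpd' : p ∣ d := ((Nat.Prime.dvd_mul hp).1 h2).resolve_left hpN
          exact hp.one_lt.ne' (Nat.dvd_one.1 (hg ▸ Nat.dvd_gcd (Nat.dvd_gcd h5 hpb) hpd'))
        · obtain ⟨s, hs, hps⟩ := (Prime.dvd_finsetProd_iff hp.prime _).1 h5
          rw [Finset.mem_filter, Nat.mem_primeFactors] at hs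
          have : p = s := (Nat.prime_dvd_prime_iff_eq hp hs.1.1).1 hps
          exact hs.2 (this ▸ hNb)
      · have h3 : p ∣ X := Finset.dvd_prod_of_mem _ (Finset.mem_filter.2 ⟨hmem, hNb⟩)
        have h4 : (p : ℤ) ∣ (a : ℤ) * X := (Int.natCast_dvd_natCast.2 h3).mul_left _
        have h5 : (p : ℤ) ∣ -(N : ℤ) * b := (dvd_add_left h4).1 h1
        apply hNb
        have h6 : (p : ℤ) ∣ ((N * b : ℕ) : ℤ) := by
          rw [← dvd_neg]
          push_cast
          rwa [neg_mul] at h5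
        exact Int.natCast_dvd_natCast.1 h6
    obtain ⟨u, v, huv⟩ := hco
    refine ⟨(X, u, v), fun _ _ => ?_⟩
    push_cast at huv
    simp only
    linear_combination huv
  choose t ht using key
  exact ⟨fun a b => (t a b).1, fun a b => (t a b).2.1, fun a b => (t a b).2.2,
    fun a ha b hb => ht a b ha hb⟩

end EtaHecke

open scoped MatrixGroups

namespace EtaHecke

open UpperHalfPlane

/-! ### Dedekind sums -/

/-! The expansion of $T_lf$ is obtained by substituting into that of $f$. The term $c_f(m)q^m$ at
$(a\tau+b)/d$ contributes to the exponent $n=ma/d$, so $m=ln/a^2$, with phase $e(bdn/l)$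
(`hasSum_component`). Two things remain: the product of the two inverse character values must be
evaluated, and exponents outside $x_N/24+\mathbb Z$ must be shown to cancel.

For the first, each character value is $e(K/24)$ with $K$ a sum of values of $\Psi$ weighted by the
$r_n$, so only $K$ modulo 3 and modulo 8 matters. The number $12k\,s(h,k)$ is an integer;
reciprocity determines it modulo 8 for odd $k$, where a Jacobi symbol appears, while modulo 3 it is
a polynomial in $h$ and $k$. This gives $\Psi$ modulo 24 (`exists_Psi_mod`). Signs are written
additively as $0,4\in\mathbb Z/8$. Since $axy\equiv1$ modulo $N$, the Jacobi symbols attached to the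
divisors $N/n$ combine into $\left(\frac a\varPi\right)$, up to corrections governed by $\delta$ and
the exponent of 2 in $\varPi$ (`signExp_bigPi`). With $M=\sum\frac Nn r_n$, the condition $l\equiv1$
modulo $m_{\mathbf r}$ means that 24 divides $(l-1)x_N$ and $(l-1)M$. This makes all dependence on
$x,y,z$ disappear. For odd $2k$, the product $l=ad$ is a square, and this turns the remaining
symbol, $\left(\frac yd\right)$ or $\left(\frac d{|y|}\right)$, into
$\left(\frac{-Nb}{(a,d)}\right)$. The results are `sum_Psi_mod_eight` and `sum_Psi_mod_three`,
joined in `etaChar_inv_mul_inv`. The term of $\psi$ containing $b$ contributes only a trivial factor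
(`eight_dvd_of_two_dvd`).

For the second, the inner sum is over a function of $b$ that is periodic modulo $d$ and is
multiplied by $e(n-x_N/24)$ under $b\mapsto b+a$; it vanishes unless this factor is 1
(`sum_indexB_eq_zero`). Coefficients are unique by Fourier integration along a horizontal segment
(`coeff_eq_zero_of_hasSum_zero`), which also places the exponents of $f$ in $x_N/24+\mathbb Z$. -/

theorem sawtooth_neg (x : ℚ) : sawtooth (-x) = -sawtooth x := by
  unfold sawtooth
  by_cases h : Int.fract x = 0
  · have h' : Int.fract (-x) = 0 := by rw [Int.fract_neg_eq_zero]; exact h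
    simp [h, h']
  · have h' : ¬ Int.fract (-x) = 0 := by rw [Int.fract_neg_eq_zero]; exact h
    rw [if_neg h, if_neg h', Int.fract_neg h]
    ring

theorem sawtooth_add_intCast (x : ℚ) (n : ℤ) : sawtooth (x + n) = sawtooth x := by
  unfold sawtooth
  rw [Int.fract_add_intCast]

theorem dedekindSum_neg (h : ℤ) (k : ℕ) : dedekindSum (-h) k = -dedekindSum h k := by
  unfold dedekindSum
  rw [← Finset.sum_neg_distrib]
  refine Finset.sum_congr rfl fun r _ => ?_
  rw [show ((-h : ℤ) : ℚ) * r / k = -((h : ℚ) * r / k) by push_cast; ring, sawtooth_neg]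
  ring

theorem dedekindSum_add_mul (h j : ℤ) {k : ℕ} (hk : 0 < k) :
    dedekindSum (h + k * j) k = dedekindSum h k := by
  unfold dedekindSum
  refine Finset.sum_congr rfl fun r _ => ?_
  have hk' : (k : ℚ) ≠ 0 := by positivity
  rw [show ((h + k * j : ℤ) : ℚ) * r / k = (h : ℚ) * r / k + ((j * r : ℤ) : ℚ) by
    push_cast; field_simp, sawtooth_add_intCast]

theorem sawtooth_div (n : ℤ) {k : ℕ} (hk : 0 < k) :
    sawtooth ((n : ℚ) / k) = if n % (k : ℤ) = 0 then 0 else ((n % (k : ℤ) : ℤ) : ℚ) / k - 1 / 2 := by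
  unfold sawtooth
  rw [Int.fract_div_intCast_eq_div_intCast_mod]
  have hk' : (k : ℚ) ≠ 0 := by positivity
  simp [div_eq_zero_iff, hk']

theorem emod_eq_zero_iff_of_coprime {h : ℤ} {k : ℕ} (hk : IsCoprime h k) {r : ℕ} (hr : r < k) :
    (h * r) % (k : ℤ) = 0 ↔ r = 0 := by
  constructor
  · intro h0
    have h1 : (k : ℤ) ∣ h * r := Int.dvd_of_emod_eq_zero h0
    have h2 : (k : ℤ) ∣ r := hk.symm.dvd_of_dvd_mul_left h1
    exact Nat.eq_zero_of_dvd_of_lt (Int.natCast_dvd_natCast.1 h2) hr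
  · rintro rfl
    simp

/-- Multiplication by a unit permutes the residues modulo $k$. -/
theorem sum_mul_emod_range {h : ℤ} {k : ℕ} (hk : IsCoprime h k) (G : ℤ → ℤ) :
    ∑ r ∈ Finset.range k, G ((h * r) % (k : ℤ)) = ∑ r ∈ Finset.range k, G r := by
  have hmaps : Set.MapsTo (fun r : ℕ => ((h * r) % (k : ℤ)).toNat)
      (Finset.range k) (Finset.range k) := by
    intro r hr
    have hk0 : (0 : ℤ) < k := by
      have := Finset.mem_range.1 hr
      omega
    have h1 := Int.emod_lt_of_pos (h * r) hk0
    have h2 := Int.emod_nonneg (h * r) hk0.ne'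
    simp only [Finset.coe_range, Set.mem_Iio]
    omega
  have hinj : Set.InjOn (fun r : ℕ => ((h * r) % (k : ℤ)).toNat) (Finset.range k) := by
    intro r hr s hs hrs
    have hk0 : (0 : ℤ) < k := by
      have := Finset.mem_range.1 hr
      omega
    have h1 := Int.emod_nonneg (h * r) hk0.ne'
    have h2 := Int.emod_nonneg (h * s) hk0.ne'
    have h3 : (h * r) % (k : ℤ) = (h * s) % (k : ℤ) := by
      simp only at hrs
      omega
    have h4 : (k : ℤ) ∣ h * (s - r) := by
      have h5 := Int.ModEq.dvd (show h * r ≡ h * s [ZMOD k] from h3)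
      rwa [← mul_sub] at h5
    have h5 := hk.symm.dvd_of_dvd_mul_left h4
    have hr' := Finset.mem_range.1 hr
    have hs' := Finset.mem_range.1 hs
    have h6 : (s : ℤ) - r = 0 := by
      refine Int.eq_zero_of_abs_lt_dvd h5 ?_
      rw [abs_lt]
      omega
    omega
  refine Finset.sum_nbij (fun r : ℕ => ((h * r) % (k : ℤ)).toNat) hmaps hinj
    (Finset.surjOn_of_injOn_of_card_le _ hmaps hinj le_rfl) ?_
  intro r hr
  have hk0 : (0 : ℤ) < k := by
    have := Finset.mem_range.1 hr
    omega
  rw [Int.toNat_of_nonneg (Int.emod_nonneg (h * r) hk0.ne')]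

/-- The integer `12 k s(h, k)`. -/
def dedekindInt (h : ℤ) (k : ℕ) : ℤ :=
  2 * h * (k - 1) * (2 * k - 1) - 12 * ∑ r ∈ Finset.range k, (r : ℤ) * (h * r / k) - 3 * k * (k - 1)

theorem two_mul_sum_range_id (k : ℕ) :
    2 * ∑ r ∈ Finset.range k, (r : ℤ) = k * (k - 1) := by
  induction k with
  | zero => simp
  | succ k ih => rw [Finset.sum_range_succ, mul_add, ih]; push_cast; ring

theorem six_mul_sum_range_sq (k : ℕ) :
    6 * ∑ r ∈ Finset.range k, (r : ℤ) ^ 2 = k * (k - 1) * (2 * k - 1) := by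
  induction k with
  | zero => simp
  | succ k ih => rw [Finset.sum_range_succ, mul_add, ih]; push_cast; ring

theorem mul_sum_floor {h : ℤ} {k : ℕ} (hk : IsCoprime h k) :
    (k : ℤ) * ∑ r ∈ Finset.range k, (h * r / k) = (h - 1) * ∑ r ∈ Finset.range k, (r : ℤ) := by
  have h1 := sum_mul_emod_range hk (fun n => n)
  simp only [Int.emod_def, Finset.sum_sub_distrib, ← Finset.mul_sum] at h1
  linear_combination -h1

/-- The permutation of residues preserves second moments. Expanding the square trades $\sum r\lfloor
hr/k\rfloor$, the sum inside $s(h,k)$, for $\sum\lfloor hr/k\rfloor^2$, which can be computed by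
counting lattice points. -/
theorem sum_mul_floor_relation {h : ℤ} {k : ℕ} (hk : IsCoprime h k) :
    2 * h * k * ∑ r ∈ Finset.range k, (r : ℤ) * (h * r / k)
      = (h ^ 2 - 1) * ∑ r ∈ Finset.range k, (r : ℤ) ^ 2
        + k ^ 2 * ∑ r ∈ Finset.range k, (h * r / k) ^ 2 := by
  have h1 := sum_mul_emod_range hk (fun n => n ^ 2)
  have h2 : ∀ r : ℕ, ((h * r) % (k : ℤ)) ^ 2
      = h ^ 2 * (r : ℤ) ^ 2 - 2 * h * k * ((r : ℤ) * (h * r / k)) + k ^ 2 * (h * r / k) ^ 2 := by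
    intro r
    rw [Int.emod_def]
    ring
  simp only [h2, Finset.sum_sub_distrib, Finset.sum_add_distrib, ← Finset.mul_sum] at h1
  linear_combination -h1

theorem dedekindSum_eq {h : ℤ} {k : ℕ} (hk0 : 0 < k) (hk : IsCoprime h k) :
    12 * (k : ℚ) * dedekindSum h k = dedekindInt h k := by
  have hk' : (k : ℚ) ≠ 0 := by positivity
  -- The sawtooth vanishes at $r=0$, where the linear formula would give $(-\frac12)^2$; the last
  -- summand corrects this.
  have hterm : ∀ r ∈ Finset.range k, sawtooth ((r : ℚ) / k) * sawtooth ((h : ℚ) * r / k)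
      = ((r : ℚ) / k - 1 / 2) * (((h * r) % (k : ℤ) : ℤ) / k - 1 / 2)
        - if r = 0 then 1 / 4 else 0 := by
    intro r hr
    have h1 := sawtooth_div r hk0
    have h2 := sawtooth_div (h * r) hk0
    push_cast at h1 h2
    rw [h1, h2]
    have hr' := Finset.mem_range.1 hr
    have h3 : ((r : ℤ) % (k : ℤ)) = r := Int.emod_eq_of_lt (by positivity) (by exact_mod_cast hr')
    rw [h3]
    by_cases h0 : r = 0
    · subst h0; simp; norm_num
    · have h4 := (emod_eq_zero_iff_of_coprime hk hr').not.2 h0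
      rw [if_neg h4, if_neg (by exact_mod_cast h0), if_neg h0]
      push_cast
      ring
  unfold dedekindSum
  rw [Finset.sum_congr rfl hterm, Finset.sum_sub_distrib]
  have h5 : ∑ r ∈ Finset.range k, (if r = 0 then (1 / 4 : ℚ) else 0) = 1 / 4 := by
    rw [Finset.sum_ite_eq' (Finset.range k) 0 (fun _ => (1 / 4 : ℚ))]
    simp [hk0]
  have h6 : ∀ r : ℕ, ((r : ℚ) / k - 1 / 2) * (((h * r) % (k : ℤ) : ℤ) / k - 1 / 2)
      = (h : ℚ) / k ^ 2 * ((r ^ 2 : ℤ) : ℚ) - 1 / k * ((r * (h * r / k) : ℤ) : ℚ)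
        - 1 / (2 * k) * ((r : ℤ) : ℚ) - 1 / (2 * k) * (((h * r) % (k : ℤ) : ℤ) : ℚ) + 1 / 4 := by
    intro r
    have h7 := Int.emod_def (h * r) k
    have h8 : (((h * r) % (k : ℤ) : ℤ) : ℚ) = h * r - k * ((h * r / k : ℤ) : ℚ) := by
      rw [h7]; push_cast; ring
    rw [h8]
    simp only [Int.cast_mul, Int.cast_pow, Int.cast_natCast]
    field_simp
    ring
  rw [h5, Finset.sum_congr rfl fun r _ => h6 r]
  simp only [Finset.sum_add_distrib, Finset.sum_sub_distrib, ← Finset.mul_sum, ← Int.cast_sum]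
  rw [sum_mul_emod_range hk (fun n => n)]
  have e1 : (2 : ℚ) * ((∑ r ∈ Finset.range k, (r : ℤ) : ℤ) : ℚ) = k * (k - 1) := by
    exact_mod_cast congrArg (Int.cast : ℤ → ℚ) (two_mul_sum_range_id k)
  have e2 : (6 : ℚ) * ((∑ r ∈ Finset.range k, (r : ℤ) ^ 2 : ℤ) : ℚ) = k * (k - 1) * (2 * k - 1) := by
    exact_mod_cast congrArg (Int.cast : ℤ → ℚ) (six_mul_sum_range_sq k)
  unfold dedekindInt
  rw [Int.cast_sub, Int.cast_sub, Int.cast_mul 12]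
  generalize ((∑ r ∈ Finset.range k, (r : ℤ) * (h * r / k) : ℤ) : ℚ) = R at *
  generalize ((∑ r ∈ Finset.range k, (r : ℤ) : ℤ) : ℚ) = S at *
  generalize ((∑ r ∈ Finset.range k, (r : ℤ) ^ 2 : ℤ) : ℚ) = S2 at *
  simp only [Finset.sum_const, Finset.card_range, nsmul_eq_mul]
  push_cast
  have e1' : S = k * (k - 1) / 2 := by linear_combination e1 / 2
  have e2' : S2 = k * (k - 1) * (2 * k - 1) / 6 := by linear_combination e2 / 6
  rw [e1', e2']
  field_simp
  ring

/-! ### Reciprocity for Dedekind sums -/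

theorem sum_range_indicator (m n : ℕ) (h : m ≤ n) (F : ℕ → ℤ) :
    ∑ j ∈ Finset.range n, (if j < m then F j else 0) = ∑ j ∈ Finset.range m, F j := by
  rw [← Finset.sum_filter]
  congr 1
  ext j
  simp only [Finset.mem_filter, Finset.mem_range]
  omega

/-- Since $F^2+F=2\sum_{j\le F}j$, the left side is a weighted count of lattice points with $kj\le
hr$; the right side counts the same points column by column in $j$. -/
theorem sum_floor_swap {h k : ℕ} (hh : 0 < h) (hk : 0 < k) (hc : Nat.Coprime h k) :
    ∑ r ∈ Finset.range k, (((h : ℤ) * r / k) ^ 2 + (h : ℤ) * r / k)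
      = 2 * ∑ j ∈ Finset.range h, (j : ℤ) * (k - 1 - (k : ℤ) * j / h) := by
  have h1 : ∀ r ∈ Finset.range k, (((h : ℤ) * r / k) ^ 2 + (h : ℤ) * r / k)
      = 2 * ∑ j ∈ Finset.range h, if k * j ≤ h * r then (j : ℤ) else 0 := by
    intro r hr
    have hr' := Finset.mem_range.1 hr
    have hlt : h * r / k < h := by
      rw [Nat.div_lt_iff_lt_mul hk]
      exact Nat.mul_lt_mul_of_pos_left hr' hh
    have h2 := sum_range_indicator (h * r / k + 1) h hlt (fun j => (j : ℤ))
    have h3 : ∀ j, (k * j ≤ h * r) ↔ j < h * r / k + 1 := by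
      intro j
      rw [Nat.lt_succ_iff, Nat.le_div_iff_mul_le hk, mul_comm]
    simp only [h3]
    rw [h2, two_mul_sum_range_id]
    push_cast
    ring
  rw [Finset.sum_congr rfl h1, ← Finset.mul_sum, Finset.sum_comm]
  congr 1
  refine Finset.sum_congr rfl fun j hj => ?_
  have hj' := Finset.mem_range.1 hj
  -- The quotient $(kj+h-1)/h$ is the ceiling of $kj/h$, the first $r$ that is counted. For $0<j<h$
  -- it exceeds the floor by one, because $h\nmid kj$; for $j=0$ the weight is zero.
  have h4 : ∀ r ∈ Finset.range k, (if k * j ≤ h * r then (j : ℤ) else 0)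
      = (j : ℤ) - if r < (k * j + h - 1) / h then (j : ℤ) else 0 := by
    intro r _
    have : k * j ≤ h * r ↔ ¬ r < (k * j + h - 1) / h := by
      rw [not_lt, ← Nat.lt_succ_iff (n := r), Nat.div_lt_iff_lt_mul hh, Nat.succ_mul, mul_comm r h]
      omega
    by_cases hcase : k * j ≤ h * r
    · rw [if_pos hcase, if_neg (this.1 hcase)]; ring
    · rw [if_neg hcase, if_pos (not_not.1 (fun hn => hcase (this.2 hn)))]; ring
  have hle : (k * j + h - 1) / h ≤ k := by
    rw [← Nat.lt_succ_iff, Nat.div_lt_iff_lt_mul hh, Nat.succ_mul]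
    have : k * j ≤ k * h := Nat.mul_le_mul_left k hj'.le
    have h5 : k * h = h * k := mul_comm _ _
    omega
  rw [Finset.sum_congr rfl h4, Finset.sum_sub_distrib, sum_range_indicator _ _ hle]
  simp only [Finset.sum_const, Finset.card_range, nsmul_eq_mul]
  rcases Nat.eq_zero_or_pos j with rfl | hj0
  · simp
  have hnd : ¬ h ∣ k * j := fun hd =>
    absurd (Nat.le_of_dvd hj0 (hc.dvd_of_dvd_mul_left hd)) (by omega)
  have h6 : (k * j + h - 1) / h = k * j / h + 1 := by
    have h7 := Nat.div_add_mod (k * j) h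
    have h8 : 0 < k * j % h := Nat.pos_of_ne_zero fun h0 => hnd (Nat.dvd_of_mod_eq_zero h0)
    have h9 := Nat.mod_lt (k * j) hh
    rw [Nat.div_eq_iff hh]
    constructor
    · rw [Nat.add_mul, mul_comm (k * j / h)]; omega
    · rw [Nat.add_mul, mul_comm (k * j / h)]; omega
  rw [h6]
  push_cast
  ring

/-- This is $12hk$ times the classical law. The moment identities and the lattice point count
eliminate all floor sums after multiplication by $k$. -/
theorem dedekindInt_reciprocity {h k : ℕ} (hh : 0 < h) (hk : 0 < k) (hc : Nat.Coprime h k) :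
    (h : ℤ) * dedekindInt h k + k * dedekindInt k h = h ^ 2 + k ^ 2 + 1 - 3 * h * k := by
  have hc' : IsCoprime (h : ℤ) (k : ℤ) := Nat.isCoprime_iff_coprime.2 hc
  have h1 := mul_sum_floor hc'
  have h2 := sum_mul_floor_relation hc'
  have h3 := sum_floor_swap hh hk hc
  have h4 := two_mul_sum_range_id k
  have h5 := six_mul_sum_range_sq k
  have h6 := two_mul_sum_range_id h
  rw [Finset.sum_add_distrib] at h3
  have h7 : ∑ j ∈ Finset.range h, (j : ℤ) * (k - 1 - (k : ℤ) * j / h)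
      = (k - 1) * ∑ j ∈ Finset.range h, (j : ℤ)
        - ∑ j ∈ Finset.range h, (j : ℤ) * ((k : ℤ) * j / h) := by
    rw [Finset.mul_sum, ← Finset.sum_sub_distrib]
    exact Finset.sum_congr rfl fun j _ => by ring
  rw [h7] at h3
  unfold dedekindInt
  have hk' : (k : ℤ) ≠ 0 := by positivity
  apply mul_left_cancel₀ hk'
  linear_combination (-6) * h2 - 6 * (k : ℤ) ^ 2 * h3 + 6 * k * h1 + 3 * (h - 1) * k * h4
    - ((h : ℤ) ^ 2 - 1) * h5 - 6 * (k : ℤ) ^ 2 * (k - 1) * h6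

theorem dedekindInt_add_mul {h : ℤ} (j : ℤ) {k : ℕ} (hk : 0 < k) (hc : IsCoprime h k) :
    dedekindInt (h + k * j) k = dedekindInt h k := by
  have hc' : IsCoprime (h + k * j) (k : ℤ) := by
    rw [IsCoprime.add_mul_left_left_iff]
    exact hc
  have h1 := dedekindSum_eq hk hc'
  rw [dedekindSum_add_mul h j hk, dedekindSum_eq hk hc] at h1
  exact_mod_cast h1.symm

theorem dedekindInt_neg {h : ℤ} {k : ℕ} (hk : 0 < k) (hc : IsCoprime h k) :
    dedekindInt (-h) k = -dedekindInt h k := by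
  have h1 := dedekindSum_eq hk hc.neg_left
  rw [dedekindSum_neg, mul_neg, dedekindSum_eq hk hc] at h1
  exact_mod_cast h1.symm

/-! ### Dedekind sums modulo 3 and modulo 8 -/

theorem dedekindInt_mod_three (h : ℤ) (k : ℕ) :
    (dedekindInt h k : ZMod 3) = h * ((k : ZMod 3) ^ 2 - 1) := by
  have h3 : (3 : ZMod 3) = 0 := rfl
  unfold dedekindInt
  push_cast
  linear_combination (h * (k - 1) * (k - 1) - 4 * ∑ r ∈ Finset.range k, (r : ZMod 3)
    * ((h * (r : ℤ) / (k : ℤ) : ℤ) : ZMod 3) - k * (k - 1)) * h3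

theorem int_cast_odd {n : ℤ} (hn : Odd n) :
    (n : ZMod 8) = 1 ∨ (n : ZMod 8) = 3 ∨ (n : ZMod 8) = 5 ∨ (n : ZMod 8) = 7 := by
  have h : n % 8 = 1 ∨ n % 8 = 3 ∨ n % 8 = 5 ∨ n % 8 = 7 := by
    have := Int.odd_iff.1 hn
    omega
  rcases h with h | h | h | h
  · exact Or.inl ((ZMod.intCast_eq_intCast_iff n 1 8).2 h)
  · exact Or.inr (Or.inl ((ZMod.intCast_eq_intCast_iff n 3 8).2 h))
  · exact Or.inr (Or.inr (Or.inl ((ZMod.intCast_eq_intCast_iff n 5 8).2 h)))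
  · exact Or.inr (Or.inr (Or.inr ((ZMod.intCast_eq_intCast_iff n 7 8).2 h)))

theorem emod_four_eq_three_iff (n : ℤ) :
    n % 4 = 3 ↔ (n : ZMod 8) = 3 ∨ (n : ZMod 8) = 7 := by
  have h3 : (n : ZMod 8) = 3 ↔ n % 8 = 3 := ZMod.intCast_eq_intCast_iff n 3 8
  have h7 : (n : ZMod 8) = 7 ↔ n % 8 = 7 := ZMod.intCast_eq_intCast_iff n 7 8
  rw [h3, h7]
  omega

theorem nat_emod_four_eq_three_iff (n : ℕ) :
    n % 4 = 3 ↔ (n : ZMod 8) = 3 ∨ (n : ZMod 8) = 7 := by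
  have := emod_four_eq_three_iff n
  push_cast at this
  rw [← this]
  omega

theorem jacobiSym_swap {h k : ℕ} (hh : Odd h) (hk : Odd k) :
    (jacobiSym h k : ZMod 8) = if ((h : ZMod 8) = 3 ∨ (h : ZMod 8) = 7) ∧
      ((k : ZMod 8) = 3 ∨ (k : ZMod 8) = 7) then -(jacobiSym k h : ZMod 8)
      else (jacobiSym k h : ZMod 8) := by
  rw [← jacobiSym.quadratic_reciprocity_if (Nat.odd_iff.1 hh) (Nat.odd_iff.1 hk)]
  simp only [nat_emod_four_eq_three_iff]
  split_ifs <;> push_cast <;> rfl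

/-- The Euclidean step reduced to a finite check: $D$ stands for $12k\,s(h,k)$ and $j$ for
$\left(\frac hk\right)$. The hypothesis is reciprocity with the value of $12h\,s(k,h)$ inserted, and
the conditional is quadratic reciprocity. -/
theorem zmod8_step_odd : ∀ h k D : ZMod 8, (h = 1 ∨ h = 3 ∨ h = 5 ∨ h = 7) →
    (k = 1 ∨ k = 3 ∨ k = 5 ∨ k = 7) → ∀ j : ZMod 8, (j = 1 ∨ j = -1) →
    h * D + k * (h + 1 - 2 * (if (h = 3 ∨ h = 7) ∧ (k = 3 ∨ k = 7) then -j else j))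
      = h ^ 2 + k ^ 2 + 1 - 3 * h * k → D = k + 1 - 2 * j := by
  decide

theorem dedekindInt_mod_eight_of_odd {h k : ℕ} (hh : Odd h) (hk : Odd k) (hc : Nat.Coprime h k)
    (ih : (dedekindInt k h : ZMod 8) = h + 1 - 2 * jacobiSym k h) :
    (dedekindInt h k : ZMod 8) = k + 1 - 2 * jacobiSym h k := by
  have h1 := congrArg (Int.cast : ℤ → ZMod 8) (dedekindInt_reciprocity hh.pos hk.pos hc)
  push_cast at h1
  rw [ih, jacobiSym_swap hk hh] at h1
  have hj : (jacobiSym h k : ZMod 8) = 1 ∨ (jacobiSym h k : ZMod 8) = -1 := by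
    rcases jacobiSym.eq_one_or_neg_one (a := h) (b := k) (by simpa using hc) with h | h
    · left; rw [h]; rfl
    · right; rw [h]; rfl
  have h2 := int_cast_odd (n := h) (by exact_mod_cast hh)
  have h3 := int_cast_odd (n := k) (by exact_mod_cast hk)
  rw [Int.cast_natCast] at h2 h3
  refine zmod8_step_odd h k _ h2 h3 _ hj ?_
  rw [← h1]
  simp only [and_comm]

theorem zmod8_step_even : ∀ k j : ZMod 8, (k = 1 ∨ k = 3 ∨ k = 5 ∨ k = 7) → (j = 1 ∨ j = -1) →
    -(k + 1 - 2 * (if k = 3 ∨ k = 7 then -j else j)) = k + 1 - 2 * j := by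
  decide

theorem jacobiSym_neg_cast (h : ℤ) {k : ℕ} (hk : Odd k) :
    (jacobiSym (-h) k : ZMod 8)
      = if (k : ZMod 8) = 3 ∨ (k : ZMod 8) = 7 then -(jacobiSym h k : ZMod 8)
        else (jacobiSym h k : ZMod 8) := by
  rw [jacobiSym.neg h hk]
  by_cases h3 : k % 4 = 3
  · rw [if_pos ((nat_emod_four_eq_three_iff k).1 h3), ZMod.χ₄_nat_three_mod_four h3]
    push_cast
    ring
  · rw [if_neg ((nat_emod_four_eq_three_iff k).not.1 h3), ZMod.χ₄_nat_one_mod_four]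
    · push_cast
      ring
    · have := Nat.odd_iff.1 hk
      omega

/-- The Euclidean algorithm proves this, as Dedekind sums and Jacobi symbols both depend on $h$
modulo $k$ and both satisfy reciprocity. An even remainder $h_0$ is replaced by the odd number
$k-h_0$, since the behaviour under $h\mapsto-h$ is known on both sides. -/
theorem dedekindInt_mod_eight {k : ℕ} (hk : Odd k) :
    ∀ {h : ℤ}, IsCoprime h k → (dedekindInt h k : ZMod 8) = k + 1 - 2 * jacobiSym h k := by
  induction k using Nat.strong_induction_on with
  | _ k ih =>
    intro h hc
    rcases Nat.lt_or_ge 1 k with hk1 | hk1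
    swap
    · have : k = 1 := le_antisymm hk1 hk.pos
      subst this
      simp [dedekindInt]
      rfl
    have hk0 : (0 : ℤ) < k := by exact_mod_cast hk.pos
    obtain ⟨h₀, hh₀⟩ := Int.eq_ofNat_of_zero_le (Int.emod_nonneg h hk0.ne')
    have hlt := Int.emod_lt_of_pos h hk0
    have hdec : h = h₀ + k * (h / k) := by
      have := Int.emod_add_mul_ediv h k
      rw [← hh₀]
      exact this.symm
    have hc₀ : IsCoprime (h₀ : ℤ) k := by
      rw [hdec, IsCoprime.add_mul_left_left_iff] at hc
      exact hc
    have hJ : jacobiSym h k = jacobiSym h₀ k := by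
      rw [jacobiSym.mod_left h k, hh₀]
    rw [hdec, dedekindInt_add_mul _ hk.pos hc₀, ← hdec, hJ]
    have hcn : Nat.Coprime h₀ k := Nat.isCoprime_iff_coprime.1 hc₀
    have hlt' : h₀ < k := by omega
    rcases Nat.even_or_odd h₀ with he | ho
    · have hh0 : h₀ ≠ 0 := by
        rintro rfl
        have := (Nat.coprime_zero_left k).1 hcn
        omega
      have hodd : Odd (k - h₀) := Nat.Odd.sub_even hlt'.le hk he
      have hcast : ((k - h₀ : ℕ) : ℤ) = -(h₀ : ℤ) + k * 1 := by
        rw [Nat.cast_sub hlt'.le]; ring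
      have hcop : Nat.Coprime (k - h₀) k := by
        rw [← Nat.isCoprime_iff_coprime, hcast, IsCoprime.add_mul_left_left_iff]
        exact hc₀.neg_left
      have h1 := dedekindInt_mod_eight_of_odd hodd hk hcop
        (ih (k - h₀) (by omega) hodd (Nat.isCoprime_iff_coprime.2 hcop.symm))
      have hJ' : jacobiSym ((k - h₀ : ℕ) : ℤ) k = jacobiSym (-(h₀ : ℤ)) k := by
        apply jacobiSym.mod_left'
        rw [hcast]
        simp
      rw [hJ', hcast, dedekindInt_add_mul _ hk.pos hc₀.neg_left, dedekindInt_neg hk.pos hc₀,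
        jacobiSym_neg_cast _ hk, Int.cast_neg] at h1
      have h2 := int_cast_odd (n := k) (by exact_mod_cast hk)
      rw [Int.cast_natCast] at h2
      have hj : (jacobiSym h₀ k : ZMod 8) = 1 ∨ (jacobiSym h₀ k : ZMod 8) = -1 := by
        rcases jacobiSym.eq_one_or_neg_one (a := h₀) (b := k) (by simpa using hcn) with h | h
        · left; rw [h]; rfl
        · right; rw [h]; rfl
      rw [← zmod8_step_even _ _ h2 hj, ← h1, neg_neg]
    · exact dedekindInt_mod_eight_of_odd ho hk hcn (ih h₀ hlt' ho hc₀.symm)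

/-! ### The Dedekind–Rademacher function -/

theorem Psi_neg {a b c d : ℤ} (hc : c < 0) : Psi a b c d = Psi (-a) (-b) (-c) (-d) + 6 := by
  unfold Psi
  rw [if_neg hc.le.not_gt, if_pos hc, if_pos (by omega : 0 < -c), Int.natAbs_neg, neg_neg]
  push_cast
  rw [show (-(a : ℚ) + -d) / -(c : ℚ) = ((a : ℚ) + d) / c by
    rw [← neg_add, neg_div_neg_eq]]
  ring

/-- The definition controls $c\Psi$, and reciprocity then controls $d\Psi$. Having both matters
because $c$ and $d$ are coprime: at any prime at least one of them is invertible, so $\Psi$ itself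
can be recovered. -/
theorem exists_Psi_eq {a b c d : ℤ} (hc : 0 < c) (hdet : a * d - b * c = 1) :
    ∃ P : ℤ, Psi a b c d = P ∧ c * P = a + d + dedekindInt (-d) c.natAbs - 3 * c ∧
      (d = 0 ∨ (0 < d ∧ d * P = b - c + dedekindInt c d.natAbs) ∨
        (d < 0 ∧ d * P = b - c - 6 * d + dedekindInt c d.natAbs)) := by
  have hcd : IsCoprime d c := ⟨a, -b, by linear_combination hdet⟩
  obtain ⟨c, rfl⟩ := Int.eq_ofNat_of_zero_le hc.le
  have hc0 : 0 < c := by exact_mod_cast hc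
  have hcq : (c : ℚ) ≠ 0 := by positivity
  have hD := dedekindSum_eq hc0 hcd.neg_left
  have h1 : (c : ℚ) * Psi a b c d = ((a + d + dedekindInt (-d) c - 3 * c : ℤ) : ℚ) := by
    unfold Psi
    rw [if_pos hc]
    push_cast
    rw [← hD, Int.natAbs_natCast]
    field_simp
  have key : ∀ Q : ℤ, (d : ℚ) * Psi a b c d = Q → ∃ P : ℤ, Psi a b c d = P ∧
      (c : ℤ) * P = a + d + dedekindInt (-d) c - 3 * c ∧ d * P = Q := by
    intro Q hQ
    have hdet' : (a : ℚ) * d - b * c = 1 := by exact_mod_cast hdet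
    -- The combination $a(d\Psi)-b(c\Psi)$ equals $\Psi$ by the determinant condition, so $\Psi$ is
    -- an integer.
    have h2 : Psi a b c d = ((a * Q - b * (a + d + dedekindInt (-d) c - 3 * c) : ℤ) : ℚ) := by
      rw [Int.cast_sub, Int.cast_mul, Int.cast_mul, ← hQ, ← h1]
      linear_combination (-Psi a b c d) * hdet'
    refine ⟨_, h2, ?_, ?_⟩
    · rw [h2] at h1
      exact_mod_cast h1
    · rw [h2] at hQ
      exact_mod_cast hQ
  rcases lt_trichotomy d 0 with hd | hd | hd
  · obtain ⟨e, he⟩ := Int.eq_ofNat_of_zero_le (show 0 ≤ -d by omega)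
    have he0 : 0 < e := by omega
    have hde : d = -(e : ℤ) := by omega
    have hco : Nat.Coprime e c := by
      rw [← Nat.isCoprime_iff_coprime, ← he]
      exact hcd.neg_left
    have hrec := dedekindInt_reciprocity he0 hc0 hco
    obtain ⟨P, hP1, hP2, hP3⟩ := key (b - c - 6 * d + dedekindInt c e) (by
      apply mul_left_cancel₀ hcq
      have : (c : ℚ) * ((d : ℚ) * Psi a b c d) = d * (c * Psi a b c d) := by ring
      rw [this, h1]
      norm_cast
      rw [he, hde]
      push_cast
      rw [hde] at hdet
      linear_combination hdet - hrec)
    refine ⟨P, hP1, by simpa using hP2, Or.inr (Or.inr ⟨hd, ?_⟩)⟩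
    rw [hP3, hde]
    simp
  · subst hd
    have hc1 : (c : ℤ) = 1 := by
      have : IsUnit (c : ℤ) := isUnit_iff_dvd_one.2 ⟨-b, by linear_combination -hdet⟩
      rcases Int.isUnit_iff.1 this with h | h <;> omega
    refine ⟨a + 0 + dedekindInt (-0) c - 3 * c, ?_, ?_, Or.inl rfl⟩
    · rw [← h1]
      have : (c : ℚ) = 1 := by exact_mod_cast hc1
      rw [this]
      ring
    · rw [hc1]
      have : c = 1 := by exact_mod_cast hc1
      subst this
      simp
  · obtain ⟨e, rfl⟩ := Int.eq_ofNat_of_zero_le hd.le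
    have he0 : 0 < e := by exact_mod_cast hd
    have hrec := dedekindInt_reciprocity he0 hc0 (Nat.isCoprime_iff_coprime.1 hcd)
    have hneg := dedekindInt_neg hc0 hcd
    obtain ⟨P, hP1, hP2, hP3⟩ := key (b - c + dedekindInt c e) (by
      apply mul_left_cancel₀ hcq
      have : (c : ℚ) * (((e : ℤ) : ℚ) * Psi a b c e) = ((e : ℤ) : ℚ) * (c * Psi a b c e) := by ring
      rw [this, h1, hneg]
      norm_cast
      push_cast
      linear_combination hdet - hrec)
    exact ⟨P, hP1, by simpa using hP2, Or.inr (Or.inl ⟨hd, by simpa using hP3⟩)⟩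

theorem zmod3_Psi : ∀ a b c d P : ZMod 3, a * d - b * c = 1 →
    c * P = a + d + -d * (c ^ 2 - 1) - 3 * c → d * P = b - c + c * (d ^ 2 - 1) →
    P = (a + d) * c - b * d * (c ^ 2 - 1) := by
  decide

theorem natCast_natAbs_sq {n : ℕ} (d : ℤ) : ((d.natAbs : ℕ) : ZMod n) ^ 2 = (d : ZMod n) ^ 2 := by
  have := congrArg (Int.cast : ℤ → ZMod n) (Int.natAbs_sq d)
  rwa [Int.cast_pow, Int.cast_pow, Int.cast_natCast] at this

/-- The value of `Ψ` modulo `24`, as congruences modulo `3` and modulo `8`. -/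
theorem exists_Psi_mod {a b c d : ℤ} (hc : 0 < c) (hdet : a * d - b * c = 1) :
    ∃ P : ℤ, Psi a b c d = P ∧
      (P : ZMod 3) = (a + d) * c - b * d * ((c : ZMod 3) ^ 2 - 1) ∧
      (Odd d → (d : ZMod 8) * P = b - c + d + 1 - 2 * jacobiSym c d.natAbs) ∧
      (Odd c → (c : ZMod 8) * P = a + d + 1 - 2 * c - 2 * jacobiSym (-d) c.natAbs) := by
  obtain ⟨P, hP, h1, h2⟩ := exists_Psi_eq hc hdet
  have hcd : IsCoprime d c := ⟨a, -b, by linear_combination hdet⟩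
  have hcabs : ((c.natAbs : ℕ) : ℤ) = c := Int.natAbs_of_nonneg hc.le
  refine ⟨P, hP, ?_, ?_, ?_⟩
  · have h1' := congrArg (Int.cast : ℤ → ZMod 3) h1
    push_cast at h1'
    rw [dedekindInt_mod_three, natCast_natAbs_sq] at h1'
    push_cast at h1'
    have hdet' := congrArg (Int.cast : ℤ → ZMod 3) hdet
    push_cast at hdet'
    -- The sign of $d$ does not matter modulo 3: $6d$ vanishes and $|d|$ enters only through its
    -- square.
    have h2' : (d : ZMod 3) * P = b - c + c * ((d : ZMod 3) ^ 2 - 1) := by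
      rcases h2 with hd | ⟨-, h2⟩ | ⟨-, h2⟩
      · subst hd
        have hc1 : c = 1 := by
          have : IsUnit c := isUnit_iff_dvd_one.2 ⟨-b, by linear_combination -hdet⟩
          rcases Int.isUnit_iff.1 this with h | h <;> omega
        subst hc1
        have hb : b = -1 := by linarith
        subst hb
        simp
        rfl
      · have := congrArg (Int.cast : ℤ → ZMod 3) h2
        push_cast at this
        rw [dedekindInt_mod_three, natCast_natAbs_sq] at this
        exact this
      · have := congrArg (Int.cast : ℤ → ZMod 3) h2
        push_cast at this
        rw [dedekindInt_mod_three, natCast_natAbs_sq] at this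
        have h3 : (3 : ZMod 3) = 0 := rfl
        rw [this]
        linear_combination (-2 * (d : ZMod 3)) * h3
    exact zmod3_Psi _ _ _ _ _ hdet' h1' h2'
  · intro hd
    have hdo : Odd d.natAbs := Int.natAbs_odd.2 hd
    have h8 : (8 : ZMod 8) = 0 := rfl
    rcases h2 with rfl | ⟨hpos, h2⟩ | ⟨hneg, h2⟩
    · simp at hd
    · have hdabs : ((d.natAbs : ℕ) : ℤ) = d := Int.natAbs_of_nonneg hpos.le
      have h3 := dedekindInt_mod_eight hdo (h := c) (by rw [hdabs]; exact hcd.symm)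
      have := congrArg (Int.cast : ℤ → ZMod 8) h2
      push_cast at this
      have hd8 : ((d.natAbs : ℕ) : ZMod 8) = d := by
        have := congrArg (Int.cast : ℤ → ZMod 8) hdabs
        rwa [Int.cast_natCast] at this
      rw [this, h3, hd8]
      ring
    · have hdabs : ((d.natAbs : ℕ) : ℤ) = -d := by omega
      have h3 := dedekindInt_mod_eight hdo (h := c) (by rw [hdabs]; exact hcd.symm.neg_right)
      have := congrArg (Int.cast : ℤ → ZMod 8) h2
      push_cast at this
      have hd8 : ((d.natAbs : ℕ) : ZMod 8) = -d := by
        have := congrArg (Int.cast : ℤ → ZMod 8) hdabs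
        rwa [Int.cast_natCast, Int.cast_neg] at this
      rw [this, h3, hd8]
      -- For negative $d$, the term $-6d$ together with $|d|=-d$ gives $-7d\equiv d$, the same
      -- formula as for positive $d$.
      linear_combination (-(d : ZMod 8)) * h8
  · intro hco
    have hco' : Odd c.natAbs := Int.natAbs_odd.2 hco
    have h3 := dedekindInt_mod_eight hco' (h := -d) (by rw [hcabs]; exact hcd.neg_left)
    have := congrArg (Int.cast : ℤ → ZMod 8) h1
    push_cast at this
    have hc8 : ((c.natAbs : ℕ) : ZMod 8) = c := by
      have := congrArg (Int.cast : ℤ → ZMod 8) hcabs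
      rwa [Int.cast_natCast] at this
    rw [this, h3, hc8]
    ring

/-! ### Signs, written additively modulo `8` -/

/-- The homomorphism `{± 1} → 4 ℤ / 8 ℤ`. -/
def signExp (u : ℤ) : ZMod 8 := 2 * (1 - u)

theorem signExp_one : signExp 1 = 0 := rfl

theorem signExp_mul {u v : ℤ} (hu : IsUnit u) (hv : IsUnit v) :
    signExp (u * v) = signExp u + signExp v := by
  rcases Int.isUnit_iff.1 hu with rfl | rfl <;> rcases Int.isUnit_iff.1 hv with rfl | rfl <;> rfl

theorem signExp_eq {u : ℤ} (hu : IsUnit u) : signExp u = 0 ∨ signExp u = 4 := by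
  rcases Int.isUnit_iff.1 hu with rfl | rfl
  · left; rfl
  · right; rfl

theorem two_mul_signExp {u : ℤ} (hu : IsUnit u) : 2 * signExp u = 0 := by
  rcases signExp_eq hu with h | h <;> rw [h] <;> rfl

theorem neg_signExp {u : ℤ} (hu : IsUnit u) : -signExp u = signExp u := by
  linear_combination -two_mul_signExp hu

theorem signExp_pow {u : ℤ} (hu : IsUnit u) (n : ℕ) : signExp (u ^ n) = n * signExp u := by
  induction n with
  | zero => simp [signExp_one]
  | succ n ih => rw [pow_succ, signExp_mul (hu.pow n) hu, ih]; push_cast; ring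

theorem odd_mul_signExp {u : ℤ} (hu : IsUnit u) {n : ℤ} (hn : Odd n) :
    (n : ZMod 8) * signExp u = signExp u := by
  obtain ⟨k, rfl⟩ := hn
  push_cast
  linear_combination (k : ZMod 8) * two_mul_signExp hu

theorem even_mul_signExp {u : ℤ} (hu : IsUnit u) {n : ℤ} (hn : Even n) :
    (n : ZMod 8) * signExp u = 0 := by
  obtain ⟨k, rfl⟩ := hn
  push_cast
  linear_combination (k : ZMod 8) * two_mul_signExp hu

/-- Encoded signs are killed by 2, so the sign of the multiplier is irrelevant. This is why $\varPi$
may be formed with $|r_n|$ although the exponents of the eta quotient are $r_n$. -/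
theorem natAbs_mul_signExp {u : ℤ} (hu : IsUnit u) (n : ℤ) :
    (n.natAbs : ZMod 8) * signExp u = n * signExp u := by
  rcases Int.natAbs_eq n with h | h
  · conv_rhs => rw [h]
    rw [Int.cast_natCast]
  · conv_rhs => rw [h]
    rw [Int.cast_neg, Int.cast_natCast, neg_mul, ← mul_neg, neg_signExp hu]

theorem signExp_prod {ι : Type*} {φ : ℕ → ℤ} (h1 : φ 1 = 1)
    (hmul : ∀ m n, m ≠ 0 → n ≠ 0 → φ (m * n) = φ m * φ n) (S : Finset ι) (F : ι → ℕ) (k : ι → ℕ)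
    (hF : ∀ i ∈ S, F i ≠ 0) (hu : ∀ i ∈ S, IsUnit (φ (F i))) :
    IsUnit (φ (∏ i ∈ S, F i ^ k i)) ∧
      signExp (φ (∏ i ∈ S, F i ^ k i)) = ∑ i ∈ S, (k i : ZMod 8) * signExp (φ (F i)) := by
  classical
  have hpow : ∀ m, m ≠ 0 → ∀ j, φ (m ^ j) = φ m ^ j := by
    intro m hm j
    induction j with
    | zero => simp [h1]
    | succ j ih => rw [pow_succ, pow_succ, hmul _ _ (pow_ne_zero _ hm) hm, ih]
  induction S using Finset.induction_on with
  | empty => simp [h1, signExp_one]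
  | insert i S hi ih =>
    obtain ⟨ih1, ih2⟩ := ih (fun j hj => hF j (Finset.mem_insert_of_mem hj))
      (fun j hj => hu j (Finset.mem_insert_of_mem hj))
    have hFi := hF i (Finset.mem_insert_self i S)
    have hui := hu i (Finset.mem_insert_self i S)
    rw [Finset.prod_insert hi, Finset.sum_insert hi, hmul _ _ (pow_ne_zero _ hFi)
      (Finset.prod_ne_zero_iff.2 fun j hj => pow_ne_zero _ (hF j (Finset.mem_insert_of_mem hj))),
      hpow _ hFi]
    exact ⟨(hui.pow _).mul ih1, by rw [signExp_mul (hui.pow _) ih1, ih2, signExp_pow hui]⟩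

theorem div_ne_zero_of_mem {N n : ℕ} (hn : n ∈ N.divisors) : N / n ≠ 0 := by
  obtain ⟨h1, h2⟩ := Nat.mem_divisors.1 hn
  exact (Nat.div_pos (Nat.le_of_dvd (Nat.pos_of_ne_zero h2) h1) (Nat.pos_of_mem_divisors hn)).ne'

/-- One mechanism for three later sums: it applies to the Kronecker symbol, to a sign raised to the
2-adic valuation, and to the sign of the odd part. -/
theorem signExp_bigPi {N : ℕ} (r : ℕ → ℤ) {φ : ℕ → ℤ} (h1 : φ 1 = 1)
    (hmul : ∀ m n, m ≠ 0 → n ≠ 0 → φ (m * n) = φ m * φ n) (hu : ∀ m, m ∣ N → IsUnit (φ m)) :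
    IsUnit (φ (bigPi N r)) ∧
      ∑ n ∈ N.divisors, (r n : ZMod 8) * signExp (φ (N / n)) = signExp (φ (bigPi N r)) := by
  have hu' : ∀ n ∈ N.divisors, IsUnit (φ (N / n)) := fun n hn =>
    hu _ (Nat.div_dvd_of_dvd (Nat.dvd_of_mem_divisors hn))
  obtain ⟨h2, h3⟩ := signExp_prod h1 hmul N.divisors (fun n => N / n) (fun n => (r n).natAbs)
    (fun _ hn => div_ne_zero_of_mem hn) hu'
  refine ⟨h2, ?_⟩
  unfold bigPi
  rw [h3]
  exact Finset.sum_congr rfl fun n hn => (natAbs_mul_signExp (hu' n hn) _).symm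

/-! ### Odd parts and the Kronecker symbol -/

/-- The odd part of `m`. -/
def oddPart (m : ℕ) : ℕ := m / 2 ^ padicValNat 2 m

theorem two_pow_mul_oddPart (m : ℕ) : 2 ^ padicValNat 2 m * oddPart m = m :=
  Nat.mul_div_cancel' pow_padicValNat_dvd

theorem odd_oddPart {m : ℕ} (hm : m ≠ 0) : Odd (oddPart m) := by
  rw [← Nat.not_even_iff_odd, even_iff_two_dvd]
  rintro ⟨k, hk⟩
  apply pow_succ_padicValNat_not_dvd (p := 2) hm
  refine ⟨k, ?_⟩
  conv_lhs => rw [← two_pow_mul_oddPart m, hk]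
  ring

theorem oddPart_dvd (m : ℕ) : oddPart m ∣ m := ⟨_, (two_pow_mul_oddPart m).symm.trans (mul_comm _ _)⟩

theorem oddPart_mul {m n : ℕ} (hm : m ≠ 0) (hn : n ≠ 0) :
    oddPart (m * n) = oddPart m * oddPart n := by
  unfold oddPart
  rw [padicValNat.mul hm hn, pow_add, Nat.mul_div_mul_comm pow_padicValNat_dvd pow_padicValNat_dvd]

theorem oddPart_of_odd {m : ℕ} (hm : Odd m) : padicValNat 2 m = 0 ∧ oddPart m = m := by
  have h : padicValNat 2 m = 0 := padicValNat.eq_zero_of_not_dvd hm.not_two_dvd_nat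
  exact ⟨h, by simp [oddPart, h]⟩

/-- The sign `(-1 / m')`, where `m'` is the odd part of `m`. -/
def oddSign (m : ℕ) : ℤ := if oddPart m % 4 = 3 then -1 else 1

theorem isUnit_oddSign (m : ℕ) : IsUnit (oddSign m) := by
  unfold oddSign
  split_ifs
  · exact isUnit_one.neg
  · exact isUnit_one

theorem oddSign_mul {m n : ℕ} (hm : m ≠ 0) (hn : n ≠ 0) :
    oddSign (m * n) = oddSign m * oddSign n := by
  unfold oddSign
  rw [oddPart_mul hm hn, Nat.mul_mod]
  have h1 := Nat.odd_iff.1 (odd_oddPart hm)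
  have h2 := Nat.odd_iff.1 (odd_oddPart hn)
  have h3 : oddPart m % 4 = 1 ∨ oddPart m % 4 = 3 := by omega
  have h4 : oddPart n % 4 = 1 ∨ oddPart n % 4 = 3 := by omega
  rcases h3 with h3 | h3 <;> rcases h4 with h4 | h4 <;> simp [h3, h4]

theorem signExp_oddSign_bigPi (N : ℕ) (r : ℕ → ℤ) :
    signExp (oddSign (bigPi N r)) = 4 * delta N r := by
  unfold oddSign delta oddPart
  split_ifs
  · rfl
  · rw [signExp_one]; simp

theorem kronecker_natCast (a : ℤ) {m : ℕ} (hm : m ≠ 0) :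
    kronecker a m = ZMod.χ₈ (a : ZMod 8) ^ padicValNat 2 m * jacobiSym a (oddPart m) := by
  unfold kronecker oddPart
  rw [if_neg (by exact_mod_cast hm), if_neg (by omega), one_mul, Int.natAbs_natCast]

theorem kronecker_mul (a : ℤ) {m n : ℕ} (hm : m ≠ 0) (hn : n ≠ 0) :
    kronecker a ((m * n : ℕ) : ℤ) = kronecker a m * kronecker a n := by
  rw [kronecker_natCast a (mul_ne_zero hm hn), kronecker_natCast a hm, kronecker_natCast a hn,
    padicValNat.mul hm hn, oddPart_mul hm hn,
    jacobiSym.mul_right' a (odd_oddPart hm).pos.ne' (odd_oddPart hn).pos.ne']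
  ring

theorem isUnit_χ₈ {a : ℤ} (ha : Odd a) : IsUnit (ZMod.χ₈ (a : ZMod 8)) := by
  rcases int_cast_odd ha with h | h | h | h <;> rw [h] <;> decide

theorem isUnit_jacobiSym {a : ℤ} {m : ℕ} (h : IsCoprime a m) : IsUnit (jacobiSym a m) :=
  Int.isUnit_iff.2 (jacobiSym.eq_one_or_neg_one (Int.isCoprime_iff_gcd_eq_one.1 h))

theorem odd_of_isCoprime_of_even {a : ℤ} {m : ℕ} (h : IsCoprime a m) (hm : Even m) : Odd a := by
  rw [← Int.not_even_iff_odd, even_iff_two_dvd]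
  intro h2
  have h3 : (2 : ℤ) ∣ m := by exact_mod_cast even_iff_two_dvd.1 hm
  have := Int.isUnit_iff.1 (h.isUnit_of_dvd' h2 h3)
  omega

theorem isUnit_kronecker {a : ℤ} {m : ℕ} (hm : m ≠ 0) (h : IsCoprime a m) :
    IsUnit (kronecker a m) := by
  rw [kronecker_natCast a hm]
  refine IsUnit.mul ?_ (isUnit_jacobiSym
    (h.of_isCoprime_of_dvd_right (Int.natCast_dvd_natCast.2 (oddPart_dvd m))))
  rcases Nat.even_or_odd m with he | ho
  · exact (isUnit_χ₈ (odd_of_isCoprime_of_even h he)).pow _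
  · rw [(oddPart_of_odd ho).1, pow_zero]
    exact isUnit_one

theorem kronecker_one (a : ℤ) : kronecker a ((1 : ℕ) : ℤ) = 1 := by
  rw [kronecker_natCast a one_ne_zero]
  simp [oddPart]

theorem signExp_kronecker_bigPi {N : ℕ} (hN : N ≠ 0) (r : ℕ → ℤ) {a : ℤ} (ha : IsCoprime a N) :
    IsUnit (kronecker a (bigPi N r)) ∧
      ∑ n ∈ N.divisors, (r n : ZMod 8) * signExp (kronecker a ((N / n : ℕ) : ℤ))
        = signExp (kronecker a (bigPi N r)) :=
  signExp_bigPi r (φ := fun m => kronecker a (m : ℤ)) (kronecker_one a)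
    (fun _ _ hm hn => kronecker_mul a hm hn) fun m hm => isUnit_kronecker
      (fun h0 => hN (by subst h0; exact Nat.eq_zero_of_zero_dvd hm))
      (ha.of_isCoprime_of_dvd_right (Int.natCast_dvd_natCast.2 hm))

theorem sum_padicValNat_mul_signExp (N : ℕ) (r : ℕ → ℤ) {c : ℤ} (hc : IsUnit c) :
    ∑ n ∈ N.divisors, (r n : ZMod 8) * (padicValNat 2 (N / n) * signExp c)
      = padicValNat 2 (bigPi N r) * signExp c := by
  have := (signExp_bigPi (N := N) r (φ := fun m => c ^ padicValNat 2 m) (by simp)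
    (fun m n hm hn => by simp only [padicValNat.mul hm hn, pow_add]) fun m _ => hc.pow _).2
  simpa only [signExp_pow hc] using this

theorem sum_mul_signExp_oddSign (N : ℕ) (r : ℕ → ℤ) :
    ∑ n ∈ N.divisors, (r n : ZMod 8) * signExp (oddSign (N / n)) = 4 * delta N r := by
  rw [← signExp_oddSign_bigPi]
  exact (signExp_bigPi r (by simp [oddSign, oddPart]) (fun _ _ hm hn => oddSign_mul hm hn)
    fun m _ => isUnit_oddSign m).2

/-! ### Reciprocity -/

/-- The two conjuncts serve positive and negative lower arguments, $s$ being the absolute value. In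
both cases the reciprocity sign is encoded as the product of the two numbers minus one. -/
theorem zmod8_flip : ∀ m s j : ZMod 8, (m = 1 ∨ m = 3 ∨ m = 5 ∨ m = 7) →
    (s = 1 ∨ s = 3 ∨ s = 5 ∨ s = 7) → (j = 1 ∨ j = -1) →
    2 * (1 - if (m = 3 ∨ m = 7) ∧ (s = 3 ∨ s = 7) then -j else j)
      = 2 * (1 - j) + (m - 1) * (s - 1) ∧
    2 * (1 - if (m = 3 ∨ m = 7) ∧ (s = 3 ∨ s = 7) then -j else j)
      = 2 * (1 - if m = 3 ∨ m = 7 then -j else j) + (m - 1) * (-s - 1) := by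
  decide

theorem zmod8_cast_sign {j : ℤ} (hj : IsUnit j) : (j : ZMod 8) = 1 ∨ (j : ZMod 8) = -1 := by
  rcases Int.isUnit_iff.1 hj with rfl | rfl
  · left; rfl
  · right; rfl

theorem zmod8_odd_natCast {m : ℕ} (hm : Odd m) :
    (m : ZMod 8) = 1 ∨ (m : ZMod 8) = 3 ∨ (m : ZMod 8) = 5 ∨ (m : ZMod 8) = 7 := by
  have := int_cast_odd (n := m) (by exact_mod_cast hm)
  rwa [Int.cast_natCast] at this

theorem signExp_jacobiSym_flip {m : ℕ} {s : ℤ} (hm : Odd m) (hs : Odd s) (hc : IsCoprime s m) :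
    signExp (jacobiSym m s.natAbs) = signExp (jacobiSym s m) + ((m : ZMod 8) - 1) * (s - 1) := by
  have hs' : Odd s.natAbs := Int.natAbs_odd.2 hs
  unfold signExp
  rw [jacobiSym_swap hm hs']
  have h1 := zmod8_odd_natCast hm
  have h2 := zmod8_odd_natCast hs'
  rcases Int.natAbs_eq s with h | h
  · have hj := zmod8_cast_sign (isUnit_jacobiSym hc)
    rw [h] at hj
    have := (zmod8_flip _ _ _ h1 h2 hj).1
    rw [this]
    conv_rhs => rw [h]
    rw [Int.cast_natCast]
  · have hc' : IsCoprime (s.natAbs : ℤ) m := by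
      have := hc.neg_left
      rwa [h, neg_neg] at this
    have hj := zmod8_cast_sign (isUnit_jacobiSym hc')
    have := (zmod8_flip _ _ _ h1 h2 hj).2
    rw [this]
    conv_rhs => rw [h]
    rw [jacobiSym_neg_cast _ hm, Int.cast_neg, Int.cast_natCast]

theorem χ₈_natAbs (s : ℤ) : ZMod.χ₈ ((s.natAbs : ℕ) : ZMod 8) = ZMod.χ₈ (s : ZMod 8) := by
  rcases Int.natAbs_eq s with h | h
  · conv_rhs => rw [h]
    rw [Int.cast_natCast]
  · conv_rhs => rw [h]
    rw [Int.cast_neg, Int.cast_natCast]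
    generalize ((s.natAbs : ℕ) : ZMod 8) = u
    revert u
    decide

theorem signExp_jacobiSym_flip_general {m : ℕ} {s : ℤ} (hm : m ≠ 0) (hs : Odd s)
    (hc : IsCoprime s m) :
    signExp (jacobiSym m s.natAbs) = padicValNat 2 m * signExp (ZMod.χ₈ (s : ZMod 8))
      + signExp (jacobiSym s (oddPart m)) + ((oddPart m : ZMod 8) - 1) * (s - 1) := by
  have hs' : Odd s.natAbs := Int.natAbs_odd.2 hs
  have hc' : IsCoprime s (oddPart m : ℤ) :=
    hc.of_isCoprime_of_dvd_right (Int.natCast_dvd_natCast.2 (oddPart_dvd m))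
  have h1 : jacobiSym m s.natAbs
      = ZMod.χ₈ (s : ZMod 8) ^ padicValNat 2 m * jacobiSym (oddPart m) s.natAbs := by
    conv_lhs => rw [← two_pow_mul_oddPart m]
    push_cast
    rw [jacobiSym.mul_left, jacobiSym.pow_left, jacobiSym.at_two hs', χ₈_natAbs]
  have h2 : IsUnit (jacobiSym (oddPart m) s.natAbs) := by
    apply isUnit_jacobiSym
    rcases Int.natAbs_eq s with h | h
    · rw [h] at hc'
      exact hc'.symm
    · rw [h] at hc'
      exact hc'.symm.of_isCoprime_of_dvd_right (dvd_neg.2 dvd_rfl)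
  rw [h1, signExp_mul ((isUnit_χ₈ hs).pow _) h2, signExp_pow (isUnit_χ₈ hs),
    signExp_jacobiSym_flip (odd_oddPart hm) hs hc']
  ring

theorem jacobiSym_eq_of_mul_modEq_one {a s : ℤ} {m : ℕ} (h : a * s ≡ 1 [ZMOD m]) :
    jacobiSym a m = jacobiSym s m := by
  have h1 : jacobiSym a m * jacobiSym s m = 1 := by
    rw [← jacobiSym.mul_left, jacobiSym.mod_left' h, jacobiSym.one_left]
  rcases Int.isUnit_iff.1 (IsUnit.of_mul_eq_one _ h1) with h2 | h2
  · rw [h2] at h1 ⊢; omega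
  · rw [h2] at h1 ⊢; omega

theorem isCoprime_of_mul_modEq_one {a s : ℤ} {m : ℕ} (h : a * s ≡ 1 [ZMOD m]) :
    IsCoprime a m ∧ IsCoprime s m := by
  obtain ⟨k, hk⟩ := h.dvd
  exact ⟨⟨s, k, by linear_combination -hk⟩, ⟨a, k, by linear_combination -hk⟩⟩

/-- Reciprocity brings $\left(\frac m{|s|}\right)$ to symbols with denominator $m$, where $s$ may be
replaced by its inverse $a$. The factor 2 is not seen by the congruence modulo the odd part, whence
the correction $\chi_8(as)$. -/
theorem signExp_jacobiSym_natAbs {m : ℕ} {a s : ℤ} (hm : m ≠ 0) (ha : Odd a) (hs : Odd s)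
    (h : a * s ≡ 1 [ZMOD m]) :
    signExp (jacobiSym m s.natAbs) = signExp (kronecker a m)
      + padicValNat 2 m * signExp (ZMod.χ₈ ((a * s : ℤ) : ZMod 8))
      + ((oddPart m : ZMod 8) - 1) * (s - 1) := by
  obtain ⟨hca, hcs⟩ := isCoprime_of_mul_modEq_one h
  have hd : ((oddPart m : ℕ) : ℤ) ∣ m := Int.natCast_dvd_natCast.2 (oddPart_dvd m)
  rw [signExp_jacobiSym_flip_general hm hs hcs, kronecker_natCast a hm,
    signExp_mul ((isUnit_χ₈ ha).pow _) (isUnit_jacobiSym (hca.of_isCoprime_of_dvd_right hd)),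
    signExp_pow (isUnit_χ₈ ha), jacobiSym_eq_of_mul_modEq_one (h.of_dvd hd), Int.cast_mul,
    map_mul, signExp_mul (isUnit_χ₈ ha) (isUnit_χ₈ hs)]
  linear_combination (-(padicValNat 2 m : ZMod 8)) * two_mul_signExp (isUnit_χ₈ ha)

/-! ### Congruences modulo `8` between the invariants of `r` -/

theorem oddSign_cases {m : ℕ} :
    oddSign m = if (oddPart m : ZMod 8) = 3 ∨ (oddPart m : ZMod 8) = 7 then -1 else 1 := by
  unfold oddSign
  simp only [nat_emod_four_eq_three_iff]

theorem signExp_oddSign {m : ℕ} (hm : m ≠ 0) :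
    signExp (oddSign m) = 2 * ((oddPart m : ZMod 8) - 1) := by
  rw [oddSign_cases]
  rcases zmod8_odd_natCast (odd_oddPart hm) with h | h | h | h <;> rw [h] <;> decide

theorem zmod8_key_zero : ∀ m n t : ZMod 8, (m = 1 ∨ m = 3 ∨ m = 5 ∨ m = 7) →
    m * (n + n) * t * (m + 2 - ((if m = 3 ∨ m = 7 then -1 else 1 : ℤ) : ZMod 8)
      - t * (n + n)) = 0 := by
  decide

theorem zmod8_key_one : ∀ m n t : ZMod 8, (m = 1 ∨ m = 3 ∨ m = 5 ∨ m = 7) →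
    2 * m * n * t * (2 * m + 2 - ((if m = 3 ∨ m = 7 then -1 else 1 : ℤ) : ZMod 8)
      - t * n) + signExp (ZMod.χ₈ (1 + 2 * m * n * t)) = 0 := by
  decide

theorem zmod8_key_two : ∀ m n t : ZMod 8, (m = 1 ∨ m = 3 ∨ m = 5 ∨ m = 7) →
    4 * m * n * t * (4 * m + 2 - ((if m = 3 ∨ m = 7 then -1 else 1 : ℤ) : ZMod 8)
      - t * n) = 0 := by
  decide

/-- The contribution of one divisor to `zmod8_balance`, with $m=N/n$. Only $m$ modulo 8 matters, so
the valuation of $m$ at 2 has four cases: 0 (then $n$ is even), 1, 2 and at least 3. -/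
theorem zmod8_key {m n : ℕ} (hm : m ≠ 0) (hmn : Even (m * n)) (t : ℤ) :
    (m : ZMod 8) * n * t * (m + 2 - oddSign m - t * n)
      + padicValNat 2 m * signExp (ZMod.χ₈ ((1 + m * n * t : ℤ) : ZMod 8)) = 0 := by
  have hodd := zmod8_odd_natCast (odd_oddPart hm)
  have hm2 : (m : ZMod 8) = 2 ^ padicValNat 2 m * oddPart m := by
    conv_lhs => rw [← two_pow_mul_oddPart m]
    push_cast
    rfl
  have hu : IsUnit (ZMod.χ₈ ((1 + m * n * t : ℤ) : ZMod 8)) := by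
    apply isUnit_χ₈
    obtain ⟨k, hk⟩ := hmn
    refine ⟨k * t, ?_⟩
    have : (m : ℤ) * n = k + k := by exact_mod_cast hk
    rw [this]
    ring
  rw [oddSign_cases]
  rcases h : padicValNat 2 m with _ | _ | _ | v
  · rw [h, pow_zero, one_mul] at hm2
    have hm' : Odd m := by
      have := odd_oddPart hm
      rw [← two_pow_mul_oddPart m, h, pow_zero, one_mul]
      exact this
    obtain ⟨k, hk⟩ := (Nat.even_mul.1 hmn).resolve_left (Nat.not_even_iff_odd.2 hm')
    have := zmod8_key_zero (oddPart m) k t hodd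
    rw [hm2, hk]
    push_cast at this ⊢
    rw [this]
    ring
  · rw [h] at hm2
    have := zmod8_key_one (oddPart m) n t hodd
    push_cast at hm2 ⊢
    rw [hm2]
    push_cast at this ⊢
    simpa using this
  · rw [h] at hm2
    have := zmod8_key_two (oddPart m) n t hodd
    -- An even multiple of an encoded sign is zero.
    have h2 : (((0 + 1 + 1 : ℕ) : ℕ) : ZMod 8) * signExp (ZMod.χ₈ ((1 + m * n * t : ℤ) : ZMod 8))
        = 0 := by
      rw [← two_mul_signExp hu]
      push_cast
      ring
    rw [h2, hm2, add_zero]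
    push_cast at this ⊢
    rw [← this]
    ring
  · rw [h] at hm2
    have h8 : (8 : ZMod 8) = 0 := rfl
    have h0 : (m : ZMod 8) = 0 := by
      rw [hm2]
      linear_combination 2 ^ v * (oddPart m : ZMod 8) * h8
    push_cast
    rw [h0]
    simp [signExp_one]

/-- `∑ (N / n) r_n`. -/
def coSum (N : ℕ) (r : ℕ → ℤ) : ℤ := ∑ n ∈ N.divisors, ((N / n : ℕ) : ℤ) * r n

/-- The weighted sum of `zmod8_key` over the divisors. With $1+Nt=axy$ it removes the $\chi_8$ term
from the exponent for even $N$; with small values of $t$ it yields the divisibility that trivialises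
the term of $\psi$ in $b$. -/
theorem zmod8_balance {N : ℕ} (hN : Even N) (r : ℕ → ℤ) (t : ℤ) :
    (N : ZMod 8) * t * (coSum N r + (∑ n ∈ N.divisors, r n : ℤ) + 2 * delta N r - t * xN N r)
      + padicValNat 2 (bigPi N r) * signExp (ZMod.χ₈ ((1 + N * t : ℤ) : ZMod 8)) = 0 := by
  have hu : IsUnit (ZMod.χ₈ ((1 + N * t : ℤ) : ZMod 8)) := by
    apply isUnit_χ₈
    obtain ⟨k, hk⟩ := hN
    exact ⟨k * t, by rw [hk]; push_cast; ring⟩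
  have hterm : ∀ n ∈ N.divisors, (r n : ZMod 8) * ((N : ZMod 8) * t * (((N / n : ℕ) : ZMod 8) + 2
      - oddSign (N / n) - t * n)
      + padicValNat 2 (N / n) * signExp (ZMod.χ₈ ((1 + N * t : ℤ) : ZMod 8))) = 0 := by
    intro n hn
    have hmn : N / n * n = N := Nat.div_mul_cancel (Nat.dvd_of_mem_divisors hn)
    have hmn' : (((N / n : ℕ) : ZMod 8)) * n = N := by
      rw [← Nat.cast_mul, hmn]
    have hmn'' : (((N / n : ℕ) : ℤ)) * n = N := by
      rw [← Nat.cast_mul, hmn]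
    have := zmod8_key (div_ne_zero_of_mem hn) (by rw [hmn]; exact hN) t
    rw [hmn', hmn''] at this
    rw [this, mul_zero]
  have hsum := Finset.sum_eq_zero hterm
  have hdelta := sum_mul_signExp_oddSign N r
  obtain ⟨k, hk⟩ := hN
  have hk' : (N : ZMod 8) = k + k := by rw [hk]; push_cast; rfl
  have hJ := sum_padicValNat_mul_signExp N r hu
  rw [← hJ]
  -- Only $4\delta$ is available as a sum over divisors; writing $N=2k$ supplies the missing factor
  -- 2.
  have h1 : (N : ZMod 8) * t * (2 * delta N r)
      = ∑ n ∈ N.divisors, (r n : ZMod 8) * ((N : ZMod 8) * t * (1 - oddSign (N / n))) := by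
    have : (N : ZMod 8) * t * (2 * delta N r) = k * t * (4 * delta N r) := by
      rw [hk']; ring
    rw [this, ← hdelta, Finset.mul_sum]
    refine Finset.sum_congr rfl fun n _ => ?_
    rw [hk', signExp]
    ring
  unfold coSum xN
  have h2 : ∀ A B C D E F : ZMod 8, E * F * (A + B + C - F * D)
      = E * F * C + (E * F * A + E * F * B - E * F * F * D) := by intros; ring
  rw [h2, h1, ← hsum]
  simp only [Int.cast_sum, Int.cast_mul, Int.cast_natCast, Finset.mul_sum]
  rw [← Finset.sum_add_distrib, ← Finset.sum_sub_distrib, ← Finset.sum_add_distrib,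
    ← Finset.sum_add_distrib]
  refine Finset.sum_congr rfl fun n _ => ?_
  ring

/-! ### The values of `Ψ` entering the Hecke operator -/

theorem zmod8_sq_of_odd {n : ℤ} (hn : Odd n) : (n : ZMod 8) ^ 2 = 1 := by
  rcases int_cast_odd hn with h | h | h | h <;> rw [h] <;> rfl

theorem zmod8_four_mul_odd {n : ℤ} (hn : Odd n) : 4 * ((n : ZMod 8) - 1) = 0 := by
  rcases int_cast_odd hn with h | h | h | h <;> rw [h] <;> rfl

theorem zmod8_two_mul_odd {m n : ℤ} (hm : Odd m) (hn : Odd n) :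
    2 * ((m : ZMod 8) - 1) * (n - 1) = 0 := by
  obtain ⟨i, rfl⟩ := hm
  obtain ⟨j, rfl⟩ := hn
  have h8 : (8 : ZMod 8) = 0 := rfl
  push_cast
  linear_combination (i : ZMod 8) * j * h8

theorem two_mul_jacobiSym_cast (j : ℤ) : 2 * (j : ZMod 8) = 2 - signExp j := by
  unfold signExp; ring

/-- `Ψ` at `(A, z n; -(N / n) d, y)`, with `m = N / n`. -/
theorem exists_Psi_lower_neg {A y z : ℤ} {m n d : ℕ} (hm : 0 < m) (hd : 0 < d)
    (hdet : A * y + (m * n : ℕ) * d * z = 1) :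
    ∃ P : ℤ, Psi A (z * n) (-((m * d : ℕ) : ℤ)) y = P ∧
      (P : ZMod 3) = -(A + y) * (m * d) - z * n * y * (((m : ZMod 3) * d) ^ 2 - 1) ∧
      (Odd y → (P : ZMod 8) = y * z * n + y * m * d + y + 7
        + signExp (jacobiSym ((m * d : ℕ) : ℤ) y.natAbs)) ∧
      (Odd (m * d) → (P : ZMod 8) = m * d * (-A - y - 1) + 4 + signExp (jacobiSym y (m * d))) := by
  have hmd : 0 < ((m * d : ℕ) : ℤ) := by exact_mod_cast Nat.mul_pos hm hd
  have hcop : IsCoprime y ((m * d : ℕ) : ℤ) :=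
    ⟨A, n * z, by push_cast at hdet ⊢; linear_combination hdet⟩
  obtain ⟨P, hP, h3, hy, hc⟩ := exists_Psi_mod (a := -A) (b := -(z * n)) (d := -y) hmd
    (by push_cast at hdet ⊢; linear_combination hdet)
  refine ⟨P + 6, ?_, ?_, ?_, ?_⟩
  · rw [Psi_neg (by omega), neg_neg, hP]
    push_cast
    rfl
  · have h33 : (3 : ZMod 3) = 0 := rfl
    push_cast at h3 ⊢
    rw [h3]
    linear_combination 2 * h33
  · intro hyo
    have h1 := hy hyo.neg
    have h2 := zmod8_sq_of_odd hyo
    rw [Int.natAbs_neg] at h1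
    rw [two_mul_jacobiSym_cast] at h1
    have hu : IsUnit (jacobiSym ((m * d : ℕ) : ℤ) y.natAbs) := by
      apply isUnit_jacobiSym
      rcases Int.natAbs_eq y with h | h
      · rw [h] at hcop; exact hcop.symm
      · rw [h] at hcop
        exact hcop.symm.of_isCoprime_of_dvd_right (dvd_neg.2 dvd_rfl)
    have h4 := odd_mul_signExp hu hyo
    have h5 := two_mul_signExp hu
    push_cast at h1 h4 h5 ⊢
    linear_combination (-(y : ZMod 8)) * h1 + (1 - (P : ZMod 8)) * h2 - h4 - h5
  · intro hmdo
    have h1 := hc (by exact_mod_cast hmdo)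
    rw [Int.natAbs_natCast, neg_neg] at h1
    rw [two_mul_jacobiSym_cast (jacobiSym y (m * d))] at h1
    have hodd : Odd ((m * d : ℕ) : ℤ) := by exact_mod_cast hmdo
    have h2 := zmod8_sq_of_odd hodd
    have hu := isUnit_jacobiSym hcop
    have h4 := odd_mul_signExp hu hodd
    push_cast at h1 h2 h4 ⊢
    linear_combination ((m : ZMod 8) * d) * h1 + h4 + (-(P : ZMod 8) - 2) * h2

/-- `Ψ` at `(a y, t n; N / n, x)`, with `m = N / n`. -/
theorem exists_Psi_lower_pos {A t x : ℤ} {m n : ℕ} (hm : 0 < m)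
    (hdet : A * x - t * (m * n : ℕ) = 1) :
    ∃ P : ℤ, Psi A (t * n) m x = P ∧
      (P : ZMod 3) = (A + x) * m - t * n * x * ((m : ZMod 3) ^ 2 - 1) ∧
      (Odd x → (P : ZMod 8) = x * t * n - x * m + 1 - x + signExp (jacobiSym m x.natAbs)) ∧
      (Odd m → (P : ZMod 8) = m * (A + x - 1) - 2 + signExp (jacobiSym (-x) m)) := by
  have hm' : 0 < (m : ℤ) := by exact_mod_cast hm
  have hcop : IsCoprime x (m : ℤ) :=
    ⟨A, -(n * t), by push_cast at hdet ⊢; linear_combination hdet⟩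
  obtain ⟨P, hP, h3, hy, hc⟩ := exists_Psi_mod (a := A) (b := t * n) (d := x) hm'
    (by push_cast at hdet ⊢; linear_combination hdet)
  refine ⟨P, hP, ?_, ?_, ?_⟩
  · push_cast at h3 ⊢
    rw [h3]
  · intro hxo
    have h1 := hy hxo
    have h2 := zmod8_sq_of_odd hxo
    rw [two_mul_jacobiSym_cast] at h1
    have hu : IsUnit (jacobiSym (m : ℤ) x.natAbs) := by
      apply isUnit_jacobiSym
      rcases Int.natAbs_eq x with h | h
      · rw [h] at hcop; exact hcop.symm
      · rw [h] at hcop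
        exact hcop.symm.of_isCoprime_of_dvd_right (dvd_neg.2 dvd_rfl)
    have h4 := odd_mul_signExp hu hxo
    push_cast at h1 h4 ⊢
    linear_combination (x : ZMod 8) * h1 + (1 - (P : ZMod 8)) * h2 + h4
  · intro hmo
    have h1 := hc (by exact_mod_cast hmo)
    rw [Int.natAbs_natCast, two_mul_jacobiSym_cast (jacobiSym (-x) m)] at h1
    have hodd : Odd (m : ℤ) := by exact_mod_cast hmo
    have h2 := zmod8_sq_of_odd hodd
    have hu := isUnit_jacobiSym hcop.neg_left
    have h4 := odd_mul_signExp hu hodd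
    push_cast at h1 h2 h4 ⊢
    linear_combination (m : ZMod 8) * h1 + h4 + (-(P : ZMod 8) - 2) * h2

/-! ### Squares -/

/-- After division by $(a,d)$ the two cofactors are coprime with square product, so each is a
square. In Jacobi symbols $a$ and $d$ may then be replaced by $(a,d)$. -/
theorem exists_gcd_mul_sq {a d : ℕ} (ha : 0 < a) (h : IsSquare (a * d)) :
    ∃ α β : ℕ, a = Nat.gcd a d * α ^ 2 ∧ d = Nat.gcd a d * β ^ 2 := by
  obtain ⟨s, hs⟩ := h
  have hg : 0 < Nat.gcd a d := Nat.gcd_pos_of_pos_left d ha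
  obtain ⟨a', d', hco, ha', hd'⟩ := Nat.exists_coprime a d
  have hprod : a * d = (a' * Nat.gcd a d) * (d' * Nat.gcd a d) := congrArg₂ (· * ·) ha' hd'
  have hgs : Nat.gcd a d ∣ s := by
    rw [← Nat.pow_dvd_pow_iff two_ne_zero]
    exact ⟨a' * d', by rw [sq s, ← hs, hprod]; ring⟩
  obtain ⟨u, hu⟩ := hgs
  have h1 : a' * d' = u ^ 2 := by
    apply Nat.eq_of_mul_eq_mul_left (pow_pos hg 2)
    calc Nat.gcd a d ^ 2 * (a' * d') = (a' * Nat.gcd a d) * (d' * Nat.gcd a d) := by ring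
      _ = a * d := hprod.symm
      _ = Nat.gcd a d ^ 2 * u ^ 2 := by rw [hs, ← mul_pow, ← hu, sq]
  obtain ⟨α, hα⟩ := exists_eq_pow_of_mul_eq_pow (Nat.isUnit_iff.2 hco) h1
  obtain ⟨β, hβ⟩ := exists_eq_pow_of_mul_eq_pow (Nat.isUnit_iff.2 hco.symm) ((mul_comm d' a').trans h1)
  exact ⟨α, β, by rw [← hα, mul_comm]; exact ha', by rw [← hβ, mul_comm]; exact hd'⟩

theorem kronecker_of_odd (c : ℤ) {g : ℕ} (hg : Odd g) : kronecker c g = jacobiSym c g := by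
  rw [kronecker_natCast c hg.pos.ne', (oddPart_of_odd hg).1, (oddPart_of_odd hg).2, pow_zero,
    one_mul]

theorem kronecker_eq_of_modEq {c c' : ℤ} {g : ℕ} (hg : Odd g) (h : c ≡ c' [ZMOD g]) :
    kronecker c g = kronecker c' g := by
  rw [kronecker_of_odd c hg, kronecker_of_odd c' hg, jacobiSym.mod_left' h]

theorem mul_signExp_of_even {u : ℤ} (hu : IsUnit u) {w : ℤ} (hw : ¬ Odd w) :
    (w : ZMod 8) * signExp u = 0 :=
  even_mul_signExp hu (Int.not_odd_iff_even.1 hw)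

theorem isCoprime_gcd_of_det {N a b d : ℕ} {x y z : ℤ}
    (hdet : (-(N : ℤ) * b + a * x) * y + N * d * z = 1) :
    IsCoprime (-(N : ℤ) * b) ((Nat.gcd a d : ℕ) : ℤ) := by
  obtain ⟨a', ha'⟩ := Nat.gcd_dvd_left a d
  obtain ⟨d', hd'⟩ := Nat.gcd_dvd_right a d
  refine ⟨y, a' * x * y + N * d' * z, ?_⟩
  have h1 : (a : ℤ) = (Nat.gcd a d : ℕ) * a' := by exact_mod_cast ha'
  have h2 : (d : ℤ) = (Nat.gcd a d : ℕ) * d' := by exact_mod_cast hd'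
  linear_combination hdet - x * y * h1 - N * z * h2

theorem modEq_gcd (N b d a : ℕ) (x : ℤ) :
    -(N : ℤ) * b + a * x ≡ -(N : ℤ) * b [ZMOD (Nat.gcd a d : ℕ)] := by
  have h : ((Nat.gcd a d : ℕ) : ℤ) ∣ a * x :=
    (Int.natCast_dvd_natCast.2 (Nat.gcd_dvd_left a d)).mul_right x
  exact (Int.modEq_iff_dvd.2 ⟨-(h.choose), by linear_combination -h.choose_spec⟩)

/-- For odd $w$, $d$ is $(a,d)$ times a square, and modulo $(a,d)$ the inverse of $y$ is
$-Nb+ax\equiv-Nb$. For even $w$ both sides vanish; the factor $w$ treats the two cases together. -/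
theorem mul_signExp_jacobiSym_right {N a b d : ℕ} {x y z w : ℤ} (ha : 0 < a) (hd : Odd d)
    (hdet : (-(N : ℤ) * b + a * x) * y + N * d * z = 1) (hsq : Odd w → IsSquare (a * d)) :
    (w : ZMod 8) * signExp (jacobiSym y d)
      = w * signExp (kronecker (-(N : ℤ) * b) (Nat.gcd a d : ℕ)) := by
  have hcop : IsCoprime y (d : ℤ) := ⟨-(N : ℤ) * b + a * x, N * z, by linear_combination hdet⟩
  have hg : Nat.gcd a d ≠ 0 := (Nat.gcd_pos_of_pos_left d ha).ne'
  by_cases hw : Odd w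
  · obtain ⟨α, β, -, hβ⟩ := exists_gcd_mul_sq ha (hsq hw)
    have hgo : Odd (Nat.gcd a d) := hd.of_dvd_nat (Nat.gcd_dvd_right a d)
    have hβ0 : β ≠ 0 := by
      rintro rfl
      rw [hβ] at hd
      simp at hd
    congr 2
    have hyA : jacobiSym y (Nat.gcd a d) = jacobiSym (-(N : ℤ) * b + a * x) (Nat.gcd a d) := by
      apply jacobiSym_eq_of_mul_modEq_one
      have h1 : y * (-(N : ℤ) * b + a * x) ≡ 1 [ZMOD (d : ℤ)] :=
        Int.modEq_iff_dvd.2 ⟨N * z, by linear_combination -hdet⟩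
      exact h1.of_dvd (Int.natCast_dvd_natCast.2 (Nat.gcd_dvd_right a d))
    have hcβ : IsCoprime y (β : ℤ) := hcop.of_isCoprime_of_dvd_right
      (Int.natCast_dvd_natCast.2 ⟨Nat.gcd a d * β, hβ.trans (by ring)⟩)
    rw [kronecker_of_odd _ hgo, ← jacobiSym.mod_left' (modEq_gcd N b d a x), ← hyA]
    conv_lhs => rw [hβ]
    rw [jacobiSym.mul_right' y hg (pow_ne_zero 2 hβ0), jacobiSym.pow_right,
      jacobiSym.sq_one (Int.isCoprime_iff_gcd_eq_one.1 hcβ), mul_one]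
  · rw [mul_signExp_of_even (isUnit_jacobiSym hcop) hw,
      mul_signExp_of_even (isUnit_kronecker hg (isCoprime_gcd_of_det hdet)) hw]

theorem isCoprime_natAbs_right {m y : ℤ} (h : IsCoprime m y) : IsCoprime m (y.natAbs : ℤ) := by
  rcases Int.natAbs_eq y with h' | h'
  · rw [h'] at h; exact h
  · rw [h'] at h
    exact h.of_isCoprime_of_dvd_right (dvd_neg.2 dvd_rfl)

/-- The counterpart for possibly even $d$, where $y$ is the denominator. Here $(a,d)$ is odd because
$a$ is, so reciprocity can be applied to it and $y$. -/
theorem mul_signExp_jacobiSym_left {N a b d : ℕ} {x y z w : ℤ} (ha : Odd a) (hy : Odd y)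
    (hdet : (-(N : ℤ) * b + a * x) * y + N * d * z = 1) (hsq : Odd w → IsSquare (a * d)) :
    (w : ZMod 8) * signExp (jacobiSym d y.natAbs)
      = w * signExp (kronecker (-(N : ℤ) * b) (Nat.gcd a d : ℕ)) + w * (a - 1) * (y - 1) := by
  have hcop : IsCoprime (d : ℤ) y := ⟨N * z, -(N : ℤ) * b + a * x, by linear_combination hdet⟩
  have hg : Nat.gcd a d ≠ 0 := (Nat.gcd_pos_of_pos_left d ha.pos).ne'
  by_cases hw : Odd w
  · obtain ⟨α, β, hα, hβ⟩ := exists_gcd_mul_sq ha.pos (hsq hw)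
    have hgo : Odd (Nat.gcd a d) := ha.of_dvd_nat (Nat.gcd_dvd_left a d)
    have hcg : IsCoprime y ((Nat.gcd a d : ℕ) : ℤ) :=
      hcop.symm.of_isCoprime_of_dvd_right (Int.natCast_dvd_natCast.2 (Nat.gcd_dvd_right a d))
    have hyA : jacobiSym y (Nat.gcd a d) = jacobiSym (-(N : ℤ) * b + a * x) (Nat.gcd a d) := by
      apply jacobiSym_eq_of_mul_modEq_one
      have h1 : y * (-(N : ℤ) * b + a * x) ≡ 1 [ZMOD (d : ℤ)] :=
        Int.modEq_iff_dvd.2 ⟨N * z, by linear_combination -hdet⟩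
      exact h1.of_dvd (Int.natCast_dvd_natCast.2 (Nat.gcd_dvd_right a d))
    have hαo : Odd α := by
      have h1 : Odd (α ^ 2) := ha.of_dvd_nat ⟨_, hα.trans (mul_comm _ _)⟩
      exact (Nat.odd_pow_iff two_ne_zero).1 h1
    -- The cofactor $\alpha^2$ is an odd square, hence 1 modulo 8.
    have hag : (a : ZMod 8) = (Nat.gcd a d : ℕ) := by
      have h1 := zmod8_sq_of_odd (n := α) (by exact_mod_cast hαo)
      conv_lhs => rw [hα]
      push_cast at h1 ⊢
      rw [h1, mul_one]
    have hJ : jacobiSym d y.natAbs = jacobiSym (Nat.gcd a d : ℕ) y.natAbs := by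
      have hcβ : IsCoprime (β : ℤ) y :=
        (hcop.symm.of_isCoprime_of_dvd_right (Int.natCast_dvd_natCast.2
          ⟨Nat.gcd a d * β, hβ.trans (by ring)⟩)).symm
      conv_lhs => rw [hβ]
      push_cast
      rw [jacobiSym.mul_left, jacobiSym.pow_left,
        jacobiSym.sq_one (Int.isCoprime_iff_gcd_eq_one.1 (isCoprime_natAbs_right hcβ)), mul_one]
    rw [kronecker_of_odd _ hgo, ← jacobiSym.mod_left' (modEq_gcd N b d a x), ← hyA, hJ, hag,
      signExp_jacobiSym_flip hgo hy hcg]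
    ring
  · rw [mul_signExp_of_even (isUnit_jacobiSym (isCoprime_natAbs_right hcop)) hw,
      mul_signExp_of_even (isUnit_kronecker hg (isCoprime_gcd_of_det hdet)) hw]
    obtain ⟨w', rfl⟩ := Int.not_odd_iff_even.1 hw
    have := zmod8_two_mul_odd (m := a) (by exact_mod_cast ha) hy
    push_cast at this ⊢
    linear_combination (-(w' : ZMod 8)) * this

/-! ### The exponent of the product of the two characters -/

/-- The three formulas modulo 8 correspond to choosing an odd entry in the lower row of each matrix.
Different parities of $N$ and $d$ require different choices, but the integer $E$ is the same
throughout. -/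
theorem exists_Psi_add {N n a b d : ℕ} {x y z : ℤ} (hn : n ∈ N.divisors) (hd : 0 < d)
    (hdet : (-(N : ℤ) * b + a * x) * y + N * d * z = 1) :
    ∃ E : ℤ, Psi (-(N : ℤ) * b + a * x) (z * n) (-(N : ℤ) * d / n) y
        + Psi (a * y) ((b * y - d * z) * n) (N / n) x = E ∧
      (E : ZMod 3) = ((N / n : ℕ) : ZMod 3) * (-(-(N : ZMod 3) * b + a * x + y) * d + (a * y + x)
          - z * N * d ^ 2 * y - (b * y - d * z) * N * x)
          + n * (z * y + (b * y - d * z) * x) ∧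
      (Odd x → Odd y → (E : ZMod 8) = n * (x * (b * y - d * z) + y * z)
          + ((N / n : ℕ) : ZMod 8) * (y * d - x) + (y - x)
          + signExp (jacobiSym ((N / n : ℕ) : ℤ) x.natAbs)
          + signExp (jacobiSym ((N / n * d : ℕ) : ℤ) y.natAbs)) ∧
      (Odd (N / n * d) → (E : ZMod 8) = ((N / n : ℕ) : ZMod 8) * (a * y + x - 1
          - d * (-(N : ZMod 8) * b + a * x + y + 1)) + 2
          + signExp (jacobiSym (-x) (N / n)) + signExp (jacobiSym y (N / n * d))) ∧
      (Odd (N / n) → Odd y → (E : ZMod 8) = ((N / n : ℕ) : ZMod 8) * (a * y + x - 1) + 5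
          + y * z * n + y * ((N / n : ℕ) : ZMod 8) * d + y
          + signExp (jacobiSym (-x) (N / n))
          + signExp (jacobiSym ((N / n * d : ℕ) : ℤ) y.natAbs)) := by
  have hmn : N / n * n = N := Nat.div_mul_cancel (Nat.dvd_of_mem_divisors hn)
  have hm : 0 < N / n := Nat.pos_of_ne_zero (div_ne_zero_of_mem hn)
  have hn0 : (n : ℤ) ≠ 0 := by exact_mod_cast (Nat.pos_of_mem_divisors hn).ne'
  obtain ⟨P, hP, hP3, hPy, hPm⟩ := exists_Psi_lower_neg (A := -(N : ℤ) * b + a * x) (y := y)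
    (z := z) (n := n) hm hd (by rw [hmn]; exact hdet)
  obtain ⟨Q, hQ, hQ3, hQx, hQm⟩ := exists_Psi_lower_pos (A := a * y) (t := b * y - d * z) (x := x)
    (n := n) hm (by rw [hmn]; linear_combination hdet)
  have h1 : -(N : ℤ) * d / n = -((N / n * d : ℕ) : ℤ) := by
    apply Int.ediv_eq_of_eq_mul_left hn0
    conv_lhs => rw [← hmn]
    push_cast
    ring
  have hN3 : (((N / n : ℕ)) : ZMod 3) * n = N := by rw [← Nat.cast_mul, hmn]
  have hN8 : (((N / n : ℕ)) : ZMod 8) * n = N := by rw [← Nat.cast_mul, hmn]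
  have h8 : (8 : ZMod 8) = 0 := rfl
  refine ⟨P + Q, ?_, ?_, ?_, ?_, ?_⟩
  · rw [h1, hP, ← Int.natCast_div, hQ]
    push_cast
    rfl
  · rw [Int.cast_add, hP3, hQ3]
    simp only [Int.cast_add, Int.cast_mul, Int.cast_neg, Int.cast_natCast, Int.cast_sub]
    linear_combination (-(((N / n : ℕ)) : ZMod 3) * (z * d ^ 2 * y + (b * y - d * z) * x)) * hN3
  · intro hx hy
    rw [Int.cast_add, hPy hy, hQx hx]
    simp only [Int.cast_mul, Int.cast_natCast, Int.cast_sub]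
    linear_combination h8
  · intro ho
    rw [Int.cast_add, hPm ho, hQm (Nat.odd_mul.1 ho).1]
    simp only [Int.cast_add, Int.cast_mul, Int.cast_neg, Int.cast_natCast]
    ring
  · intro hmo hy
    rw [Int.cast_add, hPy hy, hQm hmo]
    simp only [Int.cast_mul, Int.cast_natCast]
    ring

/-! ### Weighted sums over the divisors of the level -/

theorem cast_coSum (N : ℕ) (r : ℕ → ℤ) (R : Type*) [CommRing R] :
    (coSum N r : R) = ∑ n ∈ N.divisors, (r n : R) * ((N / n : ℕ) : R) := by
  unfold coSum
  rw [Int.cast_sum]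
  exact Finset.sum_congr rfl fun n _ => by rw [Int.cast_mul, Int.cast_natCast, mul_comm]

theorem cast_xN (N : ℕ) (r : ℕ → ℤ) (R : Type*) [CommRing R] :
    (xN N r : R) = ∑ n ∈ N.divisors, (r n : R) * (n : R) := by
  unfold xN
  rw [Int.cast_sum]
  exact Finset.sum_congr rfl fun n _ => by rw [Int.cast_mul, Int.cast_natCast, mul_comm]

theorem sum_linear {N : ℕ} (r : ℕ → ℤ) (R : Type*) [CommRing R] (u v c : R) :
    ∑ n ∈ N.divisors, (r n : R) * (n * u + ((N / n : ℕ) : R) * v + c)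
      = xN N r * u + coSum N r * v + (∑ n ∈ N.divisors, r n : ℤ) * c := by
  rw [cast_coSum, cast_xN, Int.cast_sum, Finset.sum_mul, Finset.sum_mul, Finset.sum_mul,
    ← Finset.sum_add_distrib, ← Finset.sum_add_distrib]
  exact Finset.sum_congr rfl fun n _ => by ring

theorem sum_odd_level {N : ℕ} (r : ℕ → ℤ) {c : ℤ} (hc : Odd c) :
    ∑ n ∈ N.divisors, (r n : ZMod 8) * (((oddPart (N / n) : ℕ) : ZMod 8) - 1) * (c - 1)
      = 2 * delta N r * (c - 1) := by
  obtain ⟨k, rfl⟩ := hc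
  have h := sum_mul_signExp_oddSign N r
  have h2 : (2 : ZMod 8) * delta N r * ((2 * k + 1 : ℤ) - 1) = (4 * delta N r) * k := by
    push_cast; ring
  rw [h2, ← h, Finset.sum_mul]
  refine Finset.sum_congr rfl fun n hn => ?_
  rw [signExp_oddSign (div_ne_zero_of_mem hn)]
  push_cast
  ring

/-- Modulo $N$ the determinant condition reads $axy\equiv1$, so $xy$ inverts $a$ modulo every $N/n$.
This makes the symbols in $x$ and $y$ multiply to a symbol in $a$. -/
theorem modEq_one_of_det {N n a b d : ℕ} {x y z : ℤ} (hn : n ∈ N.divisors)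
    (hdet : (-(N : ℤ) * b + a * x) * y + N * d * z = 1) :
    (a : ℤ) * (x * y) ≡ 1 [ZMOD (N / n : ℕ)] := by
  have hmn : N / n * n = N := Nat.div_mul_cancel (Nat.dvd_of_mem_divisors hn)
  have hmn' : ((N / n : ℕ) : ℤ) * n = N := by exact_mod_cast hmn
  refine Int.modEq_iff_dvd.2 ⟨n * (d * z - b * y), ?_⟩
  linear_combination (-(d * z - b * y)) * hmn' - hdet

theorem jacobiSym_natAbs_mul {m x y : ℤ} (hx : x ≠ 0) (hy : y ≠ 0) :
    jacobiSym m (x * y).natAbs = jacobiSym m x.natAbs * jacobiSym m y.natAbs := by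
  rw [Int.natAbs_mul, jacobiSym.mul_right' m (Int.natAbs_ne_zero.2 hx) (Int.natAbs_ne_zero.2 hy)]

/-- The exponent modulo `8` for even `N`. -/
theorem sum_Psi_of_even {N a b d : ℕ} {x y z : ℤ} (hN : N ≠ 0) (r : ℕ → ℤ)
    (hdet : (-(N : ℤ) * b + a * x) * y + N * d * z = 1) (ha : Odd a) (hx : Odd x) (hy : Odd y)
    {E : ℕ → ℤ}
    (hE : ∀ n ∈ N.divisors, (E n : ZMod 8) = n * (x * (b * y - d * z) + y * z)
          + ((N / n : ℕ) : ZMod 8) * (y * d - x) + (y - x)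
          + signExp (jacobiSym ((N / n : ℕ) : ℤ) x.natAbs)
          + signExp (jacobiSym ((N / n * d : ℕ) : ℤ) y.natAbs)) :
    ∑ n ∈ N.divisors, (r n : ZMod 8) * E n
      = xN N r * (x * (b * y - d * z) + y * z) + coSum N r * (y * d - x)
        + (∑ n ∈ N.divisors, r n : ℤ) * (y - x + signExp (jacobiSym d y.natAbs))
        + signExp (kronecker a (bigPi N r))
        + padicValNat 2 (bigPi N r) * signExp (ZMod.χ₈ ((1 + N * (b * y - d * z) : ℤ) : ZMod 8))
        + 2 * delta N r * ((x * y : ℤ) - 1) := by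
  have hao : Odd (a : ℤ) := by exact_mod_cast ha
  have hs : Odd (x * y) := hx.mul hy
  have hx0 : x ≠ 0 := by rintro rfl; simp at hx
  have hy0 : y ≠ 0 := by rintro rfl; simp at hy
  have haN : IsCoprime (a : ℤ) N := ⟨x * y, d * z - b * y, by linear_combination hdet⟩
  have hyd : IsCoprime (d : ℤ) y := ⟨N * z, -(N : ℤ) * b + a * x, by linear_combination hdet⟩
  have haxy : (a : ℤ) * (x * y) = 1 + N * (b * y - d * z) := by linear_combination hdet
  have hu : IsUnit (ZMod.χ₈ ((1 + N * (b * y - d * z) : ℤ) : ZMod 8)) := by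
    rw [← haxy]
    exact isUnit_χ₈ (hao.mul hs)
  rw [← (signExp_kronecker_bigPi hN r haN).2, ← sum_padicValNat_mul_signExp N r hu,
    ← sum_odd_level r hs, ← sum_linear, ← Finset.sum_add_distrib, ← Finset.sum_add_distrib,
    ← Finset.sum_add_distrib]
  refine Finset.sum_congr rfl fun n hn => ?_
  have h1 := modEq_one_of_det hn hdet
  have h2 := signExp_jacobiSym_natAbs (div_ne_zero_of_mem hn) hao hs h1
  obtain ⟨-, hcs⟩ := isCoprime_of_mul_modEq_one h1
  have hcx : IsCoprime ((N / n : ℕ) : ℤ) (x.natAbs : ℤ) :=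
    isCoprime_natAbs_right (hcs.of_mul_left_left).symm
  have hcy : IsCoprime ((N / n : ℕ) : ℤ) (y.natAbs : ℤ) :=
    isCoprime_natAbs_right (hcs.of_mul_left_right).symm
  rw [jacobiSym_natAbs_mul hx0 hy0, signExp_mul (isUnit_jacobiSym hcx) (isUnit_jacobiSym hcy),
    haxy] at h2
  rw [hE n hn, Nat.cast_mul, jacobiSym.mul_left, signExp_mul (isUnit_jacobiSym hcy)
    (isUnit_jacobiSym (isCoprime_natAbs_right hyd))]
  linear_combination (r n : ZMod 8) * h2

theorem odd_div_of_odd {N n : ℕ} (hN : Odd N) (hn : n ∈ N.divisors) : Odd (N / n) :=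
  hN.of_dvd_nat (Nat.div_dvd_of_dvd (Nat.dvd_of_mem_divisors hn))

theorem signExp_kronecker_of_odd {m a : ℕ} {x y : ℤ} (hm : Odd m)
    (h : (a : ℤ) * (x * y) ≡ 1 [ZMOD m]) :
    signExp (kronecker a m) = signExp (jacobiSym x m) + signExp (jacobiSym y m) := by
  obtain ⟨-, hcs⟩ := isCoprime_of_mul_modEq_one h
  rw [kronecker_of_odd _ hm, jacobiSym_eq_of_mul_modEq_one h, jacobiSym.mul_left,
    signExp_mul (isUnit_jacobiSym hcs.of_mul_left_left) (isUnit_jacobiSym hcs.of_mul_left_right)]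

theorem signExp_jacobiSym_neg {m : ℕ} {x : ℤ} (hm : Odd m) (h : IsCoprime x m) :
    signExp (jacobiSym (-x) m) = signExp (jacobiSym x m) + 2 * ((m : ZMod 8) - 1) := by
  have hj := zmod8_cast_sign (isUnit_jacobiSym h)
  have hm' := zmod8_odd_natCast hm
  unfold signExp
  rw [jacobiSym_neg_cast x hm]
  generalize (m : ZMod 8) = m at *
  generalize (jacobiSym x _ : ZMod 8) = j at *
  revert m j
  decide

/-- The exponent modulo `8` for odd `N` and odd `d`. -/
theorem sum_Psi_of_odd {N a b d : ℕ} {x y z : ℤ} (hNo : Odd N) (r : ℕ → ℤ)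
    (hdet : (-(N : ℤ) * b + a * x) * y + N * d * z = 1) (hd : Odd d) {E : ℕ → ℤ}
    (hE : ∀ n ∈ N.divisors, (E n : ZMod 8) = ((N / n : ℕ) : ZMod 8) * (a * y + x - 1
          - d * (-(N : ZMod 8) * b + a * x + y + 1)) + 2
          + signExp (jacobiSym (-x) (N / n)) + signExp (jacobiSym y (N / n * d))) :
    ∑ n ∈ N.divisors, (r n : ZMod 8) * E n
      = coSum N r * (a * y + x + 1 - d * (-(N : ZMod 8) * b + a * x + y + 1))
        + signExp (kronecker a (bigPi N r))
        + (∑ n ∈ N.divisors, r n : ℤ) * signExp (jacobiSym y d) := by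
  have haN : IsCoprime (a : ℤ) N := ⟨x * y, d * z - b * y, by linear_combination hdet⟩
  have hyd : IsCoprime y (d : ℤ) := ⟨-(N : ℤ) * b + a * x, N * z, by linear_combination hdet⟩
  have h := sum_linear (N := N) r (ZMod 8) 0
    (a * y + x + 1 - d * (-(N : ZMod 8) * b + a * x + y + 1)) (signExp (jacobiSym y d))
  rw [mul_zero, zero_add] at h
  rw [add_right_comm, ← h, ← (signExp_kronecker_bigPi hNo.pos.ne' r haN).2,
    ← Finset.sum_add_distrib]
  refine Finset.sum_congr rfl fun n hn => ?_
  have hmo := odd_div_of_odd hNo hn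
  have h1 := modEq_one_of_det hn hdet
  obtain ⟨-, hcs⟩ := isCoprime_of_mul_modEq_one h1
  rw [hE n hn, signExp_kronecker_of_odd hmo h1, signExp_jacobiSym_neg hmo hcs.of_mul_left_left,
    jacobiSym.mul_right' y hmo.pos.ne' hd.pos.ne',
    signExp_mul (isUnit_jacobiSym hcs.of_mul_left_right) (isUnit_jacobiSym hyd)]
  ring

/-- The exponent modulo `8` for odd `N` and even `d`. -/
theorem sum_Psi_of_odd_of_even {N a b d : ℕ} {x y z : ℤ} (hNo : Odd N) (r : ℕ → ℤ)
    (hdet : (-(N : ℤ) * b + a * x) * y + N * d * z = 1) (hy : Odd y)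
    (hr : Even (∑ n ∈ N.divisors, r n)) (hX : (xN N r : ZMod 8) = 0)
    (hM : (coSum N r : ZMod 8) = 0) {E : ℕ → ℤ}
    (hE : ∀ n ∈ N.divisors, (E n : ZMod 8) = ((N / n : ℕ) : ZMod 8) * (a * y + x - 1) + 5
          + y * z * n + y * ((N / n : ℕ) : ZMod 8) * d + y
          + signExp (jacobiSym (-x) (N / n))
          + signExp (jacobiSym ((N / n * d : ℕ) : ℤ) y.natAbs)) :
    ∑ n ∈ N.divisors, (r n : ZMod 8) * E n = signExp (kronecker a (bigPi N r)) := by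
  have haN : IsCoprime (a : ℤ) N := ⟨x * y, d * z - b * y, by linear_combination hdet⟩
  have hyd : IsCoprime (d : ℤ) y := ⟨N * z, -(N : ℤ) * b + a * x, by linear_combination hdet⟩
  have hud := isUnit_jacobiSym (isCoprime_natAbs_right hyd)
  have h := sum_linear (N := N) r (ZMod 8) (y * z)
    (a * y + x + 1 + y * d + (y - 1)) (4 + signExp (jacobiSym d y.natAbs))
  -- The sum of the $r_n$ is even, and it multiplies quantities killed by 2 modulo 8.
  have h0 : ((∑ n ∈ N.divisors, r n : ℤ) : ZMod 8) * (4 + signExp (jacobiSym d y.natAbs)) = 0 := by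
    rw [mul_add, even_mul_signExp hud hr]
    obtain ⟨k, hk⟩ := hr
    have h8 : (8 : ZMod 8) = 0 := rfl
    rw [hk]
    push_cast
    linear_combination (k : ZMod 8) * h8
  rw [hX, hM, h0, zero_mul, zero_mul, add_zero, add_zero] at h
  rw [← (signExp_kronecker_bigPi hNo.pos.ne' r haN).2, ← sub_eq_zero, ← Finset.sum_sub_distrib,
    ← h]
  refine Finset.sum_congr rfl fun n hn => ?_
  have hmo := odd_div_of_odd hNo hn
  have h1 := modEq_one_of_det hn hdet
  obtain ⟨-, hcs⟩ := isCoprime_of_mul_modEq_one h1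
  rw [hE n hn, signExp_kronecker_of_odd hmo h1, signExp_jacobiSym_neg hmo hcs.of_mul_left_left,
    Nat.cast_mul, jacobiSym.mul_left, signExp_mul
      (isUnit_jacobiSym (isCoprime_natAbs_right hcs.of_mul_left_right.symm)) hud,
    signExp_jacobiSym_flip hmo hy hcs.of_mul_left_right]
  ring

/-- The integer `v` with `ψ_{l,r}(a, b) = e(v / 8)`. -/
def psiExp (N l : ℕ) (r : ℕ → ℤ) (w : ℤ) (a : ℕ) : ℤ :=
  if ¬ 2 ∣ l then
    (w + 2 * delta N r) * (((l : ℤ) - 1) * ((N : ℤ) - 1) - (((l / a : ℕ) : ℤ) - 1))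
  else if 2 ∣ N then -((w + 2 * delta N r) * ((a : ℤ) - 1))
  else 0

/-! ### Assembling the congruence modulo 8 -/

theorem zmod8_eq_zero_of_odd_mul {n : ℤ} (hn : Odd n) {X : ZMod 8} (h : (n : ZMod 8) * X = 0) :
    X = 0 := by
  have := zmod8_sq_of_odd hn
  linear_combination (n : ZMod 8) * h - X * this

theorem even_mul_four {n : ℤ} (hn : Even n) : 4 * (n : ZMod 8) = 0 := by
  obtain ⟨k, rfl⟩ := hn
  have h8 : (8 : ZMod 8) = 0 := rfl
  push_cast
  linear_combination (k : ZMod 8) * h8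

/-- Odd squares are 1 modulo 8, so $n\equiv(N/n)^2n=N\cdot(N/n)$ term by term. -/
theorem xN_eq_of_odd {N : ℕ} (hN : Odd N) (r : ℕ → ℤ) :
    (xN N r : ZMod 8) = N * coSum N r := by
  rw [cast_xN, cast_coSum, Finset.mul_sum]
  refine Finset.sum_congr rfl fun n hn => ?_
  have hmn : (((N / n : ℕ)) : ZMod 8) * n = N := by
    rw [← Nat.cast_mul, Nat.div_mul_cancel (Nat.dvd_of_mem_divisors hn)]
  have h2 := zmod8_sq_of_odd (n := ((N / n : ℕ) : ℤ)) (by exact_mod_cast odd_div_of_odd hN hn)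
  rw [Int.cast_natCast] at h2
  linear_combination (-(r n : ZMod 8) * n) * h2 + (r n : ZMod 8) * ((N / n : ℕ) : ZMod 8) * hmn

/-- This is a congruence modulo 4 between $\sum\frac Nn r_n$ and $\sum r_n+2\delta$: each $N/n-1$
is, modulo 4, the encoded sign divided by 2. -/
theorem two_mul_coSum_of_odd {N : ℕ} (hN : Odd N) (r : ℕ → ℤ) :
    2 * (coSum N r : ZMod 8) = 2 * ((∑ n ∈ N.divisors, r n : ℤ) + 2 * delta N r) := by
  have h := sum_mul_signExp_oddSign N r
  have h1 : ∑ n ∈ N.divisors, (r n : ZMod 8) * signExp (oddSign (N / n))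
      = 2 * (coSum N r : ZMod 8) - 2 * (∑ n ∈ N.divisors, r n : ℤ) := by
    rw [cast_coSum, Int.cast_sum, Finset.mul_sum, Finset.mul_sum, ← Finset.sum_sub_distrib]
    refine Finset.sum_congr rfl fun n hn => ?_
    rw [signExp_oddSign (div_ne_zero_of_mem hn), (oddPart_of_odd (odd_div_of_odd hN hn)).2]
    ring
  linear_combination h - h1

/-- For odd $N$ every $N/n$ is odd, so $\sum\frac Nn r_n$ and $\sum r_n$ have the same parity. -/
theorem even_sum_of_odd {N : ℕ} (hN : Odd N) (r : ℕ → ℤ) (hM : (coSum N r : ZMod 8) = 0) :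
    Even (∑ n ∈ N.divisors, r n) := by
  have h1 : Even (coSum N r) := by
    rw [even_iff_two_dvd]
    exact (by norm_num : (2 : ℤ) ∣ 8).trans ((ZMod.intCast_zmod_eq_zero_iff_dvd _ 8).1 hM)
  have h2 : Even (coSum N r - ∑ n ∈ N.divisors, r n) := by
    unfold coSum
    rw [← Finset.sum_sub_distrib]
    refine Finset.even_sum _ fun n hn => ?_
    have : Odd ((N / n : ℕ) : ℤ) := by exact_mod_cast odd_div_of_odd hN hn
    obtain ⟨k, hk⟩ := this
    exact ⟨k * r n, by rw [hk]; ring⟩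
  have := h1.sub h2
  rwa [sub_sub_cancel] at this

theorem zmod8_mul_odd_product {a d N : ℕ} (ha : Odd a) (hd : Odd d) (hN : Even N) :
    2 * ((a : ZMod 8) * d - 1) * N = 0 := by
  obtain ⟨i, rfl⟩ := ha
  obtain ⟨j, rfl⟩ := hd
  obtain ⟨k, rfl⟩ := hN
  have h8 : (8 : ZMod 8) = 0 := rfl
  push_cast
  linear_combination (k : ZMod 8) * (2 * i * j + i + j) * h8

theorem natCast_eq_of_sq {a d : ℕ} (ha : Odd a) (hd : Odd d) (h : IsSquare (a * d)) :
    (a : ZMod 8) * d = 1 := by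
  obtain ⟨s, hs⟩ := h
  have hso : Odd s := (Nat.odd_mul.1 (hs ▸ ha.mul hd)).1
  have := zmod8_sq_of_odd (n := s) (by exact_mod_cast hso)
  rw [Int.cast_natCast] at this
  rw [← Nat.cast_mul, hs, Nat.cast_mul, ← sq, this]

theorem cast_weight {w ρ i : ℤ} (hw : w = ρ + 4 * i) : (ρ : ZMod 8) = w - 4 * i := by
  rw [hw]; push_cast; ring

/-- The exponent of the product of the two characters, modulo `8`. -/
theorem sum_Psi_mod_eight {N a b d : ℕ} {x y z w i : ℤ} (hN : N ≠ 0) (ha : 0 < a)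
    (r : ℕ → ℤ) (hw : w = ∑ n ∈ N.divisors, r n + 4 * i)
    (hdet : (-(N : ℤ) * b + a * x) * y + N * d * z = 1) (haN : Nat.Coprime a N)
    (hsq : Odd w → IsSquare (a * d))
    (hX : ((a * d : ℤ) - 1 : ℤ) * (xN N r : ZMod 8) = 0)
    (hM : ((a * d : ℤ) - 1 : ℤ) * (coSum N r : ZMod 8) = 0) {E : ℕ → ℤ}
    (hI : ∀ n ∈ N.divisors, Odd x → Odd y →
      (E n : ZMod 8) = n * (x * (b * y - d * z) + y * z)
          + ((N / n : ℕ) : ZMod 8) * (y * d - x) + (y - x)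
          + signExp (jacobiSym ((N / n : ℕ) : ℤ) x.natAbs)
          + signExp (jacobiSym ((N / n * d : ℕ) : ℤ) y.natAbs))
    (hII : ∀ n ∈ N.divisors, Odd (N / n * d) →
      (E n : ZMod 8) = ((N / n : ℕ) : ZMod 8) * (a * y + x - 1
          - d * (-(N : ZMod 8) * b + a * x + y + 1)) + 2
          + signExp (jacobiSym (-x) (N / n)) + signExp (jacobiSym y (N / n * d)))
    (hIII : ∀ n ∈ N.divisors, Odd (N / n) → Odd y →
      (E n : ZMod 8) = ((N / n : ℕ) : ZMod 8) * (a * y + x - 1) + 5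
          + y * z * n + y * ((N / n : ℕ) : ZMod 8) * d + y
          + signExp (jacobiSym (-x) (N / n))
          + signExp (jacobiSym ((N / n * d : ℕ) : ℤ) y.natAbs)) :
    ∑ n ∈ N.divisors, (r n : ZMod 8) * E n
      = b * d * xN N r + signExp (kronecker a (bigPi N r))
        + w * signExp (kronecker (-(N : ℤ) * b) (Nat.gcd a d : ℕ))
        - 3 * psiExp N (a * d) r w a := by
  have h8 : (8 : ZMod 8) = 0 := rfl
  have hρ := cast_weight hw
  have hdiv : a * d / a = d := Nat.mul_div_cancel_left d ha
  have hdet8 := congrArg (Int.cast : ℤ → ZMod 8) hdet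
  have hyd : IsCoprime (d : ℤ) y := ⟨N * z, -(N : ℤ) * b + a * x, by linear_combination hdet⟩
  have hkop := isCoprime_gcd_of_det hdet
  have hg : Nat.gcd a d ≠ 0 := (Nat.gcd_pos_of_pos_left d ha).ne'
  push_cast at hX hM hdet8
  rcases Nat.even_or_odd N with hNe | hNo
  · have ha' : Odd a := by
      rw [← Nat.not_even_iff_odd]
      intro hae
      have := Nat.dvd_gcd (even_iff_two_dvd.1 hae) (even_iff_two_dvd.1 hNe)
      rw [haN] at this
      omega
    have hao : Odd (a : ℤ) := by exact_mod_cast ha'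
    have hNe' : Even (N : ℤ) := by exact_mod_cast hNe
    have haxy : Odd (a * x * y) := by
      have : (a : ℤ) * x * y = 1 + N * (b * y - d * z) := by linear_combination hdet
      rw [this]
      exact odd_one.add_even (hNe'.mul_right _)
    have hx : Odd x := (Int.odd_mul.1 (Int.odd_mul.1 haxy).1).2
    have hy : Odd y := (Int.odd_mul.1 haxy).2
    have hs : (a : ℤ) * x * y = 1 + N * (b * y - d * z) := by linear_combination hdet
    have hu : IsUnit (ZMod.χ₈ ((1 + N * (b * y - d * z) : ℤ) : ZMod 8)) := by
      rw [← hs]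
      exact isUnit_χ₈ haxy
    have hsum := sum_Psi_of_even hN r hdet ha' hx hy (fun n hn => hI n hn hx hy)
    have hbal := zmod8_balance hNe r (b * y - d * z)
    have hxS := odd_mul_signExp hu hx
    have hSQ := mul_signExp_jacobiSym_left (w := w) ha' hy hdet hsq
    have hS2 := two_mul_signExp (isUnit_jacobiSym (isCoprime_natAbs_right hyd))
    have hN4 := even_mul_four hNe'
    have hx2 := zmod8_sq_of_odd hx
    have hy2 := zmod8_sq_of_odd hy
    have ha2 := zmod8_sq_of_odd hao
    have hx4 := zmod8_four_mul_odd hx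
    have hy4 := zmod8_four_mul_odd hy
    have ha4 := zmod8_four_mul_odd hao
    have hHxy := zmod8_two_mul_odd hx hy
    have hHay := zmod8_two_mul_odd hao hy
    rw [hsum]
    generalize signExp (ZMod.χ₈ ((1 + N * (b * y - d * z) : ℤ) : ZMod 8)) = S at *
    generalize signExp (jacobiSym d y.natAbs) = S' at *
    generalize signExp (kronecker (-(N : ℤ) * b) (Nat.gcd a d : ℕ)) = κ at *
    generalize (padicValNat 2 (bigPi N r) : ZMod 8) = J at *
    push_cast at *
    rw [hρ] at hbal ⊢
    have ht : (N : ZMod 8) * (b * y - d * z) = a * x * y - 1 := by linear_combination -hdet8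
    -- The balance identity at $t=by-dz$, multiplied by $x$, which acts trivially on the encoded
    -- sign.
    have hJS : J * S = -(x * N * (b * y - d * z)
        * (coSum N r + w + 2 * delta N r - (b * y - d * z) * xN N r)) := by
      linear_combination x * hbal - J * hxS + x * i * (b * y - d * z) * hN4
    rcases Nat.even_or_odd d with hde | hdo
    · have hl : 2 ∣ a * d := (even_iff_two_dvd.1 hde).mul_left a
      have hlo : Odd ((a : ℤ) * d - 1) := by
        have : Even (d : ℤ) := by exact_mod_cast hde
        exact (this.mul_left _).sub_odd odd_one
      -- For even $l$ the number $l-1$ is a unit modulo 8, so the condition on $l$ forces both level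
      -- sums to vanish.
      have hX0 : (xN N r : ZMod 8) = 0 :=
        zmod8_eq_zero_of_odd_mul hlo (by push_cast; exact hX)
      have hM0 : (coSum N r : ZMod 8) = 0 :=
        zmod8_eq_zero_of_odd_mul hlo (by push_cast; exact hM)
      rw [psiExp, if_neg (not_not.2 hl), if_pos (even_iff_two_dvd.1 hNe), hJS, hX0, hM0]
      push_cast
      have hδ : 2 * ((x : ZMod 8) * y - 1 - (a * y - x) - 3 * (a - 1)) = 0 := by
        linear_combination hHxy - hHay + hx4 - (a - 1) * h8
      linear_combination hSQ - i * (hy4 - hx4) - 2 * i * hS2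
        - x * (w + 2 * delta N r) * ht - a * y * (w + 2 * delta N r) * hx2
        - w * ha4 + delta N r * hδ
    · have hl : ¬ 2 ∣ a * d := (ha'.mul hdo).not_two_dvd_nat
      have hdo' : Odd (d : ℤ) := by exact_mod_cast hdo
      have hd2 := zmod8_sq_of_odd hdo'
      have hd4 := zmod8_four_mul_odd hdo'
      have hHad := zmod8_two_mul_odd hao hdo'
      have hG := zmod8_mul_odd_product ha' hdo hNe
      have hadX : ((a : ZMod 8) - d) * xN N r = 0 := by
        push_cast at hd2
        linear_combination d * hX - a * xN N r * hd2
      have hadM : ((a : ZMod 8) - d) * coSum N r = 0 := by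
        push_cast at hd2
        linear_combination d * hM - a * coSum N r * hd2
      push_cast at hd2 hd4 hHad
      have h2w : 2 * (4 - (a : ZMod 8) - 3 * d + 3 * (a * d - 1) * (N - 1)) = 0 := by
        linear_combination 3 * hG - 3 * hHad - 3 * hd4 - (a - 1) * h8
      -- For even $w$ twice the bracket suffices. For odd $w$ the product $ad$ is an odd square,
      -- hence 1 modulo 8, and $a\equiv d$.
      have hwF : (w : ZMod 8) * (4 - (a : ZMod 8) - 3 * d + 3 * (a * d - 1) * (N - 1)) = 0 := by
        rcases Int.even_or_odd w with ⟨v, hv⟩ | hwo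
        · rw [hv]
          push_cast
          linear_combination v * h2w
        · have h1 := natCast_eq_of_sq ha' hdo (hsq hwo)
          have h2 : (a : ZMod 8) = d := by linear_combination d * h1 - a * hd2
          rw [h1, h2]
          linear_combination (-(w : ZMod 8)) * hd4
      have hδ : 2 * ((x : ZMod 8) * y - 1 - (a * y - x) - 3 * (d - 1)
          + 3 * (a * d - 1) * (N - 1)) = 0 := by
        linear_combination hHxy - hHay + hx4 + 3 * hG - 3 * hHad - 3 * hd4 - (a - 1) * h8
      rw [psiExp, if_pos hl, hdiv, hJS]
      push_cast
      linear_combination hSQ - i * (hy4 - hx4) - 2 * i * hS2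
        - x * (coSum N r + w + 2 * delta N r - (b * y - d * z) * xN N r) * ht
        - a * y * (coSum N r + w + 2 * delta N r - (b * y - d * z) * xN N r) * hx2
        + xN N r * a * b * hy2 - y * z * hX + b * hadX - y * hadM + hwF + delta N r * hδ
  · rcases Nat.even_or_odd d with hde | hdo
    · have hl : 2 ∣ a * d := (even_iff_two_dvd.1 hde).mul_left a
      have hde' : Even (d : ℤ) := by exact_mod_cast hde
      have hlo : Odd ((a : ℤ) * d - 1) := (hde'.mul_left _).sub_odd odd_one
      have hX0 : (xN N r : ZMod 8) = 0 :=
        zmod8_eq_zero_of_odd_mul hlo (by push_cast; exact hX)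
      have hM0 : (coSum N r : ZMod 8) = 0 :=
        zmod8_eq_zero_of_odd_mul hlo (by push_cast; exact hM)
      have hy : Odd y := by
        have h1 : Odd ((-(N : ℤ) * b + a * x) * y) := by
          have : (-(N : ℤ) * b + a * x) * y = 1 - N * d * z := by linear_combination hdet
          rw [this]
          exact odd_one.sub_even ((hde'.mul_left _).mul_right _)
        exact (Int.odd_mul.1 h1).2
      have hre := even_sum_of_odd hNo r hM0
      have hwe : ¬ Odd w := by
        rw [Int.not_odd_iff_even, hw]
        exact hre.add ⟨2 * i, by ring⟩
      rw [sum_Psi_of_odd_of_even hNo r hdet hy hre hX0 hM0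
        (fun n hn => hIII n hn (odd_div_of_odd hNo hn) hy), hX0,
        mul_signExp_of_even (isUnit_kronecker hg hkop) hwe, psiExp, if_neg (not_not.2 hl),
        if_neg hNo.not_two_dvd_nat]
      simp
    · have hS2 := two_mul_signExp (isUnit_jacobiSym hyd.symm)
      have hSQ := mul_signExp_jacobiSym_right (w := w) ha hdo hdet hsq
      rw [sum_Psi_of_odd hNo r hdet hdo (fun n hn => hII n hn ((odd_div_of_odd hNo hn).mul hdo)),
        xN_eq_of_odd hNo]
      by_cases hl : 2 ∣ a * d
      · have hlo : Odd ((a : ℤ) * d - 1) := by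
          have : Even ((a : ℤ) * d) := by exact_mod_cast even_iff_two_dvd.2 hl
          exact this.sub_odd odd_one
        have hM0 : (coSum N r : ZMod 8) = 0 :=
          zmod8_eq_zero_of_odd_mul hlo (by push_cast; exact hM)
        rw [psiExp, if_neg (not_not.2 hl), if_neg hNo.not_two_dvd_nat, hM0, hρ]
        push_cast
        linear_combination hSQ - 2 * i * hS2
      · have hao : Odd a := (Nat.odd_mul.1 (Nat.not_even_iff_odd.1
          (fun h => hl (even_iff_two_dvd.1 h)))).1
        have hdo' : Odd (d : ℤ) := by exact_mod_cast hdo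
        have hd2 := zmod8_sq_of_odd hdo'
        have hd4 := zmod8_four_mul_odd hdo'
        have h2M := two_mul_coSum_of_odd hNo r
        push_cast at hd2 hd4
        have hadM : ((a : ZMod 8) - d) * coSum N r = 0 := by
          linear_combination d * hM - a * coSum N r * hd2
        -- The weight plus $2\delta$ agrees with the level sum only modulo 4; the other factor is
        -- even, which gives equality modulo 8.
        have hW : ((w : ZMod 8) + 2 * delta N r) * ((a * d - 1) * (N - 1) - (d - 1))
            = coSum N r * ((a * d - 1) * (N - 1) - (d - 1)) := by
          obtain ⟨u, hu⟩ : Even (((a : ℤ) * d - 1) * (N - 1) - (d - 1)) := by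
            have h1 : Even ((N : ℤ) - 1) := by
              have : Odd (N : ℤ) := by exact_mod_cast hNo
              exact this.sub_odd odd_one
            exact (h1.mul_left _).sub (hdo'.sub_odd odd_one)
          have hu' := congrArg (Int.cast : ℤ → ZMod 8) hu
          push_cast at hu'
          rw [hu']
          rw [hρ] at h2M
          linear_combination (-(u : ZMod 8)) * h2M + i * u * h8
        rw [psiExp, if_pos hl, hdiv, hρ]
        push_cast
        linear_combination hSQ - 2 * i * hS2 + 3 * hW
          + (y - x * d) * hadM + 3 * (N - 1) * hM - coSum N r * hd4 - coSum N r * x * hd2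

/-! ### The product of the two characters -/

theorem e_add (u v : ℂ) : e (u + v) = e u * e v := by
  unfold e
  rw [← Complex.exp_add, mul_add]

theorem e_zero : e 0 = 1 := by simp [e]

theorem e_intCast (n : ℤ) : e n = 1 := by
  unfold e
  rw [mul_comm]
  exact Complex.exp_int_mul_two_pi_mul_I n

theorem e_neg (u : ℂ) : e (-u) = (e u)⁻¹ := by
  unfold e
  rw [← Complex.exp_neg, mul_neg]

theorem e_ne_zero (u : ℂ) : e u ≠ 0 := Complex.exp_ne_zero _

theorem e_intCast_mul (n : ℤ) (u : ℂ) : e (n * u) = e u ^ n := by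
  unfold e
  rw [← Complex.exp_int_mul]
  congr 1
  ring

theorem e_add_intCast (u : ℂ) (n : ℤ) : e (u + n) = e u := by
  rw [e_add, e_intCast, mul_one]

theorem e_one_half : e (1 / 2) = -1 := by
  unfold e
  rw [← Complex.exp_pi_mul_I]
  congr 1
  ring

theorem intUnit_zpow_eq_e {u : ℤ} (hu : IsUnit u) (w : ℤ) :
    (u : ℂ) ^ w = e (-((6 * w * (1 - u) : ℤ) : ℂ) / 24) := by
  rcases Int.isUnit_iff.1 hu with rfl | rfl
  · simp [e_zero]
  · have : -((6 * w * (1 - -1) : ℤ) : ℂ) / 24 = ((-w : ℤ) : ℂ) * (1 / 2) := by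
      push_cast; ring
    rw [this, e_intCast_mul, e_one_half, zpow_neg, ← inv_zpow]
    norm_num

/-- Since $m_{\mathbf r}$ is 24 divided by a common divisor of the two level sums, $m_{\mathbf
r}\mid l-1$ is used in this multiplied form. -/
theorem modulus_dvd {N l : ℕ} {r : ℕ → ℤ} (hl : l ∈ monoidL N r) :
    (24 : ℤ) ∣ ((l : ℤ) - 1) * xN N r ∧ (24 : ℤ) ∣ ((l : ℤ) - 1) * coSum N r := by
  obtain ⟨-, hmod, -⟩ := hl
  have h1 : ((modulusR N r : ℕ) : ℤ) ∣ (l : ℤ) - 1 := by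
    have := (Int.natCast_modEq_iff.2 hmod).symm.dvd
    simpa using this
  have hM : (((Nat.gcd 24 (Int.gcd (coSum N r) (xN N r)) : ℕ)) : ℤ) ∣ coSum N r :=
    (Int.natCast_dvd_natCast.2 (Nat.gcd_dvd_right _ _)).trans (Int.gcd_dvd_left ..)
  have hX : (((Nat.gcd 24 (Int.gcd (coSum N r) (xN N r)) : ℕ)) : ℤ) ∣ xN N r :=
    (Int.natCast_dvd_natCast.2 (Nat.gcd_dvd_right _ _)).trans (Int.gcd_dvd_right ..)
  have h24 : (24 : ℤ) = ((modulusR N r : ℕ) : ℤ)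
      * ((Nat.gcd 24 (Int.gcd (coSum N r) (xN N r)) : ℕ) : ℤ) := by
    rw [← Nat.cast_mul]
    unfold modulusR coSum xN
    rw [Nat.div_mul_cancel (Nat.gcd_dvd_left _ _)]
    rfl
  rw [h24]
  exact ⟨mul_dvd_mul h1 hX, mul_dvd_mul h1 hM⟩

/-! ### The congruence modulo 3 and the product of the characters -/

theorem zmod3_level : ∀ a b x y z : ZMod 3, a * x * y = 1 →
    z * y + (b * y - a * z) * x = b * a := by
  decide

/-- The exponent of the product of the two characters, modulo `3`. -/
theorem sum_Psi_mod_three {N a b d : ℕ} {x y z : ℤ} (r : ℕ → ℤ)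
    (hdet : (-(N : ℤ) * b + a * x) * y + N * d * z = 1)
    (hX : ((a * d : ℤ) - 1 : ℤ) * (xN N r : ZMod 3) = 0)
    (hM : ((a * d : ℤ) - 1 : ℤ) * (coSum N r : ZMod 3) = 0) {E : ℕ → ℤ}
    (hE : ∀ n ∈ N.divisors, (E n : ZMod 3) = ((N / n : ℕ) : ZMod 3)
          * (-(-(N : ZMod 3) * b + a * x + y) * d + (a * y + x)
          - z * N * d ^ 2 * y - (b * y - d * z) * N * x)
          + n * (z * y + (b * y - d * z) * x)) :
    ∑ n ∈ N.divisors, (r n : ZMod 3) * E n = b * d * xN N r := by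
  have h := sum_linear (N := N) r (ZMod 3) (z * y + (b * y - d * z) * x)
    (-(-(N : ZMod 3) * b + a * x + y) * d + (a * y + x)
          - z * N * d ^ 2 * y - (b * y - d * z) * N * x) 0
  rw [mul_zero, add_zero] at h
  have hdet3 := congrArg (Int.cast : ℤ → ZMod 3) hdet
  push_cast at hX hM hdet3
  rw [Finset.sum_congr rfl fun n hn => by rw [hE n hn, add_comm, ← add_zero (_ + _)], h]
  -- If $l\not\equiv1$ modulo 3 both level sums vanish; otherwise $d\equiv a$, and the cases $3\mid
  -- N$ and $3\nmid N$ differ.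
  by_cases hl : (a : ZMod 3) * d - 1 = 0
  · have had : (a : ZMod 3) * d = 1 := sub_eq_zero.1 hl
    have hda : (d : ZMod 3) = a := by
      revert had
      generalize (a : ZMod 3) = u
      generalize (d : ZMod 3) = v
      revert u v
      decide
    rw [hda] at had hdet3 ⊢
    by_cases hN : (N : ZMod 3) = 0
    · have h1 := zmod3_level a b x y z (by rw [hN] at hdet3; linear_combination hdet3)
      rw [h1, hN]
      linear_combination (-(coSum N r : ZMod 3) * x) * had
    · have hXN : (xN N r : ZMod 3) = N * coSum N r := by
        rw [cast_xN, cast_coSum, Finset.mul_sum]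
        refine Finset.sum_congr rfl fun n hn => ?_
        have hmn : (((N / n : ℕ)) : ZMod 3) * n = N := by
          rw [← Nat.cast_mul, Nat.div_mul_cancel (Nat.dvd_of_mem_divisors hn)]
        have hm2 : ((N / n : ℕ) : ZMod 3) ^ 2 = 1 := by
          have h0 : ((N / n : ℕ) : ZMod 3) ≠ 0 := by
            intro h0
            rw [h0, zero_mul] at hmn
            exact hN hmn.symm
          revert h0
          generalize ((N / n : ℕ) : ZMod 3) = u
          revert u
          decide
        linear_combination (-(r n : ZMod 3) * n) * hm2
          + (r n : ZMod 3) * ((N / n : ℕ) : ZMod 3) * hmn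
      rw [hXN]
      linear_combination (-(coSum N r : ZMod 3) * (x + z * N * y)) * had
  · have hX0 : (xN N r : ZMod 3) = 0 := by
      have : Fact (Nat.Prime 3) := ⟨Nat.prime_three⟩
      exact (mul_eq_zero.1 hX).resolve_left hl
    have hM0 : (coSum N r : ZMod 3) = 0 := by
      have : Fact (Nat.Prime 3) := ⟨Nat.prime_three⟩
      exact (mul_eq_zero.1 hM).resolve_left hl
    rw [hX0, hM0]
    ring

theorem six_mul_one_sub_eq_signExp {u : ℤ} (hu : IsUnit u) :
    ((6 * (1 - u) : ℤ) : ZMod 8) = signExp u := by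
  rcases Int.isUnit_iff.1 hu with rfl | rfl <;> rfl

theorem etaChar_one (N : ℕ) (r : ℕ → ℤ) (M : Matrix (Fin 2) (Fin 2) ℤ) :
    etaChar N r M 1 = e ((((1 / 24 : ℚ) * ∑ n ∈ N.divisors,
      (r n : ℚ) * Psi (M 0 0) (M 0 1 * n) (M 1 0 / n) (M 1 1) : ℚ)) : ℂ) := by
  unfold etaChar
  simp

/-- The product of the two character values in the definition of `T_l`. -/
theorem etaChar_inv_mul_inv {N a b d : ℕ} {x y z w i : ℤ} (hN : N ≠ 0) (ha : 0 < a) (hd : 0 < d)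
    (r : ℕ → ℤ) (hw : w = ∑ n ∈ N.divisors, r n + 4 * i)
    (hdet : (-(N : ℤ) * b + a * x) * y + N * d * z = 1) (haN : Nat.Coprime a N)
    (hl : a * d ∈ monoidL N r) :
    (etaChar N r !![-(N : ℤ) * b + a * x, z; -(N : ℤ) * d, y] 1)⁻¹ *
      (etaChar N r !![(a : ℤ) * y, (b : ℤ) * y - d * z; (N : ℤ), x] 1)⁻¹
      = (kronecker a (bigPi N r) : ℂ) * (kronecker (-(N : ℤ) * b) (Nat.gcd a d : ℕ) : ℂ) ^ w
        * (e (-((b : ℂ) * d * xN N r) / 24) * e ((psiExp N (a * d) r w a : ℂ) / 8)) := by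
  choose! E hE hE3 hI hII hIII using
    fun n (hn : n ∈ N.divisors) => exists_Psi_add (x := x) (y := y) (z := z) hn hd hdet
  obtain ⟨hX, hM⟩ := modulus_dvd hl
  have hsq : Odd w → IsSquare (a * d) := by
    intro hwo
    apply hl.2.2
    have : ∑ n ∈ N.divisors, r n = w - 4 * i := by rw [hw]; ring
    rw [this]
    exact hwo.sub_even ⟨2 * i, by ring⟩
  have haNc : IsCoprime (a : ℤ) N := Nat.isCoprime_iff_coprime.2 haN
  have hg : Nat.gcd a d ≠ 0 := (Nat.gcd_pos_of_pos_left d ha).ne'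
  have hσ := (signExp_kronecker_bigPi hN r haNc).1
  have hκ := isUnit_kronecker hg (isCoprime_gcd_of_det hdet)
  have hdvd : ∀ (p : ℕ) (u : ℤ), (p : ℤ) ∣ 24 → (24 : ℤ) ∣ (((a * d : ℕ) : ℤ) - 1) * u →
      ((a * d : ℤ) - 1 : ℤ) * (u : ZMod p) = 0 := by
    intro p u hp h
    rw [← Int.cast_mul, ZMod.intCast_zmod_eq_zero_iff_dvd]
    exact hp.trans (by push_cast at h; exact h)
  have h8 := sum_Psi_mod_eight hN ha r hw hdet haN hsq (hdvd 8 _ (by norm_num) hX)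
    (hdvd 8 _ (by norm_num) hM) hI hII hIII
  have h3 := sum_Psi_mod_three r hdet (hdvd 3 _ (by norm_num) hX) (hdvd 3 _ (by norm_num) hM) hE3
  set K : ℤ := ∑ n ∈ N.divisors, r n * E n with hK
  set σ := kronecker a (bigPi N r) with hσdef
  set κ := kronecker (-(N : ℤ) * b) (Nat.gcd a d : ℕ) with hκdef
  set v := psiExp N (a * d) r w a with hv
  -- In units of $1/24$ a sign $u$ is $6(1-u)$ and $e(v/8)$ is $3v$; the latter is subtracted
  -- because the characters are inverted. All these terms vanish modulo 3, so the same expression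
  -- serves both moduli.
  have hK8 : (8 : ℤ) ∣ K - (b * d * xN N r + 6 * (1 - σ) + 6 * w * (1 - κ) - 3 * v) := by
    refine (ZMod.intCast_zmod_eq_zero_iff_dvd _ 8).1 ?_
    have e1 := six_mul_one_sub_eq_signExp hσ
    have e2 := six_mul_one_sub_eq_signExp hκ
    rw [hK]
    push_cast at h8 e1 e2 ⊢
    linear_combination h8 - e1 - w * e2
  have hK3 : (3 : ℤ) ∣ K - (b * d * xN N r + 6 * (1 - σ) + 6 * w * (1 - κ) - 3 * v) := by
    have e3 : (3 : ZMod 3) = 0 := rfl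
    have : ((K - (b * d * xN N r + 6 * (1 - σ) + 6 * w * (1 - κ) - 3 * v) : ℤ) : ZMod 3) = 0 := by
      rw [hK]
      push_cast at h3 ⊢
      linear_combination h3 + ((v : ZMod 3) - 2 * (1 - σ) - 2 * w * (1 - κ)) * e3
    exact (ZMod.intCast_zmod_eq_zero_iff_dvd _ 3).1 this
  obtain ⟨j, hj⟩ : (24 : ℤ) ∣ K - (b * d * xN N r + 6 * (1 - σ) + 6 * w * (1 - κ) - 3 * v) := by
    have h38 : IsCoprime (3 : ℤ) 8 := ⟨3, -1, by norm_num⟩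
    simpa using h38.mul_dvd hK3 hK8
  have hKeq : K = b * d * xN N r + 6 * (1 - σ) + 6 * w * (1 - κ) - 3 * v + 24 * j := by
    linear_combination hj
  have hKc := congrArg (Int.cast : ℤ → ℂ) hKeq
  push_cast at hKc
  rw [etaChar_one, etaChar_one, ← mul_inv, ← e_add, ← e_neg, ← Rat.cast_add, ← mul_add,
    ← Finset.sum_add_distrib]
  have hsum : ∑ n ∈ N.divisors,
      ((r n : ℚ) * Psi (!![-(N : ℤ) * b + a * x, z; -(N : ℤ) * d, y] 0 0)
          (!![-(N : ℤ) * b + a * x, z; -(N : ℤ) * d, y] 0 1 * n)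
          (!![-(N : ℤ) * b + a * x, z; -(N : ℤ) * d, y] 1 0 / n)
          (!![-(N : ℤ) * b + a * x, z; -(N : ℤ) * d, y] 1 1)
        + (r n : ℚ) * Psi (!![(a : ℤ) * y, (b : ℤ) * y - d * z; (N : ℤ), x] 0 0)
          (!![(a : ℤ) * y, (b : ℤ) * y - d * z; (N : ℤ), x] 0 1 * n)
          (!![(a : ℤ) * y, (b : ℤ) * y - d * z; (N : ℤ), x] 1 0 / n)
          (!![(a : ℤ) * y, (b : ℤ) * y - d * z; (N : ℤ), x] 1 1)) = K := by
    rw [hK, Int.cast_sum]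
    refine Finset.sum_congr rfl fun n hn => ?_
    rw [Int.cast_mul, ← hE n hn, ← mul_add]
    rfl
  rw [hsum]
  have hσw := intUnit_zpow_eq_e hσ 1
  rw [zpow_one] at hσw
  rw [intUnit_zpow_eq_e hκ w, hσw, ← e_add, ← e_add, ← e_add]
  rw [← e_add_intCast _ j]
  congr 1
  push_cast
  linear_combination (-1 / 24 : ℂ) * hKc

/-! ### The root of unity `ψ` -/

/-- For even $l$ the level sums vanish modulo 8, and `zmod8_balance` relates $N(w+2\delta)$ to the
parity of the exponent of 2 in $\varPi$. A nonzero residue can occur only for $N\equiv4$ modulo 8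
with $w$ odd; then that exponent is odd, so $\delta_1=1$ supplies the missing factor 2. -/
theorem eight_dvd_of_two_dvd {N l : ℕ} {r : ℕ → ℤ} {w i : ℤ} (hNe : Even N)
    (hw : w = ∑ n ∈ N.divisors, r n + 4 * i) (hl : l ∈ monoidL N r) (h2 : 2 ∣ l) :
    (8 : ℤ) ∣ N * (w + 2 * delta N r) * (1 + delta₁ N l r w) := by
  obtain ⟨hX, hM⟩ := modulus_dvd hl
  have h8 : (8 : ZMod 8) = 0 := rfl
  have hlo : Odd ((l : ℤ) - 1) := by
    have : Even (l : ℤ) := by exact_mod_cast even_iff_two_dvd.2 h2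
    exact this.sub_odd odd_one
  have hz : ∀ u : ℤ, (24 : ℤ) ∣ ((l : ℤ) - 1) * u → (u : ZMod 8) = 0 := by
    intro u hu
    apply zmod8_eq_zero_of_odd_mul hlo
    rw [← Int.cast_mul]
    exact (ZMod.intCast_zmod_eq_zero_iff_dvd _ 8).2 ((by norm_num : (8 : ℤ) ∣ 24).trans hu)
  have hX0 := hz _ hX
  have hM0 := hz _ hM
  have hN4 := even_mul_four (n := N) (by exact_mod_cast hNe)
  have hbal : ∀ t : ℤ, (N : ZMod 8) * t * (w + 2 * delta N r)
      + padicValNat 2 (bigPi N r) * signExp (ZMod.χ₈ ((1 + N * t : ℤ) : ZMod 8)) = 0 := by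
    intro t
    have := zmod8_balance hNe r t
    rw [hX0, hM0, cast_weight hw] at this
    push_cast at this hN4 ⊢
    linear_combination this + t * i * hN4
  have hgoal : ((N * (w + 2 * delta N r) * (1 + delta₁ N l r w) : ℤ) : ZMod 8) = 0 := by
    push_cast
    have hN8 : N % 8 = 0 ∨ N % 8 = 2 ∨ N % 8 = 4 ∨ N % 8 = 6 := by
      have := Nat.even_iff.1 hNe
      omega
    have hcast : ∀ c : ℕ, N % 8 = c % 8 → (N : ZMod 8) = c := fun c h =>
      (ZMod.natCast_eq_natCast_iff N c 8).2 h
    rcases hN8 with h | h | h | h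
    · rw [hcast 0 (by omega)]
      simp
    · have hc := hcast 2 (by omega)
      -- The value $t=3$ makes $1+Nt\equiv7$, where $\chi_8$ is 1; for $N\equiv6$ the value $t=1$
      -- does the same.
      have h1 := hbal 3
      have h7 : signExp (ZMod.χ₈ ((1 + N * 3 : ℤ) : ZMod 8)) = 0 := by
        push_cast
        rw [hc]
        decide
      rw [h7, hc] at h1
      rw [hc]
      push_cast at h1 ⊢
      linear_combination 3 * (1 + delta₁ N l r w) * h1
        - 2 * (1 + (delta₁ N l r w : ZMod 8)) * (w + 2 * delta N r) * h8
    · have hc := hcast 4 (by omega)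
      have h1 := hbal 1
      have h5 : signExp (ZMod.χ₈ ((1 + N * 1 : ℤ) : ZMod 8)) = 4 := by
        push_cast
        rw [hc]
        decide
      rw [h5, hc] at h1
      rw [hc]
      rcases Int.even_or_odd w with ⟨u, hu⟩ | hwo
      · rw [hu]
        push_cast
        linear_combination (u + delta N r) * (1 + (delta₁ N l r (u + u) : ZMod 8)) * h8
      · have hJ : Odd (padicValNat 2 (bigPi N r)) := by
          rw [← Nat.not_even_iff_odd]
          rintro ⟨u, hu⟩
          rw [hu] at h1
          obtain ⟨s, hs⟩ := hwo
          rw [hs] at h1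
          push_cast at h1
          have : (4 : ZMod 8) = 0 := by
            linear_combination h1 - (s + delta N r + u) * h8
          revert this
          decide
        have h4N : 4 ∣ N := by omega
        rw [delta₁, if_pos ⟨h2, h4N, hwo, hJ⟩]
        push_cast
        linear_combination (w + 2 * (delta N r : ZMod 8)) * h8
    · have hc := hcast 6 (by omega)
      have h1 := hbal 1
      have h7 : signExp (ZMod.χ₈ ((1 + N * 1 : ℤ) : ZMod 8)) = 0 := by
        push_cast
        rw [hc]
        decide
      rw [h7, hc] at h1
      rw [hc]
      push_cast at h1 ⊢
      linear_combination (1 + delta₁ N l r w) * h1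
  exact (ZMod.intCast_zmod_eq_zero_iff_dvd _ 8).1 hgoal

theorem psi_eq {N l : ℕ} {r : ℕ → ℤ} {w i : ℤ} (hw : w = ∑ n ∈ N.divisors, r n + 4 * i)
    (hl : l ∈ monoidL N r) (a b : ℕ) : psi N l r w a b = e ((psiExp N l r w a : ℂ) / 8) := by
  unfold psi psiExp
  by_cases h2 : 2 ∣ l
  · rw [if_neg (not_not.2 h2), if_neg (not_not.2 h2)]
    by_cases h2N : 2 ∣ N
    · rw [if_pos h2N, if_pos h2N]
      obtain ⟨j, hj⟩ := eight_dvd_of_two_dvd (even_iff_two_dvd.2 h2N) hw hl h2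
      have hjc := congrArg (Int.cast : ℤ → ℂ) hj
      push_cast at hjc
      rw [← e_add_intCast _ (j * b)]
      congr 1
      push_cast
      linear_combination (-(b : ℂ) / 8) * hjc
    · rw [if_neg h2N, if_neg h2N]
      simp [e_zero]
  · rw [if_pos h2, if_pos h2]
    generalize l / a = c
    congr 1
    push_cast
    ring

/-! ### Uniqueness of expansions -/

theorem hasSum_of_eq {ι : Type*} {f g : ι → ℂ} {v : ℂ} (h : ∀ i, f i = g i) (hg : HasSum g v) :
    HasSum f v := by
  rwa [funext h]

theorem norm_e (u : ℂ) : ‖e u‖ = Real.exp (-2 * Real.pi * u.im) := by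
  unfold e
  rw [Complex.norm_exp]
  congr 1
  simp [Complex.mul_re, Complex.mul_im]

theorem continuous_e : Continuous e := by
  unfold e
  fun_prop

theorem integral_e_mul {m : ℝ} (hm : 0 < m) (y : ℝ) (j : ℤ) :
    ∫ t in (0 : ℝ)..m, e ((j : ℂ) * ((t : ℂ) + y * Complex.I) / m)
      = if j = 0 then (m : ℂ) else 0 := by
  split_ifs with hj
  · subst hj
    simp [e_zero]
  · have hm' : (m : ℂ) ≠ 0 := by exact_mod_cast hm.ne'
    have hj' : (j : ℂ) ≠ 0 := by exact_mod_cast hj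
    have hc : 2 * Real.pi * Complex.I * j / m ≠ 0 :=
      div_ne_zero (mul_ne_zero Complex.two_pi_I_ne_zero hj') hm'
    have h1 : ∀ t : ℝ, e ((j : ℂ) * ((t : ℂ) + y * Complex.I) / m)
        = e ((j : ℂ) * (y * Complex.I) / m)
          * Complex.exp (2 * Real.pi * Complex.I * j / m * t) := by
      intro t
      unfold e
      rw [← Complex.exp_add]
      congr 1
      ring
    simp only [h1]
    rw [intervalIntegral.integral_const_mul, integral_exp_mul_complex hc]
    have h2 : Complex.exp (2 * Real.pi * Complex.I * j / m * m) = 1 := by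
      rw [div_mul_cancel₀ _ hm', mul_comm]
      exact Complex.exp_int_mul_two_pi_mul_I j
    rw [h2]
    simp

/-- Multiply by $e(-k\tau/m)$ and integrate over a horizontal segment of length $m$: only the $k$-th
term survives. -/
theorem coeff_eq_zero_of_hasSum_zero {m : ℕ} (hm : 1 ≤ m) {Y : ℝ} {c : ℤ → ℂ}
    (h : ∀ τ : ℍ, Y < τ.im → HasSum (fun n : ℤ => c n * e ((n : ℂ) * (τ : ℂ) / m)) 0) (k : ℤ) :
    c k = 0 := by
  obtain ⟨y, hy0, hyY⟩ : ∃ y : ℝ, 0 < y ∧ Y < y :=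
    ⟨max Y 0 + 1, by positivity, by linarith [le_max_left Y 0]⟩
  have hm' : (0 : ℝ) < m := by exact_mod_cast hm
  have hpt : ∀ t : ℝ, HasSum (fun n : ℤ => c n * e (((n - k : ℤ) : ℂ)
      * ((t : ℂ) + y * Complex.I) / (m : ℝ))) 0 := by
    intro t
    have him : ((t : ℂ) + y * Complex.I).im = y := by simp
    have h1 := (h ⟨(t : ℂ) + y * Complex.I, by rw [him]; exact hy0⟩
      (by change Y < ((t : ℂ) + y * Complex.I).im; rw [him]; exact hyY)).mul_right
        (e (-(k : ℂ) * ((t : ℂ) + y * Complex.I) / m))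
    rw [zero_mul] at h1
    refine hasSum_of_eq (fun n => ?_) h1
    rw [mul_assoc, ← e_add]
    congr 2
    push_cast
    ring
  -- The norm of each term depends only on the height, so the terms at $t=0$ give a summable bound
  -- for dominated convergence.
  have hnorm : ∀ (n : ℤ) (t : ℝ), ‖c n * e (((n - k : ℤ) : ℂ)
      * ((t : ℂ) + y * Complex.I) / (m : ℝ))‖ = ‖c n * e (((n - k : ℤ) : ℂ)
      * (((0 : ℝ) : ℂ) + y * Complex.I) / (m : ℝ))‖ := by
    intro n t
    rw [norm_mul, norm_mul, norm_e, norm_e]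
    congr 3
    rw [Complex.div_ofReal_im, Complex.div_ofReal_im]
    simp [Complex.mul_im]
  have hint := intervalIntegral.hasSum_integral_of_dominated_convergence
    (μ := MeasureTheory.volume) (a := 0) (b := (m : ℝ))
    (F := fun (n : ℤ) (t : ℝ) => c n * e (((n - k : ℤ) : ℂ)
      * ((t : ℂ) + y * Complex.I) / (m : ℝ))) (f := fun _ => 0)
    (fun n _ => ‖c n * e (((n - k : ℤ) : ℂ) * (((0 : ℝ) : ℂ) + y * Complex.I) / (m : ℝ))‖)
    (fun n => by
      refine Continuous.aestronglyMeasurable ?_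
      refine continuous_const.mul (continuous_e.comp ?_)
      fun_prop)
    (fun n => Filter.Eventually.of_forall fun t _ => (hnorm n t).le)
    (Filter.Eventually.of_forall fun t _ => (hpt 0).summable.norm)
    (by simp)
    (Filter.Eventually.of_forall fun t _ => hpt t)
  simp only [intervalIntegral.integral_const_mul, integral_e_mul hm', sub_eq_zero] at hint
  rw [intervalIntegral.integral_zero] at hint
  have h2 : HasSum (fun n : ℤ => c n * if n = k then (((m : ℝ)) : ℂ) else 0)
      (c k * ((m : ℝ) : ℂ)) := by
    convert hasSum_ite_eq k (c k * ((m : ℝ) : ℂ)) using 1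
    funext n
    split_ifs with hn
    · rw [hn]
    · rw [mul_zero]
  have h3 := hint.unique h2
  have h4 : ((m : ℝ) : ℂ) ≠ 0 := by exact_mod_cast hm'.ne'
  exact (mul_eq_zero.1 h3.symm).resolve_right h4

theorem IsQExpansion.unique {s : ℚ} {Y Y' : ℝ} {g : ℍ → ℂ} {c c' : ℚ → ℂ}
    (h : IsQExpansion s Y g c) (h' : IsQExpansion s Y' g c') : c = c' := by
  funext n
  by_cases hn : ∃ j : ℤ, n = s + j
  · obtain ⟨k, rfl⟩ := hn
    have key := coeff_eq_zero_of_hasSum_zero (m := 1) le_rfl (Y := max Y Y')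
      (c := fun j : ℤ => c (s + j) - c' (s + j)) (fun τ hτ => by
        have h1 := (h.2 τ (lt_of_le_of_lt (le_max_left _ _) hτ)).sub
          (h'.2 τ (lt_of_le_of_lt (le_max_right _ _) hτ))
        have h2 := h1.mul_right (e (-(s : ℂ) * τ))
        rw [sub_self, zero_mul] at h2
        refine hasSum_of_eq (fun j => ?_) h2
        rw [← sub_mul, mul_assoc, ← e_add]
        congr 2
        push_cast
        ring) k
    exact sub_eq_zero.1 key
  · rw [h.1 n hn, h'.1 n hn]

/-! ### Expansions indexed by the rational numbers -/

/-- Substituting $(a\tau+b)/d$ scales exponents by $a/d$, which need not preserve $s+\mathbb Z$ but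
is a bijection of $\mathbb Q$. Indexing by $\mathbb Q$ lets the expansions for different $a$ be
added termwise. -/
theorem hasSum_rat_iff {s : ℚ} {c : ℚ → ℂ} (hc : ∀ n : ℚ, (¬ ∃ j : ℤ, n = s + j) → c n = 0)
    (τ v : ℂ) : HasSum (fun j : ℤ => c (s + j) * e (((s + j : ℚ) : ℂ) * τ)) v
      ↔ HasSum (fun q : ℚ => c q * e ((q : ℂ) * τ)) v := by
  have hinj : Function.Injective fun j : ℤ => s + (j : ℚ) := fun i j hij => by
    simpa using hij
  refine hinj.hasSum_iff (f := fun q : ℚ => c q * e ((q : ℂ) * τ)) fun q hq => ?_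
  rw [hc q, zero_mul]
  rintro ⟨j, rfl⟩
  exact hq ⟨j, rfl⟩

theorem e_eq_one_iff (u : ℂ) : e u = 1 ↔ ∃ n : ℤ, u = n := by
  unfold e
  rw [Complex.exp_eq_one_iff]
  have h := Complex.two_pi_I_ne_zero
  refine exists_congr fun n => ?_
  rw [mul_comm (n : ℂ)]
  exact mul_right_inj' h

theorem slash_one_one (w : ℤ) (f : ℍ → ℂ) : slash w 1 1 f = f := by
  funext τ
  simp [slash]

/-! ### The expansion of the form at infinity -/

theorem etaChar_T (N : ℕ) (r : ℕ → ℤ) :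
    etaChar N r ModularGroup.T.1 1 = e ((xN N r : ℂ) / 24) := by
  rw [etaChar_one]
  congr 1
  have h : ∑ n ∈ N.divisors, (r n : ℚ) * Psi (ModularGroup.T.1 0 0) (ModularGroup.T.1 0 1 * n)
      (ModularGroup.T.1 1 0 / n) (ModularGroup.T.1 1 1) = (xN N r : ℚ) := by
    rw [cast_xN]
    refine Finset.sum_congr rfl fun n _ => ?_
    simp [ModularGroup.T, Psi]
  rw [h]
  push_cast
  ring

theorem IsMeromorphicModularForm.translate {N : ℕ} {r : ℕ → ℤ} {w : ℤ} {f : ℍ → ℂ}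
    (hf : IsMeromorphicModularForm N w (etaChar N r) f) (τ : ℍ) :
    f ((1 : ℝ) +ᵥ τ) = e ((xN N r : ℂ) / 24) * f τ := by
  have hT : ModularGroup.T ∈ CongruenceSubgroup.Gamma0 N := by
    rw [CongruenceSubgroup.Gamma0_mem]
    simp [ModularGroup.T]
  have h := hf.slash_eq ModularGroup.T hT 1 τ
  rw [etaChar_T] at h
  rw [← h, slash, UpperHalfPlane.modular_T_smul]
  simp [ModularGroup.T]

/-- The cusp condition gives powers of $q^{1/m}$ only. Invariance under $\tau\mapsto\tau+1$ up to
$e(x_N/24)$, with uniqueness of coefficients, kills every exponent outside $x_N/24+\mathbb Z$. -/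
theorem exists_isQExpansion {N : ℕ} {r : ℕ → ℤ} {w : ℤ} {f : ℍ → ℂ}
    (hf : IsMeromorphicModularForm N w (etaChar N r) f) :
    ∃ (Y : ℝ) (c : ℚ → ℂ), 0 < Y ∧ IsQExpansion ((xN N r : ℚ) / 24) Y f c := by
  obtain ⟨m, Y, n₀, c, hm, hY, -, hc⟩ := hf.cusps 1 1
  rw [slash_one_one] at hc
  have hm0 : (m : ℚ) ≠ 0 := by
    have : 0 < m := hm
    positivity
  have hcoef : ∀ n : ℤ, c n * e ((n : ℂ) / m) - c n * e ((xN N r : ℂ) / 24) = 0 := by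
    refine coeff_eq_zero_of_hasSum_zero hm (Y := Y) fun τ hτ => ?_
    have h1 := hc ((1 : ℝ) +ᵥ τ) (by rwa [UpperHalfPlane.vadd_im])
    have h2 := (hc τ hτ).mul_left (e ((xN N r : ℂ) / 24))
    rw [hf.translate] at h1
    have h3 := h1.sub h2
    rw [sub_self] at h3
    refine hasSum_of_eq (fun n => ?_) h3
    rw [UpperHalfPlane.coe_vadd]
    have h4 : e ((n : ℂ) * (((1 : ℝ) : ℂ) + τ) / m)
        = e ((n : ℂ) / m) * e ((n : ℂ) * τ / m) := by
      rw [← e_add]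
      congr 1
      push_cast
      ring
    rw [h4]
    ring
  have hinj : Function.Injective fun n : ℤ => (n : ℚ) / m := fun i j hij => by
    have : (i : ℚ) / m = (j : ℚ) / m := hij
    rw [div_left_inj' hm0] at this
    exact_mod_cast this
  classical
  let C : ℚ → ℂ := Function.extend (fun n : ℤ => (n : ℚ) / m) c 0
  have hC : ∀ n : ℤ, C ((n : ℚ) / m) = c n := fun n => hinj.extend_apply c 0 n
  have hC0 : ∀ q : ℚ, (¬ ∃ j : ℤ, q = (xN N r : ℚ) / 24 + j) → C q = 0 := by
    intro q hq
    by_cases hqm : ∃ n : ℤ, (n : ℚ) / m = q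
    · obtain ⟨n, rfl⟩ := hqm
      rw [hC]
      by_contra hne
      have h1 : e ((n : ℂ) / m) = e ((xN N r : ℂ) / 24) :=
        mul_left_cancel₀ hne (sub_eq_zero.1 (hcoef n))
      have h2 : e ((n : ℂ) / m - (xN N r : ℂ) / 24) = 1 := by
        rw [sub_eq_add_neg, e_add, e_neg, h1, mul_inv_cancel₀ (e_ne_zero _)]
      obtain ⟨j, hj⟩ := (e_eq_one_iff _).1 h2
      refine hq ⟨j, ?_⟩
      have h3 : (((n : ℚ) / m : ℚ) : ℂ) = (((xN N r : ℚ) / 24 + j : ℚ) : ℂ) := by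
        push_cast
        linear_combination hj
      exact_mod_cast h3
    · exact Function.extend_apply' _ _ _ hqm
  refine ⟨Y, C, hY, hC0, fun τ hτ => ?_⟩
  rw [hasSum_rat_iff hC0, ← hinj.hasSum_iff (f := fun q : ℚ => C q * e ((q : ℂ) * τ))]
  · convert hc τ hτ using 1
    funext n
    simp only [Function.comp, hC]
    congr 2
    push_cast
    ring
  · intro q hq
    have : C q = 0 := Function.extend_apply' _ _ _ hq
    rw [this, zero_mul]

/-! ### The coefficients of `T_l f` -/

theorem sum_range_shift {d : ℕ} {H : ℕ → ℂ} (hper : ∀ b, H (b + d) = H b) (a : ℕ) :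
    ∑ b ∈ Finset.range d, H (b + a) = ∑ b ∈ Finset.range d, H b := by
  induction a with
  | zero => rfl
  | succ a ih =>
    rw [← ih]
    have h1 := Finset.sum_range_succ (fun b => H (b + a)) d
    have h2 := Finset.sum_range_succ' (fun b => H (b + a)) d
    have h3 : H (d + a) = H (0 + a) := by rw [zero_add, add_comm, hper]
    have h4 : ∀ b, H (b + 1 + a) = H (b + (a + 1)) := fun b => by rw [add_assoc, add_comm 1 a]
    simp only [h4] at h2
    rw [h1, h3] at h2
    exact (add_right_cancel h2).symm

theorem zmod8_sq_sub_one : ∀ a d u : ZMod 8, (a * d - 1) * u = 0 → (d ^ 2 - 1) * u = 0 := by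
  decide

theorem zmod3_sq_sub_one : ∀ a d u : ZMod 3, (a * d - 1) * u = 0 → (d ^ 2 - 1) * u = 0 := by
  decide

/-- A special property of 24: units modulo 24 square to 1. It turns the condition on $l=ad$ into
periodicity modulo $d$ of the phases in $b$. -/
theorem dvd_sq_sub_one_mul {a d u : ℤ} (h : (24 : ℤ) ∣ (a * d - 1) * u) :
    (24 : ℤ) ∣ (d ^ 2 - 1) * u := by
  have h8 : (8 : ℤ) ∣ (d ^ 2 - 1) * u := by
    refine (ZMod.intCast_zmod_eq_zero_iff_dvd _ 8).1 ?_
    have := (ZMod.intCast_zmod_eq_zero_iff_dvd _ 8).2 ((by norm_num : ((8 : ℕ) : ℤ) ∣ 24).trans h)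
    push_cast at this ⊢
    exact zmod8_sq_sub_one _ _ _ this
  have h3 : (3 : ℤ) ∣ (d ^ 2 - 1) * u := by
    refine (ZMod.intCast_zmod_eq_zero_iff_dvd _ 3).1 ?_
    have := (ZMod.intCast_zmod_eq_zero_iff_dvd _ 3).2 ((by norm_num : ((3 : ℕ) : ℤ) ∣ 24).trans h)
    push_cast at this ⊢
    exact zmod3_sq_sub_one _ _ _ this
  have h38 : IsCoprime (3 : ℤ) 8 := ⟨3, -1, by norm_num⟩
  simpa using h38.mul_dvd h3 h8

/-- If $(a,d)$ were even, then $N$ would be odd, being coprime to $a$, and $l$ would be even; the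
level sums then vanish modulo 8 and force even $w$. -/
theorem odd_gcd_of_odd_weight {N a d : ℕ} {r : ℕ → ℤ} {w i : ℤ}
    (hw : w = ∑ n ∈ N.divisors, r n + 4 * i) (haN : Nat.Coprime a N)
    (hl : a * d ∈ monoidL N r) (hwo : Odd w) : Odd (Nat.gcd a d) := by
  rw [← Nat.not_even_iff_odd]
  intro hge
  have hae : Even a := even_iff_two_dvd.2 ((even_iff_two_dvd.1 hge).trans (Nat.gcd_dvd_left a d))
  have hNo : Odd N := by
    rw [← Nat.not_even_iff_odd]
    intro hNe
    have := Nat.dvd_gcd (even_iff_two_dvd.1 hae) (even_iff_two_dvd.1 hNe)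
    rw [haN] at this
    omega
  have hlo : Odd (((a * d : ℕ) : ℤ) - 1) := by
    have : Even ((a * d : ℕ) : ℤ) := by exact_mod_cast hae.mul_right d
    exact this.sub_odd odd_one
  have hM : (coSum N r : ZMod 8) = 0 := by
    apply zmod8_eq_zero_of_odd_mul hlo
    rw [← Int.cast_mul]
    exact (ZMod.intCast_zmod_eq_zero_iff_dvd _ 8).2
      ((by norm_num : (8 : ℤ) ∣ 24).trans (modulus_dvd hl).2)
  have h1 : Even w := by
    rw [hw]
    exact (even_sum_of_odd hNo r hM).add ⟨2 * i, by ring⟩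
  exact Int.not_even_iff_odd.2 hwo h1

theorem isCoprime_neg_mul_gcd {N a b d : ℕ} (haN : Nat.Coprime a N)
    (h : Nat.gcd (Nat.gcd a b) d = 1) : IsCoprime (-(N : ℤ) * b) ((Nat.gcd a d : ℕ) : ℤ) := by
  have h1 : IsCoprime ((N * b : ℕ) : ℤ) ((Nat.gcd a d : ℕ) : ℤ) := by
    rw [Nat.isCoprime_iff_coprime]
    refine Nat.Coprime.mul_left (haN.symm.coprime_dvd_right (Nat.gcd_dvd_left a d)) ?_
    rw [Nat.coprime_iff_gcd_eq_one, ← h, ← Nat.gcd_assoc, Nat.gcd_comm b a]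
  push_cast at h1
  rw [neg_mul]
  exact h1.neg_left

/-- For even $w$ the power is 1. For odd $w$ the gcd is odd, so the Kronecker symbol is a Jacobi
symbol and depends only on $b$ modulo $(a,d)$. -/
theorem kronecker_zpow_add {N a b c d : ℕ} {w : ℤ} (ha : 0 < a) (haN : Nat.Coprime a N)
    (hg : Odd w → Odd (Nat.gcd a d)) (hc : Nat.gcd a d ∣ c)
    (hb : Nat.gcd (Nat.gcd a b) d = 1) (hbc : Nat.gcd (Nat.gcd a (b + c)) d = 1) :
    (kronecker (-(N : ℤ) * (b + c : ℕ)) (Nat.gcd a d : ℕ) : ℂ) ^ w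
      = (kronecker (-(N : ℤ) * b) (Nat.gcd a d : ℕ) : ℂ) ^ w := by
  have hg0 : Nat.gcd a d ≠ 0 := (Nat.gcd_pos_of_pos_left d ha).ne'
  rcases Int.even_or_odd w with hwe | hwo
  · have h1 : ∀ u : ℤ, IsUnit u → (u : ℂ) ^ w = 1 := by
      intro u hu
      rcases Int.isUnit_iff.1 hu with rfl | rfl
      · simp
      · push_cast
        exact hwe.neg_one_zpow
    rw [h1 _ (isUnit_kronecker hg0 (isCoprime_neg_mul_gcd haN hbc)),
      h1 _ (isUnit_kronecker hg0 (isCoprime_neg_mul_gcd haN hb))]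
  · rw [kronecker_eq_of_modEq (hg hwo)]
    obtain ⟨k, hk⟩ := hc
    refine Int.modEq_iff_dvd.2 ⟨N * k, ?_⟩
    have : (c : ℤ) = (Nat.gcd a d : ℕ) * k := by exact_mod_cast hk
    push_cast at this ⊢
    rw [this]
    ring

/-- The sum over `b` vanishes if `n` is not one of the exponents of `T_l f`. -/
theorem sum_indexB_eq_zero {N a d : ℕ} {r : ℕ → ℤ} {w i : ℤ} (ha : 0 < a) (hd : 0 < d)
    (hw : w = ∑ n ∈ N.divisors, r n + 4 * i) (haN : Nat.Coprime a N)
    (hl : a * d ∈ monoidL N r) {n : ℚ} {j : ℤ}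
    (hj : ((a * d : ℕ) : ℚ) * n / (a : ℚ) ^ 2 = (xN N r : ℚ) / 24 + j)
    (hn : ¬ ∃ j : ℤ, n = (xN N r : ℚ) / 24 + j) :
    ∑ b ∈ indexB (a * d) a, (kronecker (-(N : ℤ) * b) (Nat.gcd a d : ℕ) : ℂ) ^ w *
      e ((b : ℂ) * d * ((n : ℂ) / (a * d : ℕ) - (xN N r : ℂ) / 24)) = 0 := by
  have hac : (a : ℂ) ≠ 0 := by exact_mod_cast ha.ne'
  have hdc : (d : ℂ) ≠ 0 := by exact_mod_cast hd.ne'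
  have hjc : ((a * d : ℕ) : ℂ) * n / (a : ℂ) ^ 2 = (xN N r : ℂ) / 24 + j := by
    exact_mod_cast congrArg (Rat.cast : ℚ → ℂ) hj
  push_cast at hjc
  have hjc' : (d : ℂ) * n = a * ((xN N r : ℂ) / 24 + j) := by
    rw [← hjc]
    field_simp
  have hX := (modulus_dvd hl).1
  have hX2 : (24 : ℤ) ∣ ((d : ℤ) ^ 2 - 1) * xN N r :=
    dvd_sq_sub_one_mul (a := a) (by push_cast at hX; exact hX)
  obtain ⟨u, hu⟩ := hX
  obtain ⟨v, hv⟩ := hX2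
  have huc := congrArg (Int.cast : ℤ → ℂ) hu
  have hvc := congrArg (Int.cast : ℤ → ℂ) hv
  push_cast at huc hvc
  have hg := odd_gcd_of_odd_weight hw haN hl
  have hdiv : a * d / a = d := Nat.mul_div_cancel_left d ha
  set F : ℕ → ℂ := fun b => (kronecker (-(N : ℤ) * b) (Nat.gcd a d : ℕ) : ℂ) ^ w *
      e ((b : ℂ) * d * ((n : ℂ) / (a * d : ℕ) - (xN N r : ℂ) / 24)) with hF
  set H : ℕ → ℂ := fun b => if Nat.gcd (Nat.gcd a b) d = 1 then F b else 0 with hH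
  have hsum : ∑ b ∈ indexB (a * d) a, F b = ∑ b ∈ Finset.range d, H b := by
    rw [indexB, hdiv, Finset.sum_filter]
  have hgd : ∀ b, Nat.gcd (Nat.gcd a (b + d)) d = Nat.gcd (Nat.gcd a b) d := by
    intro b
    rw [Nat.gcd_assoc, Nat.gcd_assoc, Nat.gcd_add_self_left]
  have hga : ∀ b, Nat.gcd (Nat.gcd a (b + a)) d = Nat.gcd (Nat.gcd a b) d := by
    intro b
    rw [Nat.gcd_add_self_right]
  -- The phase changes by $dn/a-d^2x_N/24$. The first term is $x_N/24+j$, and $24\mid(d^2-1)x_N$, so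
  -- the change is an integer.
  have hper : ∀ b, H (b + d) = H b := by
    intro b
    simp only [hH, hgd]
    split_ifs with hb
    · simp only [hF]
      rw [kronecker_zpow_add ha haN hg (Nat.gcd_dvd_right a d) hb (by rw [hgd]; exact hb)]
      congr 1
      rw [← e_add_intCast ((b : ℂ) * d * ((n : ℂ) / (a * d : ℕ) - (xN N r : ℂ) / 24)) (j - v)]
      congr 1
      push_cast
      field_simp
      linear_combination 24 * hjc' - (a : ℂ) * hvc
    · rfl
  -- The phase changes by $n-lx_N/24$, which is $n-x_N/24$ up to an integer.
  have hshift : ∀ b, H (b + a) = e ((n : ℂ) - (xN N r : ℂ) / 24) * H b := by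
    intro b
    simp only [hH, hga]
    split_ifs with hb
    · simp only [hF]
      rw [kronecker_zpow_add ha haN hg (Nat.gcd_dvd_left a d) hb (by rw [hga]; exact hb),
        mul_left_comm, ← e_add]
      congr 1
      rw [← e_add_intCast ((n : ℂ) - (xN N r : ℂ) / 24
        + (b : ℂ) * d * ((n : ℂ) / (a * d : ℕ) - (xN N r : ℂ) / 24)) (-u)]
      congr 1
      push_cast
      field_simp
      linear_combination (-(a : ℂ)) * huc
    · rw [mul_zero]
  have h1 := sum_range_shift hper a
  simp only [hshift, ← Finset.mul_sum] at h1
  have h2 : (e ((n : ℂ) - (xN N r : ℂ) / 24) - 1) * ∑ b ∈ Finset.range d, H b = 0 := by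
    linear_combination h1
  rw [hsum]
  refine (mul_eq_zero.1 h2).resolve_left fun h3 => hn ?_
  obtain ⟨k, hk⟩ := (e_eq_one_iff _).1 (sub_eq_zero.1 h3)
  refine ⟨k, ?_⟩
  have h4 : (n : ℂ) = (((xN N r : ℚ) / 24 + k : ℚ) : ℂ) := by
    push_cast
    linear_combination hk
  exact_mod_cast h4

theorem hasSum_component {s : ℚ} {Y : ℝ} {f : ℍ → ℂ} {c : ℚ → ℂ} (hY : 0 < Y)
    (hc : IsQExpansion s Y f c) {a d : ℕ} (b : ℕ) (ha : 0 < a) (hd : 0 < d) {τ : ℍ}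
    (hτ : ((a * d : ℕ) : ℝ) * Y < τ.im) :
    HasSum (fun n : ℚ => c (((a * d : ℕ) : ℚ) * n / (a : ℚ) ^ 2)
      * e ((b : ℂ) * d * ((n : ℂ) / (a * d : ℕ))) * e ((n : ℂ) * τ))
      (f (ofComplex (((a : ℂ) * (τ : ℂ) + b) / (d : ℂ)))) := by
  have ha1 : (1 : ℝ) ≤ a := by exact_mod_cast ha
  have hd1 : (1 : ℝ) ≤ d := by exact_mod_cast hd
  have him : (((a : ℂ) * (τ : ℂ) + b) / (d : ℂ)).im = a * τ.im / d := by
    have : ((d : ℝ) : ℂ) = (d : ℂ) := by push_cast; rfl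
    rw [← this, Complex.div_ofReal_im]
    simp [Complex.mul_im]
  have hYσ : Y < (((a : ℂ) * (τ : ℂ) + b) / (d : ℂ)).im := by
    rw [him, lt_div_iff₀ (by linarith)]
    push_cast at hτ
    have h1 : Y * d ≤ a * d * Y := by nlinarith [mul_pos hY (lt_of_lt_of_le one_pos hd1)]
    have h2 : τ.im ≤ a * τ.im := by nlinarith [τ.im_pos]
    linarith
  have hpos : 0 < (((a : ℂ) * (τ : ℂ) + b) / (d : ℂ)).im := hY.trans hYσ
  have hac : (a : ℂ) ≠ 0 := by exact_mod_cast ha.ne'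
  have hdc : (d : ℂ) ≠ 0 := by exact_mod_cast hd.ne'
  rw [UpperHalfPlane.ofComplex_apply_of_im_pos hpos]
  have h1 := (hasSum_rat_iff hc.1 _ _).1 (hc.2 ⟨_, hpos⟩ hYσ)
  -- The old exponent is $ln/a^2$ in terms of the new exponent $n$, so the sum is reindexed by this
  -- multiplication.
  have hk : ((a * d : ℕ) : ℚ) / (a : ℚ) ^ 2 ≠ 0 := by positivity
  rw [← (Equiv.mulRight₀ _ hk).hasSum_iff] at h1
  refine hasSum_of_eq (fun n => ?_) h1
  have he : Equiv.mulRight₀ _ hk n = n * (((a * d : ℕ) : ℚ) / (a : ℚ) ^ 2) := rfl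
  simp only [Function.comp, he]
  rw [mul_assoc, ← e_add]
  congr 1
  · congr 1
    ring
  · congr 1
    push_cast
    field_simp
    ring

theorem mem_indexA {N l a : ℕ} (ha : a ∈ indexA N l) :
    0 < a ∧ 0 < l / a ∧ a * (l / a) = l ∧ Nat.Coprime a N := by
  rw [indexA, Finset.mem_filter, Nat.mem_divisors] at ha
  obtain ⟨⟨hal, hl⟩, haN⟩ := ha
  have ha0 : 0 < a := Nat.pos_of_dvd_of_pos hal (Nat.pos_of_ne_zero hl)
  exact ⟨ha0, Nat.div_pos (Nat.le_of_dvd (Nat.pos_of_ne_zero hl) hal) ha0,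
    Nat.mul_div_cancel' hal, haN⟩

/-- The factor of `c_f (l n / a²)` in the coefficient `c_{T_l f}(n)`. -/
noncomputable def innerSum (N l : ℕ) (r : ℕ → ℤ) (w : ℤ) (a : ℕ) (n : ℚ) : ℂ :=
  ∑ b ∈ indexB l a,
    (kronecker (-(N : ℤ) * b) (Nat.gcd a (l / a)) : ℂ) ^ w *
      e ((b : ℂ) * ((l / a : ℕ) : ℂ) * ((n : ℂ) / l - (xN N r : ℂ) / 24)) * psi N l r w a b

/-- The coefficient `c_{T_l f}(n)`. -/
noncomputable def heckeCoeff (N l : ℕ) (r : ℕ → ℤ) (w : ℤ) (c : ℚ → ℂ) (n : ℚ) : ℂ :=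
  (l : ℂ) ^ (-((w : ℂ) / 2) / 2) * ∑ a ∈ indexA N l,
    (kronecker a (bigPi N r) : ℂ) * (a : ℂ) ^ ((w : ℂ) / 2) *
      c ((l : ℚ) * n / (a : ℚ) ^ 2) * innerSum N l r w a n

/-- Even when $ln/a^2$ is an exponent of $f$, the sum over $b$ cancels. The factor $\psi$ can be
taken out of it because it does not depend on $b$. -/
theorem heckeCoeff_eq_zero {N l : ℕ} {r : ℕ → ℤ} {w i : ℤ} {c : ℚ → ℂ}
    (hw : w = ∑ n ∈ N.divisors, r n + 4 * i) (hl : l ∈ monoidL N r)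
    (hc : ∀ n : ℚ, (¬ ∃ j : ℤ, n = (xN N r : ℚ) / 24 + j) → c n = 0) {n : ℚ}
    (hn : ¬ ∃ j : ℤ, n = (xN N r : ℚ) / 24 + j) : heckeCoeff N l r w c n = 0 := by
  unfold heckeCoeff
  rw [Finset.sum_eq_zero, mul_zero]
  intro a ha
  obtain ⟨ha0, hd0, had, haN⟩ := mem_indexA ha
  by_cases hj : ∃ j : ℤ, (l : ℚ) * n / (a : ℚ) ^ 2 = (xN N r : ℚ) / 24 + j
  · obtain ⟨j, hj⟩ := hj
    have h0 : innerSum N l r w a n = 0 := by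
      unfold innerSum
      simp only [psi_eq hw hl]
      rw [← Finset.sum_mul]
      have h1 := sum_indexB_eq_zero ha0 hd0 hw haN (by rw [had]; exact hl) (n := n) (j := j)
        (by rw [had]; exact hj) hn
      rw [had] at h1
      rw [h1, zero_mul]
    rw [h0, mul_zero]
  · rw [hc _ hj, mul_zero, zero_mul]

theorem isQExpansion_heckeT {N l : ℕ} (hN : 0 < N) {r : ℕ → ℤ} {w i : ℤ}
    (hw : w = ∑ n ∈ N.divisors, r n + 4 * i) (hl : l ∈ monoidL N r) {x y z : ℕ → ℕ → ℤ}
    (hxyz : IsChoice N l x y z) {f : ℍ → ℂ} {Y : ℝ} {c : ℚ → ℂ} (hY : 0 < Y)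
    (hc : IsQExpansion ((xN N r : ℚ) / 24) Y f c) :
    IsQExpansion ((xN N r : ℚ) / 24) (l * Y) (heckeT N l w (etaChar N r) x y z f)
      (heckeCoeff N l r w c) := by
  refine ⟨fun n hn => heckeCoeff_eq_zero hw hl hc.1 hn, fun τ hτ => ?_⟩
  rw [hasSum_rat_iff fun n hn => heckeCoeff_eq_zero hw hl hc.1 hn]
  have hsum : HasSum (fun n : ℚ => (l : ℂ) ^ (-((w : ℂ) / 2) / 2) * ∑ a ∈ indexA N l,
      (a : ℂ) ^ ((w : ℂ) / 2) * ∑ b ∈ indexB l a,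
      (etaChar N r !![-(N : ℤ) * b + a * x a b, z a b; -(N : ℤ) * ((l / a : ℕ) : ℤ), y a b] 1)⁻¹ *
      (etaChar N r !![(a : ℤ) * y a b, (b : ℤ) * y a b - ((l / a : ℕ) : ℤ) * z a b;
        (N : ℤ), x a b] 1)⁻¹ *
      (c ((l : ℚ) * n / (a : ℚ) ^ 2) * e ((b : ℂ) * ((l / a : ℕ) : ℂ) * ((n : ℂ) / l))
        * e ((n : ℂ) * τ))) (heckeT N l w (etaChar N r) x y z f τ) := by
    unfold heckeT
    refine HasSum.mul_left _ (hasSum_sum fun a ha => HasSum.mul_left _ (hasSum_sum fun b _ =>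
      HasSum.mul_left _ ?_))
    obtain ⟨ha0, hd0, had, -⟩ := mem_indexA ha
    have h1 := hasSum_component hY hc b ha0 hd0 (τ := τ) (by rw [had]; exact hτ)
    rw [had] at h1
    exact h1
  refine hasSum_of_eq (fun n => ?_) hsum
  unfold heckeCoeff innerSum
  rw [mul_assoc, Finset.sum_mul]
  congr 1
  refine Finset.sum_congr rfl fun a ha => ?_
  rw [Finset.mul_sum, Finset.mul_sum, Finset.sum_mul]
  refine Finset.sum_congr rfl fun b hb => ?_
  obtain ⟨ha0, hd0, had, haN⟩ := mem_indexA ha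
  have hchar := etaChar_inv_mul_inv hN.ne' ha0 hd0 r hw (hxyz a ha b hb) haN
    (by rw [had]; exact hl)
  rw [had] at hchar
  rw [hchar, psi_eq hw hl]
  have he : e ((b : ℂ) * ((l / a : ℕ) : ℂ) * ((n : ℂ) / l - (xN N r : ℂ) / 24))
      = e ((b : ℂ) * ((l / a : ℕ) : ℂ) * ((n : ℂ) / l))
        * e (-((b : ℂ) * ((l / a : ℕ) : ℂ) * xN N r) / 24) := by
    rw [← e_add]
    congr 1
    ring
  rw [he]
  ring

end EtaHecke

/-! ### The expansion theorem -/

open EtaHecke UpperHalfPlane in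
theorem theorem9p7 (N : ℕ) (hN : 0 < N) (r : ℕ → ℤ) (w : ℤ)
    (hw : ∃ m : ℤ, (w : ℚ) / 2 = (1 / 2 : ℚ) * ∑ n ∈ N.divisors, (r n : ℚ) + 2 * m)
    (f : ℍ → ℂ) (hf : IsMeromorphicModularForm N w (etaChar N r) f)
    (l : ℕ) (hl : l ∈ monoidL N r)
    (x y z : ℕ → ℕ → ℤ) (hxyz : IsChoice N l x y z) :
    ∃ (Y₀ : ℝ) (cf cT : ℚ → ℂ), 0 ≤ Y₀ ∧
      IsQExpansion ((xN N r : ℚ) / 24) Y₀ f cf ∧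
      IsQExpansion ((xN N r : ℚ) / 24) Y₀ (heckeT N l w (etaChar N r) x y z f) cT ∧
      (∀ (Y : ℝ) (c : ℚ → ℂ), IsQExpansion ((xN N r : ℚ) / 24) Y f c → c = cf) ∧
      (∀ (Y : ℝ) (c : ℚ → ℂ),
        IsQExpansion ((xN N r : ℚ) / 24) Y (heckeT N l w (etaChar N r) x y z f) c → c = cT) ∧
      ∀ n : ℚ, (∃ j : ℤ, n = (xN N r : ℚ) / 24 + j) →
        cT n = (l : ℂ) ^ (-((w : ℂ) / 2) / 2) * ∑ a ∈ indexA N l,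
          (kronecker a (bigPi N r) : ℂ) * (a : ℂ) ^ ((w : ℂ) / 2) *
            cf ((l : ℚ) * n / (a : ℚ) ^ 2) *
            ∑ b ∈ indexB l a,
              (kronecker (-(N : ℤ) * b) (Nat.gcd a (l / a)) : ℂ) ^ w *
              e ((b : ℂ) * ((l / a : ℕ) : ℂ) * ((n : ℂ) / l - (xN N r : ℂ) / 24)) *
              psi N l r w a b := by
  obtain ⟨i, hi⟩ := hw
  have hw' : w = ∑ n ∈ N.divisors, r n + 4 * i := by
    have h : (w : ℚ) = ((∑ n ∈ N.divisors, r n + 4 * i : ℤ) : ℚ) := by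
      push_cast
      linear_combination 2 * hi
    exact_mod_cast h
  obtain ⟨Y, c, hY, hc⟩ := exists_isQExpansion hf
  have hT := isQExpansion_heckeT hN hw' hl hxyz hY hc
  have hl1 : (1 : ℝ) ≤ l := by exact_mod_cast hl.1
  have hYl : Y ≤ l * Y := by nlinarith
  -- The bound $lY$ ensures that every $(a\tau+b)/d$ lies above height $Y$, and it is at least $Y$,
  -- so the expansion of $f$ is also valid there.
  exact ⟨l * Y, c, heckeCoeff N l r w c, by positivity,
    ⟨hc.1, fun τ hτ => hc.2 τ (lt_of_le_of_lt hYl hτ)⟩, hT, fun _ _ h => h.unique hc,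
    fun _ _ h => h.unique hT, fun _ _ => rfl⟩
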